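/- Let $(M,g)$ be an oriented smooth 4-dimensional space-time of signature $(-,+,+,+)$ with volume element $\eta$, Hodge operator $(*F)_{ab}=\frac12\eta_{abcd}F^{cd}$, product $(F,H)=\frac12F_{ab}H^{ab}$ of (complex) 2-forms, and $(A\cdot B)_{ab}=A_a{}^mB_{mb}$. A self-dual (SD) bivector is a complex 2-form $F$ with $*F=\mathrm iF$; the metric on SD bivectors is $\mathcal G=\frac12(G-\mathrm i\eta)$, where $G_{abmn}=g_{am}g_{bn}-g_{an}g_{bm}$. A double 2-form $P$ acts on 2-forms by $P(F)_{ab}=\frac12P_{ab}{}^{mn}F_{mn}$. Let $W$ be the Weyl tensor, $\mathcal W=\mathcal G\circ W\circ\mathcal G$ the self-dual Weyl tensor, regarded as an endomorphism of the 3-dimensional space of SD bivectors, and $R$ the scalar curvature. The space-time is of (Petrov–Bel) type I at a point if $\mathcal W$ has three different eigenvalues there. A Debever direction is a real null direction spanned by $l$ with $l_{[a}W_{b]cd[e}l_{f]}l^cl^d=0$. A principal direction of a bivector $F$ is a real null direction spanned by $l$ with $F_{ab}l^b=\lambda l_a$ for some $\lambda\in\mathbb C$. Let $U$ be the canonical 2-form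 (volume element of the time-like plane) of a smooth 2+2 structure, with projectors $v=U\cdot U$ and $h=g-v$ on the time-like plane and its orthogonal complement. Assume that the structure is umbilical, i.e. the symmetric parts of the generalized second fundamental forms $h(\nabla_{v(X)}v(Y))$ and $v(\nabla_{h(X)}h(Y))$ of the two planes are pure trace. Put $\mathcal U=\frac1{\sqrt2}(U-\mathrm i{*U})$, $\xi=\delta\,\mathcal U$ (that is, $\xi_b=-\nabla^a\mathcal U_{ab}$), $\chi_b=\xi^a\mathcal U_{ab}$, let $A$ be the antisymmetric part of $T=\nabla\xi-\chi\otimes\xi$, and put $$\Omega=-\Big[\frac R{12}+(A,\mathcal U)\Big],\qquad \mathcal Z=A_\perp=(\mathcal U\otimes\mathcal U+\mathcal G)(A).$$ At every point at which the space-time is of type I the following holds. (1) $\mathcal U$ and $3\Omega\,\mathcal U+2\mathcal Z$ are SD bivectors, there are exactly four (different) Debever directions, and these are the two principal directions of $\mathcal U$ and the two principal directions of $3\Omega\,\mathcal U+2\mathcal Z$. (2) Let $\alpha$ be either square root of $9\Omega^2-4(\mathcal Z,\mathcal Z)$. The three different eigenvalues of $\mathcal W$ are $$\rho_3=\Omega,\qquad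 \rho_1=\tfrac12(-\Omega+\alpha),\qquad \rho_2=\tfrac12(-\Omega-\alpha),$$ and the SD bivectors $F$ with $\mathcal W(F)=\rho_iF$ are, respectively, exactly the complex multiples of the SD bivectors $$\mathcal U\cdot\mathcal Z,\qquad (3\Omega-\alpha)\,\mathcal U+2\mathcal Z,\qquad (3\Omega+\alpha)\,\mathcal U+2\mathcal Z .$$ These three can be multiplied by complex numbers so as to become an orthonormal frame $\{\mathcal U_i\}$, $(\mathcal U_i,\mathcal U_j)=-\delta_{ij}$. Hence the members of every orthonormal frame of eigenbivectors of $\mathcal W$ are proportional to them. -/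

import Mathlib

open scoped Manifold ContDiff

noncomputable section

namespace Umbilical

/-- The model space of a four-dimensional manifold. -/
abbrev Coord : Type := EuclideanSpace ℝ (Fin 4)

/-- Covariant components of a (complex) 2-tensor at a point. -/
abbrev T2 : Type := Matrix (Fin 4) (Fin 4) ℂ

/-- Covariant components of a (complex) 4-tensor (in particular of a double 2-form) at a point. -/
abbrev T4 : Type := Fin 4 → Fin 4 → Fin 4 → Fin 4 → ℂ

/-! ### Algebra of 2-tensors and double 2-forms at a point

All tensors are given by their covariant components; `g` is the matrix of the metric and `g⁻¹`
the matrix of its contravariant components. -/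

/-- Contravariant components `F^{ab}`. -/
def raise (g F : T2) : T2 := fun a b => ∑ m, ∑ n, g⁻¹ a m * g⁻¹ b n * F m n

/-- `(F, H) = (1/2) F_{ab} H^{ab}`. -/
def ip (g F H : T2) : ℂ := (1 / 2) * ∑ a, ∑ b, F a b * raise g H a b

/-- `(A · B)_{ab} = A_a^m B_{mb}`. -/
def dot (g A B : T2) : T2 := A * g⁻¹ * B

/-- The exterior product of double forms,
`(A ∧ B)_{abmn} = A_{am} B_{bn} + A_{bn} B_{am} - A_{an} B_{bm} - A_{bm} B_{an}`. -/
def wedge (A B : T2) : T4 := fun a b m n =>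
  A a m * B b n + A b n * B a m - A a n * B b m - A b m * B a n

/-- `P(F)_{ab} = (1/2) P_{ab}^{mn} F_{mn}`. -/
def app (g : T2) (P : T4) (F : T2) : T2 := fun a b =>
  (1 / 2) * ∑ m, ∑ n, P a b m n * raise g F m n

/-- `(P ∘ Q)_{abrs} = (1/2) P_{ab}^{mn} Q_{mnrs}`. -/
def comp (g : T2) (P Q : T4) : T4 := fun a b r s =>
  (1 / 2) * ∑ m, ∑ n, P a b m n * raise g (fun i j => Q i j r s) m n

/-- `(F ⊗ H)_{abmn} = F_{ab} H_{mn}`. -/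
def tensor (F H : T2) : T4 := fun a b m n => F a b * H m n

/-- The Hodge dual `(*F)_{ab} = (1/2) η_{abmn} F^{mn}` for the volume element `η`. -/
def star (g : T2) (η : T4) (F : T2) : T2 := app g η F

/-- The metric on 2-forms, `G = (1/2) g ∧ g`. -/
def metricG (g : T2) : T4 := (1 / 2 : ℂ) • wedge g g

/-- The metric on self-dual 2-forms, `𝒢 = (1/2) (G - i η)`. -/
def metricSD (g : T2) (η : T4) : T4 := (1 / 2 : ℂ) • (metricG g - Complex.I • η)

/-- SD bivectors: complex 2-forms with `*F = i F`. -/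
def IsSD (g : T2) (η : T4) (F : T2) : Prop :=
  F.transpose = -F ∧ star g η F = Complex.I • F

/-- The SD bivector `(1/√2) (F - i *F)` associated with a 2-form `F`. -/
def toSD (g : T2) (η : T4) (F : T2) : T2 :=
  (1 / (Real.sqrt 2 : ℂ)) • (F - Complex.I • star g η F)

/-- `𝒢_⊥ = 𝒰 ⊗ 𝒰 + 𝒢`, the metric on (and projector onto) the SD bivectors orthogonal to the
unitary SD bivector `𝒰`. -/
def metricPerp (g : T2) (η : T4) (u : T2) : T4 := tensor u u + metricSD g η

/-! ### Null directions -/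

/-- The covector `l_a = g_{ab} l^b` of a real vector `l`. -/
def lowerVec (g : T2) (l : Fin 4 → ℝ) : Fin 4 → ℂ := fun a => ∑ b, g a b * (l b : ℂ)

/-- `l` is a real, non-zero null vector. -/
def IsNullVec (g : T2) (l : Fin 4 → ℝ) : Prop :=
  l ≠ 0 ∧ ∑ a, lowerVec g l a * (l a : ℂ) = 0

/-- `l` spans a principal direction of the bivector `F`: it is null and `F_{ab} l^b = lam l_a`. -/
def IsPrincipalVec (g F : T2) (l : Fin 4 → ℝ) : Prop :=
  IsNullVec g l ∧ ∃ lam : ℂ, ∀ a, ∑ b, F a b * (l b : ℂ) = lam * lowerVec g l a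

/-- `l` spans a Debever principal null direction of the Weyl tensor `W`: it is null and
`l_{[a} W_{b]cd[e} l_{f]} l^c l^d = 0`. -/
def IsDebeverVec (g : T2) (W : T4) (l : Fin 4 → ℝ) : Prop :=
  IsNullVec g l ∧
  let k := lowerVec g l
  let N : T2 := fun b e => ∑ c, ∑ d, W b c d e * (l c : ℂ) * (l d : ℂ)
  ∀ a b e f, k a * N b e * k f - k b * N a e * k f - k a * N b f * k e + k b * N a f * k e = 0

/-! ### Differential calculus in a coordinate domain

Here `g` and the other arguments are the component functions of tensor fields. -/

/-- The partial derivative `∂_i f`. -/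
def pd (i : Fin 4) (f : Coord → ℂ) (x : Coord) : ℂ :=
  fderiv ℝ f x (EuclideanSpace.single i 1)

/-- Christoffel symbols `Γ^k_{ij}` of the Levi-Civita connection. -/
def christoffel (g : Coord → T2) (x : Coord) (k i j : Fin 4) : ℂ :=
  (1 / 2) * ∑ l, (g x)⁻¹ k l *
    (pd i (fun y => g y j l) x + pd j (fun y => g y i l) x - pd l (fun y => g y i j) x)

/-- `∇_i w_j`. -/
def cov1 (g : Coord → T2) (w : Coord → Fin 4 → ℂ) (x : Coord) : T2 := fun i j =>
  pd i (fun y => w y j) x - ∑ m, christoffel g x m i j * w x m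

/-- `∇_c F_{ij}`. -/
def cov2 (g F : Coord → T2) (x : Coord) (c i j : Fin 4) : ℂ :=
  pd c (fun y => F y i j) x - ∑ m, christoffel g x m c i * F x m j
    - ∑ m, christoffel g x m c j * F x i m

/-- The Riemann tensor with all indices down, `R_{klij} = g_{kn} R^n_{lij}` with
`R^n_{lij} = ∂_i Γ^n_{jl} - ∂_j Γ^n_{il} + Γ^n_{im} Γ^m_{jl} - Γ^n_{jm} Γ^m_{il}`. -/
def riemann (g : Coord → T2) (x : Coord) : T4 := fun k l i j =>
  ∑ n, g x k n *
    (pd i (fun y => christoffel g y n j l) x - pd j (fun y => christoffel g y n i l) x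
      + ∑ m, (christoffel g x n i m * christoffel g x m j l
        - christoffel g x n j m * christoffel g x m i l))

/-- The Ricci tensor `R_{lj} = R^i_{lij}`. -/
def ricci (g : Coord → T2) (x : Coord) : T2 := fun l j =>
  ∑ k, ∑ i, (g x)⁻¹ k i * riemann g x k l i j

/-- The scalar curvature. -/
def scalarCurv (g : Coord → T2) (x : Coord) : ℂ :=
  ∑ i, ∑ j, (g x)⁻¹ i j * ricci g x i j

/-- The Weyl tensor `W = Riem - (1/2) Ric ∧ g + (R/6) G`. -/
def weyl (g : Coord → T2) (x : Coord) : T4 :=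
  riemann g x - (1 / 2 : ℂ) • wedge (ricci g x) (g x)
    + (scalarCurv g x / 6) • metricG (g x)

/-- The self-dual Weyl tensor `𝒲 = 𝒢 ∘ W ∘ 𝒢`. -/
def weylSD (g : Coord → T2) (η : Coord → T4) (x : Coord) : T4 :=
  comp (g x) (comp (g x) (metricSD (g x) (η x)) (weyl g x)) (metricSD (g x) (η x))

/-- Petrov-Bel type I at a point: the endomorphism defined by `𝒲` on the (three-dimensional) space
of SD bivectors has three different eigenvalues. -/
def IsTypeI (g : Coord → T2) (η : Coord → T4) (x : Coord) : Prop :=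
  ∃ ρ : Fin 3 → ℂ, Function.Injective ρ ∧
    ∀ i, ∃ F : T2, F ≠ 0 ∧ IsSD (g x) (η x) F ∧ app (g x) (weylSD g η x) F = ρ i • F

/-! ### 2+2 structures -/

/-- The plane with projector `v` is umbilical at `x`, where `h` is the projector on the orthogonal
plane (`v`, `h` with both indices down). The generalized second fundamental form
`Q(X, Y) = h(∇_{v(X)} v(Y))` has components `Q_{cab} = h_c^d v_a^e ∇_e v_{db}`
(`c` being the index of its value); umbilical means that its symmetric part is pure trace,
`Q_{c(ab)} = (1/2) v_{ab} g^{mn} Q_{cmn}`. -/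
def PlaneUmbilicalAt (g v h : Coord → T2) (x : Coord) : Prop :=
  let Q : Fin 4 → T2 := fun c a b =>
    ∑ d, ∑ e, (h x * (g x)⁻¹) c d * (v x * (g x)⁻¹) a e * cov2 g v x e d b
  ∀ c a b, (1 / 2) * (Q c a b + Q c b a)
    = (1 / 2) * v x a b * ∑ m, ∑ n, (g x)⁻¹ m n * Q c m n

/-- The projector `v = U²` on the time-like plane with volume element `U`. -/
def projV (g U : Coord → T2) (x : Coord) : T2 := dot (g x) (U x) (U x)

/-- The projector `h = g - v` on the orthogonal space-like plane. -/
def projH (g U : Coord → T2) (x : Coord) : T2 := g x - projV g U x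

/-- The 2+2 structure is umbilical at `x`: both planes are. -/
def UmbilicalAt (g U : Coord → T2) (x : Coord) : Prop :=
  PlaneUmbilicalAt g (projV g U) (projH g U) x ∧ PlaneUmbilicalAt g (projH g U) (projV g U) x

/-- The canonical SD bivector `𝒰 = (1/√2) (U - i *U)`. -/
def canSD (g : Coord → T2) (η : Coord → T4) (U : Coord → T2) (x : Coord) : T2 :=
  toSD (g x) (η x) (U x)

/-- `ξ = δ𝒰`, with `δ` the exterior codifferential, `(δF)_b = -∇^a F_{ab}`. -/
def xi (g : Coord → T2) (η : Coord → T4) (U : Coord → T2) (x : Coord) : Fin 4 → ℂ := fun b =>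
  -∑ c, ∑ a, (g x)⁻¹ c a * cov2 g (canSD g η U) x c a b

/-- `χ = i_ξ 𝒰`, i.e. `χ_b = ξ^a 𝒰_{ab}`. -/
def chi (g : Coord → T2) (η : Coord → T4) (U : Coord → T2) (x : Coord) : Fin 4 → ℂ := fun b =>
  ∑ c, ∑ a, (g x)⁻¹ c a * xi g η U x c * canSD g η U x a b

/-- The antisymmetric part `A` of `T = ∇ξ - χ ⊗ ξ`. -/
def tensorA (g : Coord → T2) (η : Coord → T4) (U : Coord → T2) (x : Coord) : T2 :=
  let T : T2 := fun a b => cov1 g (xi g η U) x a b - chi g η U x a * xi g η U x b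
  (1 / 2 : ℂ) • (T - T.transpose)

/-- `Ω = -(R/12 + (A, 𝒰))`. -/
def Omega (g : Coord → T2) (η : Coord → T4) (U : Coord → T2) (x : Coord) : ℂ :=
  -(scalarCurv g x / 12 + ip (g x) (tensorA g η U x) (canSD g η U x))

/-- `𝒵 = A_⊥ = 𝒢_⊥(A)`. -/
def Zed (g : Coord → T2) (η : Coord → T4) (U : Coord → T2) (x : Coord) : T2 :=
  app (g x) (metricPerp (g x) (η x) (canSD g η U x)) (tensorA g η U x)

/-! ### Space-times -/

section Manifold

variable {M : Type*} [TopologicalSpace M] [ChartedSpace Coord M]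

/-- The coordinate vector `∂_a` of the chart `e` at the point with coordinates `x`. -/
def coordVec (e : OpenPartialHomeomorph M Coord) (x : Coord) (a : Fin 4) :
    TangentSpace (𝓡 4) (e.symm x) :=
  mfderiv (𝓡 4) (𝓡 4) e.symm x (EuclideanSpace.single a (1 : ℝ) : Coord)

variable (M) in
/-- An oriented space-time structure on the four-dimensional manifold `M`: a smooth metric `g` of
signature `(-, +, +, +)` and its volume element `η` (a smooth 4-form which takes the value `1` on
the oriented orthonormal bases). -/
structure SpaceTime [IsManifold (𝓡 4) ∞ M] where
  g : ∀ p : M, LinearMap.BilinForm ℝ (TangentSpace (𝓡 4) p)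
  η : ∀ p : M, (TangentSpace (𝓡 4) p) [⋀^Fin 4]→ₗ[ℝ] ℝ
  g_symm : ∀ p v w, g p v w = g p w v
  orthonormal : ∀ p, ∃ b : Module.Basis (Fin 4) ℝ (TangentSpace (𝓡 4) p),
    (∀ i j, g p (b i) (b j) = if i = j then (if i = 0 then -1 else 1) else 0) ∧ η p b = 1
  g_smooth : ∀ e ∈ IsManifold.maximalAtlas (𝓡 4) ∞ M, ∀ a b,
    ContDiffOn ℝ ∞ (fun x => g (e.symm x) (coordVec e x a) (coordVec e x b)) e.target
  η_smooth : ∀ e ∈ IsManifold.maximalAtlas (𝓡 4) ∞ M,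
    ContDiffOn ℝ ∞ (fun x => η (e.symm x) (coordVec e x)) e.target

variable [IsManifold (𝓡 4) ∞ M]

/-- A 2+2 structure, given by its canonical 2-form: a smooth 2-form which at every point is the
volume element `e₀ ∧ e₁` of a time-like plane with orthonormal basis `e₀, e₁`. -/
structure TwoTwo (S : SpaceTime M) where
  U : ∀ p : M, LinearMap.BilinForm ℝ (TangentSpace (𝓡 4) p)
  volume_form : ∀ p, ∃ e₀ e₁ : TangentSpace (𝓡 4) p,
    S.g p e₀ e₀ = -1 ∧ S.g p e₁ e₁ = 1 ∧ S.g p e₀ e₁ = 0 ∧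
    ∀ v w, U p v w = S.g p e₀ v * S.g p e₁ w - S.g p e₀ w * S.g p e₁ v
  U_smooth : ∀ e ∈ IsManifold.maximalAtlas (𝓡 4) ∞ M, ∀ a b,
    ContDiffOn ℝ ∞ (fun x => U (e.symm x) (coordVec e x a) (coordVec e x b)) e.target

/-- The components of the metric in the chart `e`. -/
def SpaceTime.gC (S : SpaceTime M) (e : OpenPartialHomeomorph M Coord) (x : Coord) : T2 :=
  fun a b => (S.g (e.symm x) (coordVec e x a) (coordVec e x b) : ℂ)

/-- The components of the volume element in the chart `e`. -/
def SpaceTime.ηC (S : SpaceTime M) (e : OpenPartialHomeomorph M Coord) (x : Coord) : T4 :=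
  fun a b c d =>
    (S.η (e.symm x) ![coordVec e x a, coordVec e x b, coordVec e x c, coordVec e x d] : ℂ)

/-- The components of the canonical 2-form in the chart `e`. -/
def TwoTwo.UC {S : SpaceTime M} (B : TwoTwo S) (e : OpenPartialHomeomorph M Coord) (x : Coord) :
    T2 :=
  fun a b => (B.U (e.symm x) (coordVec e x a) (coordVec e x b) : ℂ)

/-- The 2+2 structure is umbilical: both planes are, at every point and in every chart. -/
def TwoTwo.IsUmbilical {S : SpaceTime M} (B : TwoTwo S) : Prop :=
  ∀ e ∈ IsManifold.maximalAtlas (𝓡 4) ∞ M, ∀ x ∈ e.target, UmbilicalAt (S.gC e) (B.UC e) x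

end Manifold

end Umbilical

end

/-! The umbilical condition says that the whole covariant derivative of the canonical SD bivector
`u` is determined by its divergence `ξ`: `∇_c u = 𝒢_⊥(ξ ∧ g_c)` (`covM_canSD_of_umbilical`), where
`𝒢_⊥` is realised as `X ↦ X/2 - u·X·u` (`perp`). This is an overdetermined first order equation.
Antisymmetrizing a second derivative and using the Ricci identity gives its integrability conditions
(`curv_of_covM_eq`): the commutator of the curvature with `u` equals an expression in `∇ξ` and `ξ`
alone.

That commutator sees exactly the part of the curvature with one SD index orthogonal to `u`. In an
orthonormal frame adapted to the two planes, its components on pairs of SD bivectors are expressed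
by the antisymmetric tensor `A` (`frame_integ`). The remaining diagonal component follows because
the Weyl tensor is trace-free, so that, up to complex conjugation (`frame_weyl`), `𝒲 = 3Ω u⊗u + u⊗Z
+ Z⊗u + Ω 𝒢`. The rest is algebra of this one tensor, with `Z = (0, b, c)` and `u = (1/√2)(1, 0, 0)`
in a basis of SD bivectors, and `q = b² + c² = -(Z,Z)/2`.

Eigenvalues: the SD bivector orthogonal to both `u` and `Z` has eigenvalue `Ω`. On the span of `u`
and `Z` the characteristic equation is `ρ² + Ωρ - 2Ω² - 2q = 0`, of discriminant `9Ω² + 8q = α²`.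
Three different eigenvalues force `q ≠ 0` and `α ≠ 0` (`frame_typeI`), and then the eigenbivectors
are explicit (`frame_eigen`).

Debever directions: real null vectors are given by spinors `(s, t)`, and an SD bivector becomes a
binary quadratic form vanishing exactly on its principal directions. Put `V = 3Ωu + 2Z`. Since `2(3Ω
u⊗u + u⊗Z + Z⊗u) = u⊗V + V⊗u`, and `𝒢` contributes nothing on a null direction, the quartic of the
Weyl tensor is the product of the quadratic forms of `u` and `V`. The form of `u` has nonzero
discriminant, that of `V` has discriminant proportional to `α²`, and a common root would mean `q =
0`; hence there are four different directions (`frame_debever`).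

The frame computations are carried back to an arbitrary chart by the naturality of every
construction under a change of frame (`IsFrame`), which gives `debever_and_eigen_of_curvature`. An
adapted oriented orthonormal frame exists at each point by `exists_frame`; it need not be smooth,
because derivatives are taken in coordinates and only their values are expressed in the frame. -/

open scoped Manifold ContDiff

noncomputable section

namespace Umbilical

/-! ### Partial derivatives and matrix-valued functions -/

/-- Smoothness of the components of a matrix-valued function. -/
def SmoothM (F : Coord → T2) (x : Coord) : Prop :=
  ∀ a b, ContDiffAt ℝ ∞ (fun y => F y a b) x

/-- The entrywise partial derivative of a matrix-valued function. -/
def pdM (F : Coord → T2) (x : Coord) (c : Fin 4) : T2 :=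
  Matrix.of fun a b => pd c (fun y => F y a b) x

lemma pd_congr {f h : Coord → ℂ} {x : Coord} (i : Fin 4) (hf : f =ᶠ[nhds x] h) :
    pd i f x = pd i h x := by
  unfold pd; rw [hf.fderiv_eq]

lemma smooth_diff {f : Coord → ℂ} {x : Coord} (hf : ContDiffAt ℝ ∞ f x) :
    DifferentiableAt ℝ f x := hf.differentiableAt (by simp)

lemma pd_smooth {f : Coord → ℂ} {x : Coord} (i : Fin 4) (hf : ContDiffAt ℝ ∞ f x) :
    ContDiffAt ℝ ∞ (fun y => pd i f y) x :=
  (hf.fderiv_right (m := ∞) (by simp)).clm_apply contDiffAt_const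

lemma pd_sub {f h : Coord → ℂ} {x : Coord} (i : Fin 4) (hf : DifferentiableAt ℝ f x)
    (hh : DifferentiableAt ℝ h x) : pd i (fun y => f y - h y) x = pd i f x - pd i h x := by
  unfold pd; rw [fderiv_fun_sub hf hh]; rfl

lemma pd_mul {f h : Coord → ℂ} {x : Coord} (i : Fin 4) (hf : DifferentiableAt ℝ f x)
    (hh : DifferentiableAt ℝ h x) :
    pd i (fun y => f y * h y) x = pd i f x * h x + f x * pd i h x := by
  unfold pd; rw [fderiv_fun_mul hf hh]; simp; ring

lemma pd_sum {f : Fin 4 → Coord → ℂ} {x : Coord} (i : Fin 4)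
    (hf : ∀ m, DifferentiableAt ℝ (f m) x) :
    pd i (fun y => ∑ m, f m y) x = ∑ m, pd i (f m) x := by
  unfold pd; rw [fderiv_fun_sum (fun m _ => hf m)]; simp

lemma pd_const (c : ℂ) (x : Coord) (i : Fin 4) : pd i (fun _ => c) x = 0 := by
  simp [pd]

lemma pd_const_mul {f : Coord → ℂ} {x : Coord} (i : Fin 4) (c : ℂ)
    (hf : DifferentiableAt ℝ f x) : pd i (fun y => c * f y) x = c * pd i f x := by
  rw [pd_mul i (differentiableAt_const c) hf, pd_const]; ring

lemma pd_comm {f : Coord → ℂ} {x : Coord} (i j : Fin 4) (hf : ContDiffAt ℝ ∞ f x) :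
    pd i (fun y => pd j f y) x = pd j (fun y => pd i f y) x := by
  have hd : DifferentiableAt ℝ (fderiv ℝ f) x :=
    (hf.fderiv_right (m := ∞) (by simp)).differentiableAt (by simp)
  have key : ∀ i j : Fin 4, pd i (fun y => pd j f y) x =
      fderiv ℝ (fderiv ℝ f) x (EuclideanSpace.single i 1) (EuclideanSpace.single j 1) := by
    intro i j
    unfold pd
    rw [fderiv_clm_apply hd (differentiableAt_const _)]
    simp
  rw [key, key]
  have h2 : ((2 : ℕ∞) : WithTop ℕ∞) ≤ ((⊤ : ℕ∞) : WithTop ℕ∞) := WithTop.coe_le_coe.2 le_top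
  exact (hf.isSymmSndFDerivAt (by simpa using h2)).eq _ _

lemma pd_conj {f : Coord → ℂ} {x : Coord} (i : Fin 4) :
    pd i (fun y => (starRingEnd ℂ) (f y)) x = (starRingEnd ℂ) (pd i f x) := by
  have := (Complex.conjCLE : ℂ ≃L[ℝ] ℂ).comp_fderiv (f := f) (x := x)
  unfold pd
  have h2 : (fun y => (starRingEnd ℂ) (f y)) = (Complex.conjCLE : ℂ ≃L[ℝ] ℂ) ∘ f := by
    ext y; simp
  rw [h2, this]; simp

lemma SmoothM.diff {F : Coord → T2} {x : Coord} (hF : SmoothM F x) (a b : Fin 4) :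
    DifferentiableAt ℝ (fun y => F y a b) x := smooth_diff (hF a b)

lemma SmoothM.mul {F H : Coord → T2} {x : Coord} (hF : SmoothM F x) (hH : SmoothM H x) :
    SmoothM (fun y => F y * H y) x := by
  intro a b
  simp only [Matrix.mul_apply]
  exact ContDiffAt.sum fun m _ => (hF a m).mul (hH m b)

lemma SmoothM.sub {F H : Coord → T2} {x : Coord} (hF : SmoothM F x) (hH : SmoothM H x) :
    SmoothM (fun y => F y - H y) x := fun a b => (hF a b).sub (hH a b)

lemma SmoothM.smul {F : Coord → T2} {x : Coord} (c : ℂ) (hF : SmoothM F x) :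
    SmoothM (fun y => c • F y) x := fun a b => contDiffAt_const.mul (hF a b)

lemma SmoothM.transpose {F : Coord → T2} {x : Coord} (hF : SmoothM F x) :
    SmoothM (fun y => (F y).transpose) x := fun a b => hF b a

lemma SmoothM.pdM {F : Coord → T2} {x : Coord} (hF : SmoothM F x) (c : Fin 4) :
    SmoothM (fun y => pdM F y c) x := fun a b => pd_smooth c (hF a b)

lemma pdM_congr {F H : Coord → T2} {x : Coord} (c : Fin 4) (h : F =ᶠ[nhds x] H) :
    pdM F x c = pdM H x c := by
  ext a b
  exact pd_congr c (h.mono fun y hy => by simp [hy])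

lemma pdM_mul {F H : Coord → T2} {x : Coord} (hF : SmoothM F x) (hH : SmoothM H x) (c : Fin 4) :
    pdM (fun y => F y * H y) x c = pdM F x c * H x + F x * pdM H x c := by
  ext a b
  simp only [pdM, Matrix.of_apply, Matrix.add_apply, Matrix.mul_apply]
  rw [pd_sum (f := fun m y => F y a m * H y m b) c fun m => (hF.diff a m).mul (hH.diff m b),
    ← Finset.sum_add_distrib]
  exact Finset.sum_congr rfl fun m _ => pd_mul c (hF.diff a m) (hH.diff m b)

lemma pdM_sub {F H : Coord → T2} {x : Coord} (hF : SmoothM F x) (hH : SmoothM H x) (c : Fin 4) :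
    pdM (fun y => F y - H y) x c = pdM F x c - pdM H x c := by
  ext a b; exact pd_sub c (hF.diff a b) (hH.diff a b)

lemma pdM_smul {F : Coord → T2} {x : Coord} (k : ℂ) (hF : SmoothM F x) (c : Fin 4) :
    pdM (fun y => k • F y) x c = k • pdM F x c := by
  ext a b; exact pd_const_mul c k (hF.diff a b)

lemma pdM_transpose (F : Coord → T2) (x : Coord) (c : Fin 4) :
    pdM (fun y => (F y).transpose) x c = (pdM F x c).transpose := rfl

lemma pdM_const (A : T2) (x : Coord) (c : Fin 4) : pdM (fun _ => A) x c = 0 := by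
  ext a b; exact pd_const _ _ _

lemma pdM_comm {F : Coord → T2} {x : Coord} (hF : SmoothM F x) (c d : Fin 4) :
    pdM (fun y => pdM F y c) x d = pdM (fun y => pdM F y d) x c := by
  ext a b; exact pd_comm d c (hF a b)

lemma smooth_det {F : Coord → T2} {x : Coord} (hF : SmoothM F x) :
    ContDiffAt ℝ ∞ (fun y => (F y).det) x := by
  simp only [Matrix.det_apply']
  exact ContDiffAt.sum fun σ _ => contDiffAt_const.mul (contDiffAt_prod fun i _ => hF _ _)

lemma SmoothM.inv {F : Coord → T2} {x : Coord} (hF : SmoothM F x) (h0 : (F x).det ≠ 0) :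
    SmoothM (fun y => (F y)⁻¹) x := by
  intro a b
  simp only [Matrix.inv_def, Ring.inverse_eq_inv', Matrix.smul_apply, smul_eq_mul,
    Matrix.adjugate_apply]
  refine ((smooth_det hF).inv h0).mul (smooth_det fun i j => ?_)
  by_cases h : i = b
  · subst h; simpa using contDiffAt_const
  · simpa [Matrix.updateRow_ne h] using hF i j

/-- A metric in a neighbourhood of `x`: smooth, symmetric, real and non-degenerate. -/
structure IsMetricNear (g : Coord → T2) (x : Coord) : Prop where
  smooth : ∀ᶠ y in nhds x, SmoothM g y
  symm : ∀ᶠ y in nhds x, (g y).transpose = g y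
  det : ∀ᶠ y in nhds x, (g y).det ≠ 0
  real : ∀ᶠ y in nhds x, ∀ a b, (starRingEnd ℂ) (g y a b) = g y a b

lemma IsMetricNear.eventually {g : Coord → T2} {x : Coord} (h : IsMetricNear g x) :
    ∀ᶠ y in nhds x, IsMetricNear g y := by
  filter_upwards [h.smooth.eventually_nhds, h.symm.eventually_nhds, h.det.eventually_nhds,
    h.real.eventually_nhds] with y h1 h2 h3 h4 using ⟨h1, h2, h3, h4⟩

/-- The matrices `(Γ_c)^k_j` of the Levi-Civita connection. -/
def conn (g : Coord → T2) (x : Coord) (c : Fin 4) : T2 :=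
  Matrix.of fun k j => christoffel g x k c j

/-- The matrices `∇_c F`. -/
def covM (g F : Coord → T2) (x : Coord) (c : Fin 4) : T2 := Matrix.of (cov2 g F x c)

/-- The curvature matrices `(R_{dc})^n_l`. -/
def curv (g : Coord → T2) (x : Coord) (d c : Fin 4) : T2 :=
  pdM (fun y => conn g y c) x d - pdM (fun y => conn g y d) x c
    + conn g x d * conn g x c - conn g x c * conn g x d

lemma covM_eq (g F : Coord → T2) (x : Coord) (c : Fin 4) :
    covM g F x c = pdM F x c - (conn g x c).transpose * F x - F x * conn g x c := by
  ext i j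
  simp [covM, cov2, pdM, conn, Matrix.mul_apply, mul_comm]

section

variable {g : Coord → T2} {x : Coord} (hg : IsMetricNear g x)

include hg

lemma IsMetricNear.symm_apply (a b : Fin 4) : ∀ᶠ y in nhds x, g y a b = g y b a :=
  hg.symm.mono fun y hy => by
    conv_lhs => rw [← hy]
    rfl

lemma IsMetricNear.pd_symm (c a b : Fin 4) :
    pd c (fun y => g y a b) x = pd c (fun y => g y b a) x := pd_congr c (hg.symm_apply a b)

lemma IsMetricNear.mul_inv : g x * (g x)⁻¹ = 1 :=
  Matrix.mul_nonsing_inv _ (isUnit_iff_ne_zero.mpr hg.det.self_of_nhds)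

lemma IsMetricNear.inv_mul : (g x)⁻¹ * g x = 1 :=
  Matrix.nonsing_inv_mul _ (isUnit_iff_ne_zero.mpr hg.det.self_of_nhds)

lemma IsMetricNear.smooth_inv : SmoothM (fun y => (g y)⁻¹) x :=
  hg.smooth.self_of_nhds.inv hg.det.self_of_nhds

lemma conn_smooth (c : Fin 4) : SmoothM (fun y => conn g y c) x := by
  intro k j
  have h1 := hg.smooth.self_of_nhds
  have h2 := hg.smooth_inv
  simp only [conn, Matrix.of_apply, christoffel]
  exact contDiffAt_const.mul (ContDiffAt.sum fun l _ => (h2 k l).mul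
    (((pd_smooth _ (h1 _ _)).add (pd_smooth _ (h1 _ _))).sub (pd_smooth _ (h1 _ _))))

lemma covM_smooth {F : Coord → T2} (hF : SmoothM F x) (c : Fin 4) :
    SmoothM (fun y => covM g F y c) x := by
  simp only [covM_eq]
  exact ((hF.pdM c).sub ((conn_smooth hg c).transpose.mul hF)).sub (hF.mul (conn_smooth hg c))

lemma conn_symm (k i j : Fin 4) : conn g x i k j = conn g x j k i := by
  simp only [conn, Matrix.of_apply, christoffel]
  congr 1
  refine Finset.sum_congr rfl fun l _ => ?_
  rw [hg.pd_symm l i j]; ring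

/-- The Christoffel symbols of the first kind: lowering the upper index cancels the inverse metric
in `christoffel`. -/
lemma metric_mul_conn (c i j : Fin 4) : (g x * conn g x c) i j =
    (1 / 2) * (pd c (fun y => g y j i) x + pd j (fun y => g y c i) x
      - pd i (fun y => g y c j) x) := by
  let v : Fin 4 → ℂ := fun l => pd c (fun y => g y j l) x + pd j (fun y => g y c l) x
      - pd l (fun y => g y c j) x
  have : (g x).mulVec ((g x)⁻¹.mulVec v) i = v i := by
    rw [Matrix.mulVec_mulVec, hg.mul_inv, Matrix.one_mulVec]
  change _ = (1 / 2) * v i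
  rw [← this]
  simp only [Matrix.mul_apply, conn, Matrix.of_apply, christoffel, Matrix.mulVec, dotProduct]
  rw [Finset.mul_sum]
  refine Finset.sum_congr rfl fun k _ => ?_
  simp only [v]; ring

/-- The metric is parallel. -/
lemma covM_metric (c : Fin 4) : covM g g x c = 0 := by
  rw [covM_eq]
  have h : (conn g x c).transpose * g x = (g x * conn g x c).transpose := by
    rw [Matrix.transpose_mul, hg.symm.self_of_nhds]
  ext i j
  rw [h]
  simp only [Matrix.sub_apply, Matrix.transpose_apply, metric_mul_conn hg, pdM, Matrix.of_apply,
    Matrix.zero_apply]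
  rw [hg.pd_symm i c j, hg.pd_symm j c i, hg.pd_symm c j i, hg.pd_symm i j c, hg.pd_symm j i c]
  ring

lemma pdM_metric (c : Fin 4) :
    pdM g x c = (conn g x c).transpose * g x + g x * conn g x c := by
  have := covM_metric hg c
  rw [covM_eq, sub_sub, sub_eq_zero] at this
  exact this

/-- Obtained by differentiating `g g⁻¹ = 1`. It expresses that the inverse metric is parallel, which
is what the Leibniz rule for `dot` needs. -/
lemma pdM_inv (c : Fin 4) : pdM (fun y => (g y)⁻¹) x c =
    -((g x)⁻¹ * (conn g x c).transpose) - conn g x c * (g x)⁻¹ := by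
  have h1 : pdM (fun y => g y * (g y)⁻¹) x c = 0 := by
    rw [pdM_congr c (H := fun _ => 1), pdM_const]
    exact hg.eventually.mono fun y hy => hy.mul_inv
  rw [pdM_mul hg.smooth.self_of_nhds hg.smooth_inv, pdM_metric hg] at h1
  have h2 : (g x)⁻¹ * (g x * pdM (fun y => (g y)⁻¹) x c) =
      -((g x)⁻¹ * (((conn g x c).transpose * g x + g x * conn g x c) * (g x)⁻¹)) := by
    rw [← mul_neg]; congr 1; exact eq_neg_of_add_eq_zero_right h1
  rw [← mul_assoc, hg.inv_mul, one_mul] at h2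
  rw [h2, add_mul, mul_assoc _ (g x), hg.mul_inv, mul_one, mul_add, mul_assoc (g x),
    ← mul_assoc _ (g x), hg.inv_mul, one_mul]
  abel

/-- The Leibniz rule for the product of 2-tensors. -/
lemma covM_dot {F H : Coord → T2} (hF : SmoothM F x) (hH : SmoothM H x) (c : Fin 4) :
    covM g (fun y => dot (g y) (F y) (H y)) x c =
      dot (g x) (covM g F x c) (H x) + dot (g x) (F x) (covM g H x c) := by
  simp only [covM_eq, dot]
  rw [pdM_mul (hF.mul hg.smooth_inv) hH, pdM_mul hF hg.smooth_inv, pdM_inv hg]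
  noncomm_ring

omit hg in
lemma covM_congr {F H : Coord → T2} (c : Fin 4) (h : F =ᶠ[nhds x] H) :
    covM g F x c = covM g H x c := by
  rw [covM_eq, covM_eq, pdM_congr c h, h.eq_of_nhds]

omit hg in
lemma covM_sub {F H : Coord → T2} (hF : SmoothM F x) (hH : SmoothM H x) (c : Fin 4) :
    covM g (fun y => F y - H y) x c = covM g F x c - covM g H x c := by
  rw [covM_eq, covM_eq, covM_eq, pdM_sub hF hH]; noncomm_ring

omit hg in
lemma covM_smul {F : Coord → T2} (k : ℂ) (hF : SmoothM F x) (c : Fin 4) :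
    covM g (fun y => k • F y) x c = k • covM g F x c := by
  rw [covM_eq, covM_eq, pdM_smul k hF, Matrix.mul_smul, Matrix.smul_mul, smul_sub, smul_sub]

omit hg in
lemma covM_transpose (F : Coord → T2) (c : Fin 4) :
    covM g (fun y => (F y).transpose) x c = (covM g F x c).transpose := by
  rw [covM_eq, covM_eq, pdM_transpose]
  simp only [Matrix.transpose_sub, Matrix.transpose_mul, Matrix.transpose_transpose]
  abel

/-- The Ricci identity. -/
lemma ricci_identity {F : Coord → T2} (hF : SmoothM F x) (d c : Fin 4) :
    covM g (fun y => covM g F y c) x d - covM g (fun y => covM g F y d) x c =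
      -((curv g x d c).transpose * F x) - F x * curv g x d c := by
  have key : ∀ d c, covM g (fun y => covM g F y c) x d =
      pdM (fun y => pdM F y c) x d
      - ((pdM (fun y => conn g y c) x d).transpose * F x + (conn g x c).transpose * pdM F x d)
      - (pdM F x d * conn g x c + F x * pdM (fun y => conn g y c) x d)
      - (conn g x d).transpose *
        (pdM F x c - (conn g x c).transpose * F x - F x * conn g x c)
      - (pdM F x c - (conn g x c).transpose * F x - F x * conn g x c) * conn g x d := by
    intro d c
    rw [covM_eq, covM_eq]
    have hc := conn_smooth hg c
    have h1 : pdM (fun y => covM g F y c) x d = pdM (fun y => pdM F y c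
        - (conn g y c).transpose * F y - F y * conn g y c) x d := by
      simp only [covM_eq]
    rw [h1, pdM_sub ((hF.pdM c).sub (hc.transpose.mul hF)) (hF.mul hc),
      pdM_sub (hF.pdM c) (hc.transpose.mul hF), pdM_mul hc.transpose hF, pdM_mul hF hc,
      pdM_transpose]
  rw [key, key, pdM_comm hF c d, curv]
  simp only [Matrix.transpose_sub, Matrix.transpose_add, Matrix.transpose_mul]
  noncomm_ring

omit hg in
lemma riemann_eq (k l d c : Fin 4) : riemann g x k l d c = (g x * curv g x d c) k l := by
  simp only [riemann, curv, Matrix.mul_apply, Matrix.sub_apply, Matrix.add_apply, pdM,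
    Matrix.of_apply, conn]
  refine Finset.sum_congr rfl fun n _ => ?_
  rw [Finset.sum_sub_distrib]; ring

omit hg in
lemma riemann_antisymm_right (k l d c : Fin 4) : riemann g x k l c d = -riemann g x k l d c := by
  have h : curv g x c d = -curv g x d c := by simp only [curv]; abel
  rw [riemann_eq, riemann_eq, h, mul_neg, Matrix.neg_apply]

/-- The Ricci identity applied to `g` itself: the metric is parallel, so the left side vanishes. -/
lemma riemann_antisymm_left (k l d c : Fin 4) : riemann g x l k d c = -riemann g x k l d c := by
  have h := ricci_identity hg hg.smooth.self_of_nhds d c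
  have h0 : ∀ d c, covM g (fun y => covM g g y c) x d = 0 := by
    intro d c
    rw [covM_congr (H := fun _ => 0) d (hg.eventually.mono fun y hy => covM_metric hy c), covM_eq,
      pdM_const]
    simp
  rw [h0, h0, sub_zero] at h
  have h2 : (curv g x d c).transpose * g x = (g x * curv g x d c).transpose := by
    rw [Matrix.transpose_mul, hg.symm.self_of_nhds]
  rw [h2] at h
  have h3 := congrFun (congrFun h k) l
  simp only [Matrix.zero_apply, Matrix.sub_apply, Matrix.neg_apply, Matrix.transpose_apply] at h3
  rw [riemann_eq, riemann_eq]
  linear_combination h3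

/-- A consequence of the symmetry of the Christoffel symbols: in the cyclic sum both the derivative
terms and the quadratic terms cancel in pairs. -/
lemma riemann_bianchi (k l d c : Fin 4) :
    riemann g x k l d c + riemann g x k d c l + riemann g x k c l d = 0 := by
  have hs : ∀ n i j, (fun y => christoffel g y n i j) =ᶠ[nhds x] fun y => christoffel g y n j i :=
    fun n i j => hg.eventually.mono fun y hy => conn_symm hy n i j
  have hs' : ∀ n i j, christoffel g x n i j = christoffel g x n j i :=
    fun n i j => (hs n i j).eq_of_nhds
  simp only [riemann, ← Finset.sum_add_distrib, ← mul_add]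
  refine Finset.sum_eq_zero fun n _ => ?_
  rw [pd_congr d (hs n c l), pd_congr c (hs n d l), pd_congr l (hs n d c)]
  simp only [hs' _ c l, hs' _ d l, hs' _ d c, Finset.sum_sub_distrib]
  ring

end

/-! ### The curvature of a parallel-type equation for a 2-form -/

/-- The 2-form `p ∧ q`. -/
def wedgeVec (p q : Fin 4 → ℂ) : T2 := Matrix.of fun a b => p a * q b - q a * p b

/-- The map `X ↦ X / 2 - u · X · u`, which for a unitary SD bivector `u` is the projector `𝒢_⊥`. -/
def perp (g u X : T2) : T2 := (1 / 2 : ℂ) • X - dot g (dot g u X) u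

section

variable {g : Coord → T2} {x : Coord} (hg : IsMetricNear g x)

include hg

/-- In `ξ ∧ g_c` the index `c` is only a label, which `covM` does not differentiate as a tensor
index. Although `g` is parallel, a Christoffel term in `c` therefore remains. -/
lemma covM_wedgeVec {w : Coord → Fin 4 → ℂ} (hw : ∀ a, ContDiffAt ℝ ∞ (fun y => w y a) x)
    (d c : Fin 4) :
    covM g (fun y => wedgeVec (w y) (g y c)) x d =
      wedgeVec (cov1 g w x d) (g x c) + ∑ m, conn g x d m c • wedgeVec (w x) (g x m) := by
  have hs := hg.smooth.self_of_nhds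
  have hpd : ∀ b, pd d (fun y => g y c b) x =
      ∑ m, (conn g x d m c * g x m b + g x c m * conn g x d m b) := by
    intro b
    have := congrFun (congrFun (pdM_metric hg d) c) b
    simpa [pdM, Matrix.mul_apply, Finset.sum_add_distrib] using this
  ext a b
  rw [covM_eq]
  simp only [Matrix.sub_apply, Matrix.add_apply, pdM, wedgeVec, Matrix.of_apply, Matrix.mul_apply,
    Matrix.transpose_apply, cov1, Matrix.sum_apply, Matrix.smul_apply, smul_eq_mul]
  rw [pd_sub (f := fun y => w y a * g y c b) (h := fun y => g y c a * w y b) d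
      ((smooth_diff (hw a)).mul (hs.diff c b)) ((hs.diff c a).mul (smooth_diff (hw b))),
    pd_mul d (smooth_diff (hw a)) (hs.diff c b), pd_mul d (hs.diff c a) (smooth_diff (hw b)),
    hpd, hpd]
  simp only [Fin.sum_univ_four, conn, Matrix.of_apply]
  ring

omit hg in
lemma wedgeVec_smooth {w v : Coord → Fin 4 → ℂ} (hw : ∀ a, ContDiffAt ℝ ∞ (fun y => w y a) x)
    (hv : ∀ a, ContDiffAt ℝ ∞ (fun y => v y a) x) : SmoothM (fun y => wedgeVec (w y) (v y)) x :=
  fun a b => ((hw a).mul (hv b)).sub ((hv a).mul (hw b))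

lemma dot_smooth {F H : Coord → T2} (hF : SmoothM F x) (hH : SmoothM H x) :
    SmoothM (fun y => dot (g y) (F y) (H y)) x := (hF.mul hg.smooth_inv).mul hH

lemma covM_perp {u X : Coord → T2} (hu : SmoothM u x) (hX : SmoothM X x) (d : Fin 4) :
    covM g (fun y => perp (g y) (u y) (X y)) x d = perp (g x) (u x) (covM g X x d)
      - dot (g x) (dot (g x) (covM g u x d) (X x)) (u x)
      - dot (g x) (dot (g x) (u x) (X x)) (covM g u x d) := by
  simp only [perp]
  rw [covM_sub (hX.smul _) (dot_smooth hg (dot_smooth hg hu hX) hu), covM_smul _ hX,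
    covM_dot hg (dot_smooth hg hu hX) hu, covM_dot hg hu hX]
  simp only [dot, add_mul]
  abel

/-- The integrability conditions of the equation `∇_c u = 𝒢_⊥(ξ ∧ g_c)`. -/
lemma curv_of_covM_eq {u : Coord → T2} {w : Coord → Fin 4 → ℂ} (hu : SmoothM u x)
    (hw : ∀ a, ContDiffAt ℝ ∞ (fun y => w y a) x)
    (hcov : ∀ᶠ y in nhds x, ∀ c, covM g u y c = perp (g y) (u y) (wedgeVec (w y) (g y c)))
    (d c : Fin 4) :
    -((curv g x d c).transpose * u x) - u x * curv g x d c =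
      perp (g x) (u x) (wedgeVec (cov1 g w x d) (g x c) - wedgeVec (cov1 g w x c) (g x d))
      - dot (g x) (dot (g x) (perp (g x) (u x) (wedgeVec (w x) (g x d)))
          (wedgeVec (w x) (g x c))) (u x)
      - dot (g x) (dot (g x) (u x) (wedgeVec (w x) (g x c)))
          (perp (g x) (u x) (wedgeVec (w x) (g x d)))
      + dot (g x) (dot (g x) (perp (g x) (u x) (wedgeVec (w x) (g x c)))
          (wedgeVec (w x) (g x d))) (u x)
      + dot (g x) (dot (g x) (u x) (wedgeVec (w x) (g x d)))
          (perp (g x) (u x) (wedgeVec (w x) (g x c))) := by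
  have hs := hg.smooth.self_of_nhds
  -- The hypothesis holds on a neighbourhood, so it can be differentiated once more; each `∇u`
  -- produced by the Leibniz rule is replaced by its value again.
  have key : ∀ d c, covM g (fun y => covM g u y c) x d =
      perp (g x) (u x) (covM g (fun y => wedgeVec (w y) (g y c)) x d)
      - dot (g x) (dot (g x) (perp (g x) (u x) (wedgeVec (w x) (g x d)))
          (wedgeVec (w x) (g x c))) (u x)
      - dot (g x) (dot (g x) (u x) (wedgeVec (w x) (g x c)))
          (perp (g x) (u x) (wedgeVec (w x) (g x d))) := by
    intro d c
    rw [covM_congr d (hcov.mono fun y hy => hy c),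
      covM_perp hg hu (wedgeVec_smooth hw fun a => hs c a), hcov.self_of_nhds]
  have hperp : ∀ X Y : T2, perp (g x) (u x) X - perp (g x) (u x) Y = perp (g x) (u x) (X - Y) := by
    intro X Y; simp only [perp, dot, smul_sub]; noncomm_ring
  -- The label terms of `covM_wedgeVec` are symmetric in `d`, `c` because the connection has no
  -- torsion, and so drop out of the commutator.
  have hsum : ∑ m, conn g x d m c • wedgeVec (w x) (g x m)
      = ∑ m, conn g x c m d • wedgeVec (w x) (g x m) :=
    Finset.sum_congr rfl fun m _ => by rw [conn_symm hg]
  rw [← ricci_identity hg hu, key, key, covM_wedgeVec hg hw, covM_wedgeVec hg hw, hsum,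
    ← add_sub_add_right_eq_sub (wedgeVec (cov1 g w x d) (g x c)) _
      (∑ m, conn g x c m d • wedgeVec (w x) (g x m)), ← hperp]
  abel

/-! ### Reality of the curvature -/

/-- A real symmetric matrix is Hermitian, and inversion preserves both hermiticity and symmetry.
Reality is needed up to the Weyl tensor, because it makes the anti-self-dual part the conjugate of
the self-dual one. -/
lemma inv_real (a b : Fin 4) : (starRingEnd ℂ) ((g x)⁻¹ a b) = (g x)⁻¹ a b := by
  have h1 : (g x).conjTranspose = g x := by
    ext a b
    rw [Matrix.conjTranspose_apply]
    exact (hg.real.self_of_nhds b a).trans (hg.symm_apply b a).self_of_nhds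
  have h2 : ((g x)⁻¹).transpose = (g x)⁻¹ := by
    rw [Matrix.transpose_nonsing_inv, hg.symm.self_of_nhds]
  have h3 : ((g x)⁻¹).conjTranspose = (g x)⁻¹ := by
    rw [Matrix.conjTranspose_nonsing_inv, h1]
  have h4 := congrFun (congrFun h3 b) a
  have h5 := congrFun (congrFun h2 b) a
  rw [Matrix.conjTranspose_apply] at h4
  rw [Matrix.transpose_apply] at h5
  exact h4.trans h5.symm

omit hg in
lemma pd_real {f : Coord → ℂ} (hf : ∀ᶠ y in nhds x, (starRingEnd ℂ) (f y) = f y) (i : Fin 4) :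
    (starRingEnd ℂ) (pd i f x) = pd i f x := by
  rw [← pd_conj]; exact pd_congr i hf

lemma christoffel_real (k i j : Fin 4) :
    (starRingEnd ℂ) (christoffel g x k i j) = christoffel g x k i j := by
  have h : ∀ a b c, (starRingEnd ℂ) (pd c (fun y => g y a b) x) = pd c (fun y => g y a b) x :=
    fun a b c => pd_real (hg.real.mono fun y hy => hy a b) c
  simp only [christoffel, map_mul, map_sum, map_add, map_sub, inv_real hg, h]
  simp [map_ofNat]

lemma riemann_real (k l i j : Fin 4) :
    (starRingEnd ℂ) (riemann g x k l i j) = riemann g x k l i j := by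
  have h : ∀ a b c d, (starRingEnd ℂ) (pd d (fun y => christoffel g y a b c) x)
      = pd d (fun y => christoffel g y a b c) x :=
    fun a b c d => pd_real (hg.eventually.mono fun y hy => christoffel_real hy a b c) d
  simp only [riemann, map_mul, map_sum, map_add, map_sub, h, christoffel_real hg,
    hg.real.self_of_nhds]

lemma ricci_real (i j : Fin 4) : (starRingEnd ℂ) (ricci g x i j) = ricci g x i j := by
  simp only [ricci, map_mul, map_sum, riemann_real hg, inv_real hg]

lemma scalarCurv_real : (starRingEnd ℂ) (scalarCurv g x) = scalarCurv g x := by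
  simp only [scalarCurv, map_mul, map_sum, ricci_real hg, inv_real hg]

lemma weyl_real (a b c d : Fin 4) : (starRingEnd ℂ) (weyl g x a b c d) = weyl g x a b c d := by
  simp [map_ofNat, weyl, wedge, metricG, riemann_real hg, ricci_real hg, scalarCurv_real hg,
    hg.real.self_of_nhds]

end

/-! ### Smoothness of the divergence -/

lemma xi_smooth {g : Coord → T2} {η : Coord → T4} {U : Coord → T2} {x : Coord}
    (hg : IsMetricNear g x) (hu : SmoothM (fun y => canSD g η U y) x) (b : Fin 4) :
    ContDiffAt ℝ ∞ (fun y => xi g η U y b) x := by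
  have h1 := hg.smooth_inv
  have h2 := covM_smooth hg hu
  exact (ContDiffAt.sum fun c _ => ContDiffAt.sum fun a _ => (h1 c a).mul (h2 c a b)).neg

lemma star_smooth {g : Coord → T2} {η : Coord → T4} {F : Coord → T2} {x : Coord}
    (hg : IsMetricNear g x) (hη : ∀ a b c d, ContDiffAt ℝ ∞ (fun y => η y a b c d) x)
    (hF : SmoothM F x) : SmoothM (fun y => star (g y) (η y) (F y)) x := by
  intro a b
  have h1 := hg.smooth_inv
  exact contDiffAt_const.mul (ContDiffAt.sum fun m _ => ContDiffAt.sum fun n _ =>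
    (hη a b m n).mul (ContDiffAt.sum fun i _ => ContDiffAt.sum fun j _ =>
      ((h1 m i).mul (h1 n j)).mul (hF i j)))

lemma canSD_smooth {g : Coord → T2} {η : Coord → T4} {U : Coord → T2} {x : Coord}
    (hg : IsMetricNear g x) (hη : ∀ a b c d, ContDiffAt ℝ ∞ (fun y => η y a b c d) x)
    (hU : SmoothM U x) : SmoothM (fun y => canSD g η U y) x :=
  (hU.sub ((star_smooth hg hη hU).smul _)).smul _

/-! ### The standard frame -/

/-- The Minkowski metric. -/
def gStd : T2 := !![-1, 0, 0, 0; 0, 1, 0, 0; 0, 0, 1, 0; 0, 0, 0, 1]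

/-- The volume element of the standard time-like plane. -/
def uStd : T2 := !![0, -1, 0, 0; 1, 0, 0, 0; 0, 0, 0, 0; 0, 0, 0, 0]

/-- The Hodge dual of `uStd`. -/
def suStd : T2 := !![0, 0, 0, 0; 0, 0, 0, 0; 0, 0, 0, 1; 0, 0, -1, 0]

/-- The factor `1/√2`. -/
def rt : ℂ := 1 / (Real.sqrt 2 : ℂ)

lemma rt_sq : rt ^ 2 = 1 / 2 := by
  have : ((Real.sqrt 2 : ℝ) : ℂ) ^ 2 = 2 := by
    rw [← Complex.ofReal_pow, Real.sq_sqrt (by norm_num)]; norm_num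
  rw [rt, div_pow, this]; norm_num

/-- The self-dual bivector with components `f₁, f₂, f₃`. -/
def sdStd (a b c : ℂ) : T2 :=
  !![0, -a, -b, -c; a, 0, -(Complex.I * c), Complex.I * b;
    b, Complex.I * c, 0, -(Complex.I * a); c, -(Complex.I * b), Complex.I * a, 0]

lemma sdStd_one : rt • (uStd - Complex.I • suStd) = rt • sdStd 1 0 0 := by
  congr 1
  ext i j
  fin_cases i <;> fin_cases j <;> simp [uStd, suStd, sdStd]

lemma gStd_apply (a b : Fin 4) : gStd a b = if a = b then (if a = 0 then -1 else 1) else 0 := by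
  fin_cases a <;> fin_cases b <;> simp [gStd]

lemma gStd_mul_self : gStd * gStd = 1 := by
  ext i j
  fin_cases i <;> fin_cases j <;> simp [gStd_apply, Matrix.mul_apply]

lemma gStd_inv : gStd⁻¹ = gStd := Matrix.inv_eq_left_inv gStd_mul_self

lemma dot_gStd (F H : T2) (a b : Fin 4) : dot gStd F H a b =
    -(F a 0 * H 0 b) + F a 1 * H 1 b + F a 2 * H 2 b + F a 3 * H 3 b := by
  simp [dot, gStd_inv, Matrix.mul_apply, Fin.sum_univ_four, gStd_apply]

/-! ### Umbilicity in the standard frame -/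

/-- The umbilical condition for a plane, in terms of the covariant derivative of its projector. -/
def Umb (g v h : T2) (Dv : Fin 4 → T2) : Prop :=
  let Q : Fin 4 → T2 := fun c a b => ∑ d, ∑ e, (h * g⁻¹) c d * (v * g⁻¹) a e * Dv e d b
  ∀ c a b, (1 / 2) * (Q c a b + Q c b a) = (1 / 2) * v a b * ∑ m, ∑ n, g⁻¹ m n * Q c m n

/-- The divergence of a 2-form in terms of its covariant derivative. -/
def divD (g : T2) (D : Fin 4 → T2) : Fin 4 → ℂ := fun b => -∑ c, ∑ a, g⁻¹ c a * D c a b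

lemma dot_uStd : dot gStd uStd uStd = !![-1, 0, 0, 0; 0, 1, 0, 0; 0, 0, 0, 0; 0, 0, 0, 0] := by
  ext i j
  rw [dot_gStd]
  fin_cases i <;> fin_cases j <;> simp [uStd]

lemma projV_mul_gStd : dot gStd uStd uStd * gStd⁻¹ =
    !![1, 0, 0, 0; 0, 1, 0, 0; 0, 0, 0, 0; 0, 0, 0, 0] := by
  ext i j
  rw [gStd_inv, dot_uStd, Matrix.mul_apply]
  fin_cases i <;> fin_cases j <;> simp [gStd_apply]

lemma projH_mul_gStd : (gStd - dot gStd uStd uStd) * gStd⁻¹ =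
    !![0, 0, 0, 0; 0, 0, 0, 0; 0, 0, 1, 0; 0, 0, 0, 1] := by
  rw [sub_mul, projV_mul_gStd, gStd_inv, gStd_mul_self]
  ext i j
  fin_cases i <;> fin_cases j <;> simp

/-- The result keeps only the second and third SD components. `app_metricPerp_std` gives the same
value for `𝒢_⊥`, so the matrix expression `perp` agrees with that projector on 2-forms. -/
lemma perp_std (X : T2) (hX : X.transpose = -X) : perp gStd (rt • sdStd 1 0 0) X =
    sdStd 0 (-(X 0 2 + Complex.I * X 1 3) / 2) (-(X 0 3 - Complex.I * X 1 2) / 2) := by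
  have h := rt_sq
  have hI := Complex.I_sq
  have hX' : ∀ a b, X b a = -X a b := fun a b => congrFun (congrFun hX a) b
  have h0 : ∀ a, X a a = 0 := fun a => by have := hX' a a; linear_combination (1 / 2) * this
  ext i j
  simp only [perp, Matrix.sub_apply, dot_gStd, Matrix.smul_apply, smul_eq_mul]
  fin_cases i <;> fin_cases j <;>
    simp [sdStd, h0, hX' 0, hX' 1 2, hX' 1 3, hX' 2 3] <;> grind

lemma wedgeVec_transpose (p q : Fin 4 → ℂ) : (wedgeVec p q).transpose = -wedgeVec p q := by
  ext a b; simp [wedgeVec]; ring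

lemma entry_antisymm {F : T2} (hF : F.transpose = -F) (a b : Fin 4) : F b a = -F a b :=
  congrFun (congrFun hF a) b

lemma entry_diag {F : T2} (hF : F.transpose = -F) (a : Fin 4) : F a a = 0 := by
  have := entry_antisymm hF a a
  linear_combination (1 / 2) * this

/-- The derivative of the SD bivector of a unit simple 2-form. -/
lemma frame_sd_deriv {DU DS : T2} (hU : DU.transpose = -DU) (hS : DS.transpose = -DS)
    (h1 : dot gStd (dot gStd DU uStd) uStd + dot gStd (dot gStd uStd DU) uStd
      + dot gStd (dot gStd uStd uStd) DU = DU)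
    (h2 : dot gStd DS uStd + dot gStd suStd DU = 0)
    (h3 : dot gStd DS suStd + dot gStd suStd DS = dot gStd DU uStd + dot gStd uStd DU) :
    DU - Complex.I • DS =
      sdStd 0 (-(DU 0 2 + Complex.I * DU 1 3)) (-(DU 0 3 - Complex.I * DU 1 2)) := by
  have hI := Complex.I_sq
  have hU' := entry_antisymm hU
  have hS' := entry_antisymm hS
  have hU0 := entry_diag hU
  have hS0 := entry_diag hS
  have e1 := congrFun (congrFun h1 0) 1
  have e2 := congrFun (congrFun h1 2) 3
  have e3 := congrFun (congrFun h2 0) 0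
  have e4 := congrFun (congrFun h3 2) 2
  have e5 := congrFun (congrFun h2 2) 1
  have e6 := congrFun (congrFun h2 3) 1
  have e7 := congrFun (congrFun h2 2) 0
  have e8 := congrFun (congrFun h2 3) 0
  simp [dot_gStd, uStd, suStd, hU0, hS0, hU' 0 1, hU' 0 2, hU' 0 3, hU' 1 2, hU' 1 3,
    hS' 0 2, hS' 0 3, hS' 1 2, hS' 1 3, hS' 2 3]
    at e1 e2 e3 e4 e5 e6 e7 e8
  clear h1 h2 h3
  -- A variation of a unit simple 2-form mixes the two planes, and the variation of its dual is then
  -- forced. The three differentiated relations thus play the role of `∇η = 0`.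
  have hU01 : DU 0 1 = 0 := by grind
  have hU23 : DU 2 3 = 0 := by grind
  have hS01 : DS 0 1 = 0 := by grind
  have hS23 : DS 2 3 = 0 := by grind
  have hS02 : DS 0 2 = -DU 1 3 := by grind
  have hS03 : DS 0 3 = DU 1 2 := by grind
  have hS12 : DS 1 2 = -DU 0 3 := by grind
  have hS13 : DS 1 3 = DU 0 2 := by grind
  ext i j
  fin_cases i <;> fin_cases j <;>
    simp [sdStd, hU0, hS0, hU' 0 1, hU' 0 2, hU' 0 3, hU' 1 2, hU' 1 3, hU' 2 3, hS' 0 1, hS' 0 2,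
      hS' 0 3, hS' 1 2, hS' 1 3, hS' 2 3, hU01, hU23, hS01, hS23, hS02, hS03, hS12, hS13] <;>
    grind

/-- The trace-free symmetric part of a form on a plane has two components; each of the two normal
directions contributes two equations. -/
lemma frame_umb_left {DU : Fin 4 → T2} (hU : ∀ c, (DU c).transpose = -DU c)
    (hV : Umb gStd (dot gStd uStd uStd) (gStd - dot gStd uStd uStd)
      fun c => dot gStd (DU c) uStd + dot gStd uStd (DU c)) :
    DU 1 1 2 = -DU 0 0 2 ∧ DU 0 1 2 = -DU 1 0 2 ∧ DU 1 1 3 = -DU 0 0 3 ∧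
      DU 0 1 3 = -DU 1 0 3 := by
  have hU' := fun c => entry_antisymm (hU c)
  have e1 := hV 2 0 1
  have e2 := hV 2 0 0
  have e3 := hV 3 0 1
  have e4 := hV 3 0 0
  simp only [projV_mul_gStd, projH_mul_gStd] at e1 e2 e3 e4
  simp only [dot_uStd] at e1 e2 e3 e4
  simp [Fin.sum_univ_four, gStd_inv, gStd_apply, dot_gStd, uStd, hU' _ 0 2, hU' _ 0 3, hU' _ 1 2,
    hU' _ 1 3] at e1 e2 e3 e4
  grind

lemma frame_umb_right {DU : Fin 4 → T2}
    (hH : Umb gStd (gStd - dot gStd uStd uStd) (dot gStd uStd uStd)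
      fun c => -(dot gStd (DU c) uStd + dot gStd uStd (DU c))) :
    DU 2 0 3 = -DU 3 0 2 ∧ DU 3 0 3 = DU 2 0 2 ∧ DU 2 1 3 = -DU 3 1 2 ∧
      DU 3 1 3 = DU 2 1 2 := by
  have e1 := hH 0 2 3
  have e2 := hH 0 2 2
  have e3 := hH 1 2 3
  have e4 := hH 1 2 2
  simp only [projV_mul_gStd, projH_mul_gStd] at e1 e2 e3 e4
  simp only [dot_uStd] at e1 e2 e3 e4
  simp [Fin.sum_univ_four, gStd_inv, gStd_apply, dot_gStd, uStd] at e1 e2 e3 e4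
  grind

/-- The hypotheses are umbilicity in complex form. They reduce the eight numbers `B c`, `C c` to `B
0`, `C 0`, `B 2`, `C 2`, which up to constant factors are the four components of the divergence.
This is why the divergence determines the derivative. -/
lemma frame_covM_sd (B C : Fin 4 → ℂ) (h1 : B 1 = -(Complex.I * C 0)) (h2 : C 1 = Complex.I * B 0)
    (h3 : B 3 = -C 2) (h4 : C 3 = B 2) (c : Fin 4) :
    rt • sdStd 0 (B c) (C c) = perp gStd (rt • sdStd 1 0 0)
      (wedgeVec (divD gStd fun c => rt • sdStd 0 (B c) (C c)) (gStd c)) := by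
  have hI := Complex.I_mul_I
  have hdiv : divD gStd (fun c => rt • sdStd 0 (B c) (C c)) =
      ![-2 * rt * B 2, -2 * rt * Complex.I * C 2, -2 * rt * B 0, -2 * rt * C 0] := by
    ext b
    fin_cases b <;>
      simp [divD, gStd_inv, Fin.sum_univ_four, gStd_apply, sdStd, h1, h2, h3, h4] <;> grind
  rw [perp_std _ (wedgeVec_transpose _ _), hdiv]
  ext i j
  simp only [Matrix.smul_apply, smul_eq_mul, wedgeVec, Matrix.of_apply]
  fin_cases c <;> fin_cases i <;> fin_cases j <;>
    simp [sdStd, gStd_apply, h1, h2, h3, h4] <;> grind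

/-- In the standard frame, the umbilical condition determines `∇u` by its divergence. -/
lemma frame_covM (DU DS : Fin 4 → T2)
    (hU : ∀ c, (DU c).transpose = -DU c) (hS : ∀ c, (DS c).transpose = -DS c)
    (h1 : ∀ c, dot gStd (dot gStd (DU c) uStd) uStd + dot gStd (dot gStd uStd (DU c)) uStd
      + dot gStd (dot gStd uStd uStd) (DU c) = DU c)
    (h2 : ∀ c, dot gStd (DS c) uStd + dot gStd suStd (DU c) = 0)
    (h3 : ∀ c, dot gStd (DS c) suStd + dot gStd suStd (DS c) =
      dot gStd (DU c) uStd + dot gStd uStd (DU c))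
    (hV : Umb gStd (dot gStd uStd uStd) (gStd - dot gStd uStd uStd)
      fun c => dot gStd (DU c) uStd + dot gStd uStd (DU c))
    (hH : Umb gStd (gStd - dot gStd uStd uStd) (dot gStd uStd uStd)
      fun c => -(dot gStd (DU c) uStd + dot gStd uStd (DU c))) (c : Fin 4) :
    rt • (DU c - Complex.I • DS c) = perp gStd (rt • sdStd 1 0 0)
      (wedgeVec (divD gStd fun c => rt • (DU c - Complex.I • DS c)) (gStd c)) := by
  have hd := fun c => frame_sd_deriv (hU c) (hS c) (h1 c) (h2 c) (h3 c)
  obtain ⟨a1, a2, a3, a4⟩ := frame_umb_left hU hV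
  obtain ⟨b1, b2, b3, b4⟩ := frame_umb_right hH
  have hI := Complex.I_mul_I
  simp only [fun c => hd c]
  apply frame_covM_sd (fun c => -(DU c 0 2 + Complex.I * DU c 1 3))
    (fun c => -(DU c 0 3 - Complex.I * DU c 1 2))
  · simp only [a2, a3]; linear_combination -DU 1 0 2 * hI
  · simp only [a1, a4]; linear_combination -DU 1 0 3 * hI
  · simp only [b1, b4]; ring
  · simp only [b2, b3]; ring

/-! ### Integrability conditions and the curvature components -/

/-- The right-hand side of the integrability conditions of `∇_c u = 𝒢_⊥(x ∧ g_c)`, where `N` is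
the covariant derivative of `x`. -/
def integ (g u : T2) (x : Fin 4 → ℂ) (N : T2) (d c : Fin 4) : T2 :=
  perp g u (wedgeVec (N d) (g c) - wedgeVec (N c) (g d))
    - dot g (dot g (perp g u (wedgeVec x (g d))) (wedgeVec x (g c))) u
    - dot g (dot g u (wedgeVec x (g c))) (perp g u (wedgeVec x (g d)))
    + dot g (dot g (perp g u (wedgeVec x (g c))) (wedgeVec x (g d))) u
    + dot g (dot g u (wedgeVec x (g d))) (perp g u (wedgeVec x (g c)))

/-- The algebraic symmetries of a curvature tensor. -/
structure IsCurv (r : T4) : Prop where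
  left : ∀ a b c d, r b a c d = -r a b c d
  right : ∀ a b c d, r a b d c = -r a b c d
  bianchi : ∀ a b c d, r a b c d + r a c d b + r a d b c = 0

/-- The classical octahedron argument: four cyclic identities are combined using the antisymmetries.
-/
lemma IsCurv.pair {r : T4} (h : IsCurv r) (a b c d : Fin 4) : r c d a b = r a b c d := by
  have h1 := h.bianchi a b c d
  have h2 := h.bianchi b c d a
  have h3 := h.bianchi c d a b
  have h4 := h.bianchi d a b c
  have e1 := h.left a b c d
  have e2 := h.left b c a d
  have e3 := h.left c d a b
  have e4 := h.left a c b d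
  have e5 := h.left a d b c
  have e6 := h.left b d a c
  have f1 := h.right a b c d
  have f2 := h.right b c a d
  have f3 := h.right c d a b
  have f4 := h.right a c b d
  have f5 := h.right a d b c
  have f6 := h.right b d a c
  have g1 := h.left b d c a
  have g2 := h.left b c d a
  grind

lemma IsCurv.diag_left {r : T4} (h : IsCurv r) (a c d : Fin 4) : r a a c d = 0 := by
  linear_combination (1 / 2) * h.left a a c d

lemma IsCurv.diag_right {r : T4} (h : IsCurv r) (a b c : Fin 4) : r a b c c = 0 := by
  linear_combination (1 / 2) * h.right a b c c

/-- The matrices `R_{kldc}` for fixed `d`, `c`. -/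
def curvMat (r : T4) (d c : Fin 4) : T2 := Matrix.of fun k l => r k l d c

/-- The Ricci tensor of a curvature tensor. -/
def ricT (g : T2) (r : T4) : T2 := fun l j => ∑ k, ∑ i, g⁻¹ k i * r k l i j

/-- The scalar curvature of a curvature tensor. -/
def scalT (g : T2) (r : T4) : ℂ := ∑ i, ∑ j, g⁻¹ i j * ricT g r i j

/-- The Weyl tensor of a curvature tensor. -/
def weylT (g : T2) (r : T4) : T4 :=
  r - (1 / 2 : ℂ) • wedge (ricT g r) g + (scalT g r / 6) • metricG g

/-- The covector `x^a u_{ab}`. -/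
def chiT (g u : T2) (x : Fin 4 → ℂ) : Fin 4 → ℂ := fun b => ∑ c, ∑ a, g⁻¹ c a * x c * u a b

/-- The antisymmetric part of `N - χ ⊗ x`. -/
def antiT (g u : T2) (x : Fin 4 → ℂ) (N : T2) : T2 :=
  let T : T2 := fun a b => N a b - chiT g u x a * x b
  (1 / 2 : ℂ) • (T - T.transpose)

lemma antiT_apply (g u : T2) (x : Fin 4 → ℂ) (N : T2) (a b : Fin 4) : antiT g u x N a b =
    (1 / 2) * ((N a b - chiT g u x a * x b) - (N b a - chiT g u x b * x a)) := rfl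

lemma antiT_transpose (g u : T2) (x : Fin 4 → ℂ) (N : T2) :
    (antiT g u x N).transpose = -antiT g u x N := by
  ext a b
  rw [Matrix.transpose_apply, Matrix.neg_apply, antiT_apply, antiT_apply]
  ring

lemma chiT_gStd (x : Fin 4 → ℂ) : chiT gStd (rt • sdStd 1 0 0) x =
    ![rt * x 1, rt * x 0, rt * Complex.I * x 3, -(rt * Complex.I * x 2)] := by
  ext b
  fin_cases b <;> simp [chiT, gStd_inv, gStd_apply, Fin.sum_univ_four, sdStd] <;> ring

/-- The components of the double 2-form `r` on SD bivectors. -/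
def sdComp (r : T4) (i k l j m n : Fin 4) : ℂ :=
  r 0 i 0 j - Complex.I * r 0 i m n - Complex.I * r k l 0 j - r k l m n

/-- With the index triples `(1;2,3)`, `(2;3,1)`, `(3;1,2)`, the conclusions are the SD components of
`r` with at least one index orthogonal to `u`, up to pair symmetry. A commutator with `u` has only
components orthogonal to `u`; on the SD side these are already visible in its `(0,2)` and `(0,3)`
entries, the only ones used. The terms quadratic in `x` combine with `∇x` into `A`. -/
lemma frame_integ (x : Fin 4 → ℂ) (N : T2) (r : T4)
    (h : ∀ d c, dot gStd (curvMat r d c) (rt • sdStd 1 0 0)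
      - dot gStd (rt • sdStd 1 0 0) (curvMat r d c) = integ gStd (rt • sdStd 1 0 0) x N d c)
    (hr : IsCurv r) (A : T2) (hA : A = antiT gStd (rt • sdStd 1 0 0) x N) :
    sdComp r 2 3 1 1 2 3 = -(2 * rt * (A 0 2 + Complex.I * A 1 3)) ∧
    sdComp r 3 1 2 1 2 3 = -(2 * rt * (A 0 3 - Complex.I * A 1 2)) ∧
    sdComp r 2 3 1 2 3 1 = 2 * rt * (A 0 1 - Complex.I * A 2 3) ∧
    sdComp r 2 3 1 3 1 2 = 0 ∧
    sdComp r 3 1 2 3 1 2 = 2 * rt * (A 0 1 - Complex.I * A 2 3) := by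
  have hI := Complex.I_mul_I
  have hs := rt_sq
  have hw : ∀ p q p' q' : Fin 4 → ℂ, (wedgeVec p q - wedgeVec p' q').transpose =
    -(wedgeVec p q - wedgeVec p' q') := by
    intro p q p' q'
    rw [Matrix.transpose_sub, wedgeVec_transpose, wedgeVec_transpose, neg_sub_neg, neg_sub]
  have e1 := fun d c => congrFun (congrFun (h d c) 0) 2
  have e2 := fun d c => congrFun (congrFun (h d c) 0) 3
  simp only [integ, perp_std _ (wedgeVec_transpose _ _), perp_std _ (hw _ _ _ _), Matrix.sub_apply,
    Matrix.add_apply, dot_gStd, curvMat] at e1 e2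
  have a1 := e1 0 1
  have a2 := e1 2 3
  have a3 := e1 0 2
  have a4 := e1 1 3
  have a5 := e1 0 3
  have a6 := e1 1 2
  have b1 := e2 0 1
  have b2 := e2 2 3
  have b3 := e2 0 2
  have b4 := e2 1 3
  have b5 := e2 0 3
  have b6 := e2 1 2
  clear e1 e2
  simp [sdStd, wedgeVec, gStd_apply] at a1 a2 a3 a4 a5 a6 b1 b2 b3 b4 b5 b6
  have A' := antiT_apply gStd (rt • sdStd 1 0 0) x N
  rw [← hA, chiT_gStd] at A'
  have A1 := A' 0 1
  have A2 := A' 0 2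
  have A3 := A' 0 3
  have A4 := A' 1 2
  have A5 := A' 1 3
  have A6 := A' 2 3
  simp at A1 A2 A3 A4 A5 A6
  have L := hr.left 1 3
  have R := fun a b => hr.right a b 1 3
  have p1 := hr.pair 0 2 0 3
  have p2 := hr.pair 0 2 1 2
  have p3 := hr.pair 1 3 0 3
  have p4 := hr.pair 1 3 1 2
  clear hw hA A' h hr
  have hI' := Complex.I_sq
  simp only [sdComp, L, R, A1, A2, A3, A4, A5, A6]
  clear A1 A2 A3 A4 A5 A6 L R
  -- Some combinations below yield the desired component multiplied by this factor.
  have hne : rt * Complex.I ≠ 0 := by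
    intro h0
    have : rt ^ 2 * (Complex.I * Complex.I) = 0 := by linear_combination rt * Complex.I * h0
    rw [hs, hI] at this
    norm_num at this
  refine ⟨?_, ?_, ?_, ?_, ?_⟩
  · apply mul_left_cancel₀ hne
    linear_combination (-1) * b1 + Complex.I * b2 + (rt * r 1 3 0 1 - 1 / 2 * rt * x 0 * x 3
      + 1 / 2 * rt * Complex.I * x 1 * x 2 + 1 / 2 * N 1 3 - rt ^ 3 * Complex.I * x 1 * x 2) * hI
      + (Complex.I * N 0 2 - Complex.I * N 2 0 + Complex.I ^ 2 * N 1 3 - Complex.I ^ 2 * N 3 1) * hs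
  · apply mul_left_cancel₀ hne
    linear_combination a1 - Complex.I * a2 + (-rt * r 1 2 0 1 + 1 / 2 * rt * x 0 * x 2
      + 1 / 2 * rt * Complex.I * x 1 * x 3 - 1 / 2 * N 1 2 - rt ^ 3 * Complex.I * x 1 * x 3) * hI
      + (Complex.I * N 0 3 - Complex.I * N 3 0 - Complex.I ^ 2 * N 1 2 + Complex.I ^ 2 * N 2 1) * hs
  · clear a1 a2 a3 a4 a5 a6 b1 b2 b5 b6
    grind
  · apply mul_left_cancel₀ hne
    -- This component appears in both sets of entries. Averaging its two evaluations, which are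
    -- related by pair symmetry, cancels the derivatives of `x`.
    linear_combination (-1 / 2) * b5 + (1 / 2) * Complex.I * b6 + (1 / 2) * (a3 + Complex.I * a4)
      - 1 / 2 * rt * Complex.I * (p1 + p4) - 1 / 2 * rt * p2 - 1 / 2 * rt * Complex.I ^ 2 * p3
      + (-1 / 2 * rt * r 0 2 1 2 + 1 / 2 * rt * r 1 3 0 3 + 1 / 2 * rt * Complex.I * x 3 * x 2
        + 1 / 4 * (N 3 3 - N 2 2)) * hI
  · clear a1 a2 a3 a4 b1 b2 b3 b4 b5 b6
    grind

/-! ### The Weyl tensor in an adapted frame -/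

/-- The Levi-Civita symbol. -/
def epsStd : T4 := fun a b c d =>
  ((((b : ℕ) : ℤ) - (a : ℕ)) * ((c : ℕ) - (a : ℕ)) * ((d : ℕ) - (a : ℕ)) * ((c : ℕ) - (b : ℕ))
    * ((d : ℕ) - (b : ℕ)) * ((d : ℕ) - (c : ℕ)) : ℤ) / 12

/-- The tensor `3Ω u ⊗ u + u ⊗ Z + Z ⊗ u + Ω 𝒢`. -/
def weylForm (g : T2) (η : T4) (u Z : T2) (Ω : ℂ) : T4 :=
  (3 * Ω) • tensor u u + tensor u Z + tensor Z u + Ω • metricSD g η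

/-- Antisymmetry in the first and in the second pair of indices. -/
structure IsDouble (F : T4) : Prop where
  left : ∀ a b c d, F b a c d = -F a b c d
  right : ∀ a b c d, F a b d c = -F a b c d

lemma IsDouble.diag_left {r : T4} (h : IsDouble r) (a c d : Fin 4) : r a a c d = 0 := by
  linear_combination (1 / 2) * h.left a a c d

lemma IsDouble.diag_right {r : T4} (h : IsDouble r) (a b c : Fin 4) : r a b c c = 0 := by
  linear_combination (1 / 2) * h.right a b c c

/-- The six index pairs are listed as `01, 02, 03` followed by their Hodge partners `23, 31, 12`;
the order `31` avoids signs in self-duality relations. -/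
lemma IsDouble.ext {F H : T4} (hF : IsDouble F) (hH : IsDouble H)
    (h : ∀ i ∈ [((0 : Fin 4), (1 : Fin 4)), (0, 2), (0, 3), (2, 3), (3, 1), (1, 2)],
      ∀ j ∈ [((0 : Fin 4), (1 : Fin 4)), (0, 2), (0, 3), (2, 3), (3, 1), (1, 2)],
      F i.1 i.2 j.1 j.2 = H i.1 i.2 j.1 j.2) : F = H := by
  have key : ∀ i ∈ [((0 : Fin 4), (1 : Fin 4)), (0, 2), (0, 3), (2, 3), (3, 1), (1, 2)],
      ∀ c d, F i.1 i.2 c d = H i.1 i.2 c d := by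
    intro i hi c d
    have h' := h i hi
    simp only [List.mem_cons, List.not_mem_nil, or_false, forall_eq_or_imp, forall_eq] at h'
    obtain ⟨h1, h2, h3, h4, h5, h6⟩ := h'
    have fF := hF.right i.1 i.2
    have fH := hH.right i.1 i.2
    fin_cases c <;> fin_cases d <;>
      simp [hF.diag_right, hH.diag_right, fF 0 1, fF 0 2, fF 0 3, fF 1 2, fF 3 1, fF 2 3, fH 0 1,
        fH 0 2, fH 0 3, fH 1 2, fH 3 1, fH 2 3, h1, h2, h3, h4, h5, h6]
  simp only [List.mem_cons, List.not_mem_nil, or_false, forall_eq_or_imp, forall_eq] at key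
  obtain ⟨h1, h2, h3, h4, h5, h6⟩ := key
  funext a b c d
  have fF := fun a b => hF.left a b c d
  have fH := fun a b => hH.left a b c d
  fin_cases a <;> fin_cases b <;>
    simp [hF.diag_left, hH.diag_left, fF 0 1, fF 0 2, fF 0 3, fF 1 2, fF 3 1, fF 2 3, fH 0 1,
      fH 0 2, fH 0 3, fH 1 2, fH 3 1, fH 2 3, h1, h2, h3, h4, h5, h6]

lemma IsCurv.isDouble {r : T4} (h : IsCurv r) : IsDouble r := ⟨h.left, h.right⟩

lemma IsDouble.add {F H : T4} (hF : IsDouble F) (hH : IsDouble H) : IsDouble (F + H) :=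
  ⟨fun a b c d => by simp [hF.left a b, hH.left a b]; ring,
    fun a b c d => by simp [hF.right a b c d, hH.right a b c d]; ring⟩

lemma IsDouble.smul {F : T4} (k : ℂ) (hF : IsDouble F) : IsDouble (k • F) :=
  ⟨fun a b c d => by simp [hF.left a b], fun a b c d => by simp [hF.right a b c d]⟩

lemma isDouble_tensor {F H : T2} (hF : F.transpose = -F) (hH : H.transpose = -H) :
    IsDouble (tensor F H) :=
  ⟨fun a b c d => by simp [tensor, entry_antisymm hF a b],
    fun a b c d => by simp [tensor, entry_antisymm hH c d]⟩

lemma isDouble_wedge (A B : T2) : IsDouble (wedge A B) :=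
  ⟨fun a b c d => by simp [wedge]; ring, fun a b c d => by simp [wedge]; ring⟩

lemma epsStd_isDouble : IsDouble epsStd :=
  ⟨fun a b c d => by simp [epsStd]; ring, fun a b c d => by simp [epsStd]; ring⟩

lemma sdStd_transpose (a b c : ℂ) : (sdStd a b c).transpose = -sdStd a b c := by
  ext i j
  fin_cases i <;> fin_cases j <;> simp [sdStd]

lemma metricSD_isDouble {g : T2} {η : T4} (h : IsDouble η) : IsDouble (metricSD g η) := by
  have : metricSD g η = (1 / 2 : ℂ) • ((1 / 2 : ℂ) • wedge g g + (-Complex.I) • η) := by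
    simp only [metricSD, metricG, neg_smul, sub_eq_add_neg]
  rw [this]
  exact (((isDouble_wedge g g).smul _).add (h.smul _)).smul _

/-- The three basic SD bivectors are orthogonal with square `-2`, whence the factor `-1/2`. -/
lemma metricSD_std : metricSD gStd epsStd = (-1 / 2 : ℂ) • (tensor (sdStd 1 0 0) (sdStd 1 0 0)
    + tensor (sdStd 0 1 0) (sdStd 0 1 0) + tensor (sdStd 0 0 1) (sdStd 0 0 1)) := by
  have ht := fun a b c => isDouble_tensor (sdStd_transpose a b c) (sdStd_transpose a b c)
  refine (metricSD_isDouble epsStd_isDouble).ext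
    ((((ht 1 0 0).add (ht 0 1 0)).add (ht 0 0 1)).smul _) ?_
  have hI := Complex.I_mul_I
  simp only [List.mem_cons, List.not_mem_nil, or_false, forall_eq_or_imp, forall_eq]
  simp [metricSD, metricG, wedge, tensor, gStd_apply, epsStd, sdStd]
  norm_num

lemma weylT_isCurv {g : T2} (hg : g.transpose = g) {r : T4} (hr : IsCurv r) (h0 : (ricT g r).transpose = ricT g r) :
    IsCurv (weylT g r) := by
  have h1 : ∀ a b, g b a = g a b := fun a b => congrFun (congrFun hg a) b
  have h2 : ∀ a b, ricT g r b a = ricT g r a b := fun a b => congrFun (congrFun h0 a) b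
  refine ⟨fun a b c d => ?_, fun a b c d => ?_, fun a b c d => ?_⟩
  · simp [weylT, metricG, wedge, hr.left a b]; ring
  · simp [weylT, metricG, wedge, hr.right a b c d]; ring
  · simp [weylT, metricG, wedge]
    rw [h1 b c, h1 b d, h1 c d, h2 b c, h2 b d, h2 c d]
    linear_combination hr.bianchi a b c d

lemma ricT_gStd (r : T4) (l j : Fin 4) :
    ricT gStd r l j = -r 0 l 0 j + r 1 l 1 j + r 2 l 2 j + r 3 l 3 j := by
  simp [ricT, gStd_inv, gStd_apply, Fin.sum_univ_four]

lemma scalT_gStd (r : T4) : scalT gStd r =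
    -ricT gStd r 0 0 + ricT gStd r 1 1 + ricT gStd r 2 2 + ricT gStd r 3 3 := by
  simp [scalT, gStd_inv, gStd_apply, Fin.sum_univ_four]

lemma ricT_weylT (r : T4) (l j : Fin 4) : ricT gStd (weylT gStd r) l j = 0 := by
  rw [ricT_gStd]
  have h : ∀ k, weylT gStd r k l k j = r k l k j - (1 / 2) * wedge (ricT gStd r) gStd k l k j
    + scalT gStd r / 6 * ((1 / 2) * wedge gStd gStd k l k j) := fun k => rfl
  rw [h, h, h, h, scalT_gStd]
  have e := ricT_gStd r l j
  simp only [wedge]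
  generalize ricT gStd r = ρ at *
  fin_cases l <;> fin_cases j <;> simp [gStd_apply] at e ⊢ <;> linear_combination -e

lemma raise_gStd (F : T2) (a b : Fin 4) : raise gStd F a b =
    (if a = 0 then -1 else 1) * (if b = 0 then -1 else 1) * F a b := by
  have h : ∀ m n : Fin 4, gStd m n = if m = n then (if m = 0 then -1 else 1) else 0 := gStd_apply
  simp only [raise, gStd_inv, h]
  simp

lemma ip_gStd (F H : T2) (hF : F.transpose = -F) (hH : H.transpose = -H) : ip gStd F H =
    -(F 0 1 * H 0 1) - F 0 2 * H 0 2 - F 0 3 * H 0 3 + F 2 3 * H 2 3 + F 1 3 * H 1 3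
      + F 1 2 * H 1 2 := by
  have hF' := entry_antisymm hF
  have hH' := entry_antisymm hH
  simp only [ip, raise_gStd, Fin.sum_univ_four]
  simp [entry_diag hF, entry_diag hH, hF' 0 1, hF' 0 2, hF' 0 3, hF' 1 2, hF' 1 3, hF' 2 3,
    hH' 0 1, hH' 0 2, hH' 0 3, hH' 1 2, hH' 1 3, hH' 2 3]
  ring

lemma ip_sdStd_left (a b c : ℂ) (X : T2) (hX : X.transpose = -X) : ip gStd (sdStd a b c) X =
    a * (X 0 1 - Complex.I * X 2 3) + b * (X 0 2 + Complex.I * X 1 3)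
      + c * (X 0 3 - Complex.I * X 1 2) := by
  rw [ip_gStd _ _ (sdStd_transpose _ _ _) hX]
  simp [sdStd]
  ring

lemma ip_sdStd (a b c a' b' c' : ℂ) : ip gStd (sdStd a b c) (sdStd a' b' c') =
    -2 * (a * a' + b * b' + c * c') := by
  rw [ip_sdStd_left _ _ _ _ (sdStd_transpose _ _ _)]
  simp [sdStd]
  linear_combination (a * a' + b * b' + c * c') * Complex.I_mul_I

lemma ip_smul_left (g : T2) (k : ℂ) (F H : T2) : ip g (k • F) H = k * ip g F H := by
  simp only [ip, Matrix.smul_apply, smul_eq_mul, mul_assoc, ← Finset.mul_sum]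
  ring

lemma raise_eq (g F : T2) : raise g F = g⁻¹ * F * (g⁻¹).transpose := by
  ext a b
  simp only [raise, Matrix.mul_apply, Matrix.transpose_apply, Finset.sum_mul]
  rw [Finset.sum_comm]
  refine Finset.sum_congr rfl fun n _ => Finset.sum_congr rfl fun m _ => ?_
  ring

lemma ip_smul_right (g : T2) (k : ℂ) (F H : T2) : ip g F (k • H) = k * ip g F H := by
  simp only [ip, raise_eq, Matrix.mul_smul, Matrix.smul_mul, Matrix.smul_apply, smul_eq_mul,
    mul_left_comm _ k, ← Finset.mul_sum]

lemma app_add (g : T2) (P Q : T4) (F : T2) : app g (P + Q) F = app g P F + app g Q F := by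
  ext a b
  simp only [app, Pi.add_apply, Matrix.add_apply, add_mul, Finset.sum_add_distrib, mul_add]

lemma app_smul (g : T2) (k : ℂ) (P : T4) (F : T2) : app g (k • P) F = k • app g P F := by
  ext a b
  simp only [app, Pi.smul_apply, Matrix.smul_apply, smul_eq_mul, mul_assoc, ← Finset.mul_sum]
  ring

lemma app_tensor (g F H X : T2) : app g (tensor F H) X = ip g H X • F := by
  ext a b
  simp only [app, tensor, ip, Matrix.smul_apply, smul_eq_mul, mul_assoc, ← Finset.mul_sum]
  ring

lemma sdStd_add (a b c a' b' c' : ℂ) :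
    sdStd a b c + sdStd a' b' c' = sdStd (a + a') (b + b') (c + c') := by
  ext i j
  fin_cases i <;> fin_cases j <;> simp [sdStd] <;> ring

lemma smul_sdStd (k a b c : ℂ) : k • sdStd a b c = sdStd (k * a) (k * b) (k * c) := by
  ext i j
  fin_cases i <;> fin_cases j <;> simp [sdStd] <;> ring

lemma app_metricSD_std (X : T2) : app gStd (metricSD gStd epsStd) X =
    (-1 / 2 : ℂ) • sdStd (ip gStd (sdStd 1 0 0) X) (ip gStd (sdStd 0 1 0) X)
      (ip gStd (sdStd 0 0 1) X) := by
  rw [metricSD_std, app_smul, app_add, app_add, app_tensor, app_tensor, app_tensor]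
  simp [smul_sdStd, sdStd_add]

lemma app_metricPerp_std (X : T2) (hX : X.transpose = -X) :
    app gStd (metricPerp gStd epsStd (rt • sdStd 1 0 0)) X =
      sdStd 0 (-(X 0 2 + Complex.I * X 1 3) / 2) (-(X 0 3 - Complex.I * X 1 2) / 2) := by
  rw [metricPerp, app_add, app_tensor, app_metricSD_std, ip_smul_left, smul_smul, smul_sdStd,
    smul_sdStd, sdStd_add, ip_sdStd_left _ _ _ _ hX, ip_sdStd_left _ _ _ _ hX,
    ip_sdStd_left _ _ _ _ hX]
  congr 1
  · linear_combination (X 0 1 - Complex.I * X 2 3) * rt_sq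
  · ring
  · ring

/-- The scalar `Ω` in terms of the tensors at a point. -/
def omegaT (g u : T2) (x : Fin 4 → ℂ) (N : T2) (r : T4) : ℂ :=
  -(scalT g r / 12 + ip g (antiT g u x N) u)

/-- The bivector `Z` in terms of the tensors at a point. -/
def zedT (g : T2) (η : T4) (u : T2) (x : Fin 4 → ℂ) (N : T2) : T2 :=
  app g (metricPerp g η u) (antiT g u x N)

lemma ip_comm_std (F H : T2) (hF : F.transpose = -F) (hH : H.transpose = -H) :
    ip gStd F H = ip gStd H F := by
  rw [ip_gStd F H hF hH, ip_gStd H F hH hF]; ring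

/-- The complex conjugate of a double 2-form. -/
def conj4 (F : T4) : T4 := fun a b c d => (starRingEnd ℂ) (F a b c d)

lemma IsDouble.conj {F : T4} (h : IsDouble F) : IsDouble (conj4 F) :=
  ⟨fun a b c d => by simp [conj4, h.left a b], fun a b c d => by simp [conj4, h.right a b c d]⟩

/-- Used with real `p`, `q` and `c` the conjugate of `k`: one complex SD component determines two
real components of the Weyl tensor. -/
lemma solve_conj {p q k c : ℂ} (h : p - Complex.I * q = 2 * k) (h' : p + Complex.I * q = 2 * c) :
    p = k + c ∧ q = Complex.I * k + -Complex.I * c := by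
  constructor
  · linear_combination (1 / 2) * (h + h')
  · linear_combination (-Complex.I / 2) * (h' - h) + q * Complex.I_mul_I

/-- The components of a Weyl tensor in the standard frame are determined by five of its complex
self-dual components. -/
lemma weyl_eq_of_sd {W k : T4} (hW : IsCurv W) (ht : ∀ l j, ricT gStd W l j = 0)
    (hr : ∀ a b c d, (starRingEnd ℂ) (W a b c d) = W a b c d) (hk : IsDouble k)
    (hk1 : ∀ a b, k 2 3 a b = Complex.I * k 0 1 a b)
    (hk2 : ∀ a b, k 3 1 a b = Complex.I * k 0 2 a b)
    (hk3 : ∀ a b, k 1 2 a b = Complex.I * k 0 3 a b)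
    (hks : ∀ a b c d, k a b c d = k c d a b)
    (h11 : W 0 1 0 1 - Complex.I * W 0 1 2 3 = 2 * k 0 1 0 1)
    (h21 : W 0 2 0 1 - Complex.I * W 0 2 2 3 = 2 * k 0 2 0 1)
    (h31 : W 0 3 0 1 - Complex.I * W 0 3 2 3 = 2 * k 0 3 0 1)
    (h22 : W 0 2 0 2 - Complex.I * W 0 2 3 1 = 2 * k 0 2 0 2)
    (h32 : W 0 2 0 3 - Complex.I * W 0 2 1 2 = 2 * k 0 2 0 3)
    (h33 : W 0 3 0 3 - Complex.I * W 0 3 1 2 = 2 * k 0 3 0 3) : W = k + conj4 k := by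
  refine hW.isDouble.ext (hk.add hk.conj) ?_
  have hI := Complex.I_mul_I
  have c11 := congrArg (starRingEnd ℂ) h11
  have c21 := congrArg (starRingEnd ℂ) h21
  have c31 := congrArg (starRingEnd ℂ) h31
  have c22 := congrArg (starRingEnd ℂ) h22
  have c32 := congrArg (starRingEnd ℂ) h32
  have c33 := congrArg (starRingEnd ℂ) h33
  simp [hr, map_ofNat] at c11 c21 c31 c22 c32 c33
  have t := fun l j => (ricT_gStd W l j).symm.trans (ht l j)
  have t00 := t 0 0
  have t11 := t 1 1
  have t22 := t 2 2
  have t33 := t 3 3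
  have t01 := t 0 1
  have t02 := t 0 2
  have t03 := t 0 3
  have t12 := t 1 2
  have t13 := t 1 3
  have t23 := t 2 3
  have L := hW.left
  have R := hW.right
  simp only [hW.diag_left, hW.diag_right, L 0 1, L 0 2, L 0 3, L 1 2, L 3 1, L 2 3, R _ _ 0 1,
    R _ _ 0 2, R _ _ 0 3, R _ _ 1 2, R _ _ 3 1, R _ _ 2 3] at t00 t11 t22 t33 t01 t02 t03 t12 t13 t23
  clear L R t
  have P : ∀ {a b c d : Fin 4} {z : ℂ}, W a b c d = z → W c d a b = z :=
    fun h => (hW.pair _ _ _ _).trans h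
  obtain ⟨w1, w2⟩ := solve_conj h11 c11
  obtain ⟨w3, w4⟩ := solve_conj h21 c21
  obtain ⟨w5, w6⟩ := solve_conj h31 c31
  obtain ⟨w7, w8⟩ := solve_conj h22 c22
  obtain ⟨w9, w10⟩ := solve_conj h32 c32
  obtain ⟨w11, w12⟩ := solve_conj h33 c33
  -- Vanishing Ricci contraction means that the left and the right Hodge dual coincide, so the
  -- remaining components repeat, up to sign, those already found.
  have w13 : W 0 1 3 1 = _ := (show W 0 1 3 1 = W 0 2 2 3 by linear_combination t03).trans w4
  have w14 : W 0 1 1 2 = _ := (show W 0 1 1 2 = W 0 3 2 3 by linear_combination -t02).trans w6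
  have w15 : W 0 3 3 1 = _ := (show W 0 3 3 1 = W 0 2 1 2 by linear_combination -t01).trans w10
  have w16 : W 2 3 2 3 = - _ := (show W 2 3 2 3 = -W 0 1 0 1 by
    linear_combination (1 / 2) * (t22 + t33 - t11 + t00)).trans (congrArg _ w1)
  have w17 : W 3 1 3 1 = - _ := (show W 3 1 3 1 = -W 0 2 0 2 by
    linear_combination (1 / 2) * (t11 + t33 - t22 + t00)).trans (congrArg _ w7)
  have w18 : W 1 2 1 2 = - _ := (show W 1 2 1 2 = -W 0 3 0 3 by
    linear_combination (1 / 2) * (t11 + t22 - t33 + t00)).trans (congrArg _ w11)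
  have w19 : W 2 3 3 1 = - _ := (show W 2 3 3 1 = -W 0 2 0 1 by
    linear_combination -t12 + hW.pair 0 1 0 2 + hW.pair 3 1 2 3).trans (congrArg _ w3)
  have w20 : W 2 3 1 2 = - _ := (show W 2 3 1 2 = -W 0 3 0 1 by
    linear_combination -t13 + hW.pair 0 1 0 3 + hW.pair 1 2 2 3).trans (congrArg _ w5)
  have w21 : W 3 1 1 2 = - _ := (show W 3 1 1 2 = -W 0 2 0 3 by
    linear_combination -t23 + hW.pair 1 2 3 1).trans (congrArg _ w9)
  have q : ∀ z : ℂ, Complex.I * (Complex.I * z) = -z := fun z => by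
    linear_combination z * hI
  simp only [List.mem_cons, List.not_mem_nil, or_false, forall_eq_or_imp, forall_eq]
  simp only [Pi.add_apply, conj4, hk1, hk2, hk3, hks 0 1 0 2, hks 0 1 0 3, hks 0 3 0 2,
    hks _ _ 2 3, hks _ _ 3 1, hks _ _ 1 2, map_mul, Complex.conj_I, w1, w2, w3, w4, w5, w6, w7, w8,
    w9, w10, w11, w12, w13, w14, w15, w16, w17, w18, w19, w20, w21, P w2, P w3, P w4, P w5, P w6,
    P w8, P w9, P w10, P w12, P w13, P w14, P w15, P w19, P w20, P w21, map_neg, neg_mul, q,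
    neg_add, and_self]

lemma ricT_symm {r : T4} (h : IsCurv r) : (ricT gStd r).transpose = ricT gStd r := by
  ext l j
  rw [Matrix.transpose_apply, ricT_gStd, ricT_gStd, h.pair 0 l 0 j, h.pair 1 l 1 j, h.pair 2 l 2 j,
    h.pair 3 l 3 j]

lemma gStd_transpose : gStd.transpose = gStd := by
  ext a b
  rw [Matrix.transpose_apply, gStd_apply, gStd_apply]
  by_cases h : a = b
  · subst h; rfl
  · simp [h, Ne.symm h]

/-- The trace-free Ricci tensor pairs self-dual with anti-self-dual forms, so only the scalar
curvature distinguishes the SD components of `r` from those of its Weyl tensor. The three diagonal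
values add up to zero; this is how the `11` component is written through the other two, with the
cyclic identity. -/
lemma weylT_sd {r : T4} (h : IsCurv r) :
    (weylT gStd r 0 1 0 1 - Complex.I * weylT gStd r 0 1 2 3
      = (-sdComp r 2 3 1 2 3 1 - sdComp r 3 1 2 3 1 2) / 2 - scalT gStd r / 6) ∧
    (weylT gStd r 0 2 0 1 - Complex.I * weylT gStd r 0 2 2 3 = sdComp r 2 3 1 1 2 3 / 2) ∧
    (weylT gStd r 0 3 0 1 - Complex.I * weylT gStd r 0 3 2 3 = sdComp r 3 1 2 1 2 3 / 2) ∧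
    (weylT gStd r 0 2 0 2 - Complex.I * weylT gStd r 0 2 3 1
      = (sdComp r 2 3 1 2 3 1 + scalT gStd r / 6) / 2) ∧
    (weylT gStd r 0 2 0 3 - Complex.I * weylT gStd r 0 2 1 2 = sdComp r 2 3 1 3 1 2 / 2) ∧
    (weylT gStd r 0 3 0 3 - Complex.I * weylT gStd r 0 3 1 2
      = (sdComp r 3 1 2 3 1 2 + scalT gStd r / 6) / 2) := by
  have hw : ∀ a b c d, weylT gStd r a b c d = r a b c d
      - (1 / 2) * wedge (ricT gStd r) gStd a b c d
      + scalT gStd r / 6 * ((1 / 2) * wedge gStd gStd a b c d) := fun a b c d => rfl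
  have L := h.left
  have R := h.right
  have P := h.pair
  have B := h.bianchi 0 1 2 3
  simp only [hw, wedge, scalT_gStd, ricT_gStd, sdComp]
  simp only [gStd_apply, h.diag_left, h.diag_right, L 0 1, L 0 2, L 0 3, L 1 2, L 3 1, L 2 3, R _ _ 0 1,
    R _ _ 0 2, R _ _ 0 3, R _ _ 1 2, R _ _ 3 1, R _ _ 2 3] at B ⊢
  simp only [P 0 1 0 2, P 0 1 0 3, P 0 1 3 1, P 0 1 1 2, P 0 2 0 3, P 0 2 2 3, P 0 2 3 1,
    P 0 2 1 2, P 0 3 2 3, P 0 3 3 1, P 0 3 1 2, P 2 3 3 1, P 2 3 1 2, P 3 1 1 2] at B ⊢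
  clear L R P hw h
  refine ⟨?_, ?_, ?_, ?_, ?_, ?_⟩
  all_goals simp
  · linear_combination -Complex.I * B
  all_goals ring

lemma weylForm_isDouble {u Z : T2} (hu : u.transpose = -u) (hZ : Z.transpose = -Z) (Ω : ℂ) :
    IsDouble (weylForm gStd epsStd u Z Ω) :=
  ((((isDouble_tensor hu hu).smul _).add (isDouble_tensor hu hZ)).add (isDouble_tensor hZ hu)).add
    ((metricSD_isDouble epsStd_isDouble).smul _)

lemma weylForm_std_apply (b c Ω : ℂ) (i j m n : Fin 4) :
    weylForm gStd epsStd (rt • sdStd 1 0 0) (sdStd 0 b c) Ω i j m n =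
      Ω * (sdStd 1 0 0 i j * sdStd 1 0 0 m n)
      + rt * (sdStd 1 0 0 i j * sdStd 0 b c m n) + rt * (sdStd 0 b c i j * sdStd 1 0 0 m n)
      - Ω / 2 * (sdStd 0 1 0 i j * sdStd 0 1 0 m n + sdStd 0 0 1 i j * sdStd 0 0 1 m n) := by
  simp only [weylForm, metricSD_std, Pi.add_apply, Pi.smul_apply, tensor, Matrix.smul_apply,
    smul_eq_mul]
  linear_combination 3 * Ω * sdStd 1 0 0 i j * sdStd 1 0 0 m n * rt_sq

/-- The Weyl tensor of a curvature tensor which satisfies the integrability conditions of an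
umbilical structure, in an adapted frame. -/
lemma frame_weyl (x : Fin 4 → ℂ) (N : T2) {r : T4}
    (h : ∀ d c, dot gStd (curvMat r d c) (rt • sdStd 1 0 0)
      - dot gStd (rt • sdStd 1 0 0) (curvMat r d c) = integ gStd (rt • sdStd 1 0 0) x N d c)
    (hr : IsCurv r) (hreal : ∀ a b c d, (starRingEnd ℂ) (weylT gStd r a b c d) = weylT gStd r a b c d) :
    weylT gStd r = weylForm gStd epsStd (rt • sdStd 1 0 0) (zedT gStd epsStd (rt • sdStd 1 0 0) x N)
        (omegaT gStd (rt • sdStd 1 0 0) x N r)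
      + conj4 (weylForm gStd epsStd (rt • sdStd 1 0 0) (zedT gStd epsStd (rt • sdStd 1 0 0) x N)
        (omegaT gStd (rt • sdStd 1 0 0) x N r)) := by
  obtain ⟨e1, e2, e3, e4, e5⟩ := frame_integ x N r h hr _ rfl
  obtain ⟨w1, w2, w3, w4, w5, w6⟩ := weylT_sd hr
  have hA := antiT_transpose gStd (rt • sdStd 1 0 0) x N
  rw [zedT, app_metricPerp_std _ hA]
  have hΩ : omegaT gStd (rt • sdStd 1 0 0) x N r = -(scalT gStd r / 12 + rt *
      (antiT gStd (rt • sdStd 1 0 0) x N 0 1 - Complex.I * antiT gStd (rt • sdStd 1 0 0) x N 2 3)) := by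
    rw [omegaT, ip_smul_right, ip_comm_std _ _ hA (sdStd_transpose _ _ _), ip_sdStd_left _ _ _ _ hA]
    ring
  have hu : (rt • sdStd 1 0 0).transpose = -(rt • sdStd 1 0 0) := by
    rw [smul_sdStd, sdStd_transpose]
  refine weyl_eq_of_sd (weylT_isCurv gStd_transpose hr (ricT_symm hr)) (ricT_weylT r) hreal
    (weylForm_isDouble hu (sdStd_transpose _ _ _) _) ?_ ?_ ?_ ?_ ?_ ?_ ?_ ?_ ?_ ?_
  · intro a b
    simp only [weylForm_std_apply]
    simp [sdStd]
    grind
  · intro a b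
    simp only [weylForm_std_apply]
    simp [sdStd]
    grind
  · intro a b
    simp only [weylForm_std_apply]
    simp [sdStd]
    grind
  · intro a b c d
    simp only [weylForm_std_apply]
    ring
  -- The six remaining goals match the SD components: the five supplied by the integrability
  -- conditions, and the `11` component, where the trace produces the scalar curvature term of `Ω`.
  all_goals simp only [weylForm_std_apply, hΩ]
  · rw [w1, e3, e5]; simp [sdStd]; ring
  · rw [w2, e1]; simp [sdStd]; ring
  · rw [w3, e2]; simp [sdStd]; ring
  · rw [w4, e3]; simp [sdStd]; ring
  · rw [w5, e4]; simp [sdStd]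
  · rw [w6, e5]; simp [sdStd]; ring

/-! ### Real null vectors, spinors and principal directions -/

/-- The real null vector with spinor `(s, t)`. -/
def spin (s t : ℂ) : Fin 4 → ℝ :=
  ![Complex.normSq s + Complex.normSq t, Complex.normSq s - Complex.normSq t,
    2 * (s * (starRingEnd ℂ) t).re, -2 * (s * (starRingEnd ℂ) t).im]

lemma spin_zero (s t : ℂ) :
    (spin s t 0 : ℂ) = s * (starRingEnd ℂ) s + t * (starRingEnd ℂ) t := by
  simp [spin, Complex.mul_conj]

lemma spin_one (s t : ℂ) :
    (spin s t 1 : ℂ) = s * (starRingEnd ℂ) s - t * (starRingEnd ℂ) t := by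
  simp [spin, Complex.mul_conj]

lemma spin_two (s t : ℂ) :
    (spin s t 2 : ℂ) = s * (starRingEnd ℂ) t + t * (starRingEnd ℂ) s := by
  apply Complex.ext <;> simp [spin] <;> ring

lemma spin_three (s t : ℂ) :
    (spin s t 3 : ℂ) = Complex.I * (s * (starRingEnd ℂ) t - t * (starRingEnd ℂ) s) := by
  apply Complex.ext <;> simp [spin] <;> ring

lemma lowerVec_gStd (l : Fin 4 → ℝ) (a : Fin 4) :
    lowerVec gStd l a = (if a = 0 then -1 else 1) * l a := by
  simp [lowerVec, gStd_apply]

lemma isNullVec_gStd (l : Fin 4 → ℝ) :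
    IsNullVec gStd l ↔ l ≠ 0 ∧ l 0 ^ 2 = l 1 ^ 2 + l 2 ^ 2 + l 3 ^ 2 := by
  rw [IsNullVec, Fin.sum_univ_four]
  simp only [lowerVec_gStd]
  refine and_congr_right fun _ => ?_
  rw [← Complex.ofReal_inj]
  simp
  constructor <;> intro h <;> linear_combination -h

lemma spin_normSq_pos {s t : ℂ} (h : s ≠ 0 ∨ t ≠ 0) : 0 < spin s t 0 := by
  simp only [spin, Matrix.cons_val_zero]
  rcases h with h | h
  · exact add_pos_of_pos_of_nonneg (Complex.normSq_pos.mpr h) (Complex.normSq_nonneg _)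
  · exact add_pos_of_nonneg_of_pos (Complex.normSq_nonneg _) (Complex.normSq_pos.mpr h)

lemma spin_isNullVec {s t : ℂ} (h : s ≠ 0 ∨ t ≠ 0) : IsNullVec gStd (spin s t) := by
  refine (isNullVec_gStd _).2 ⟨fun h0 => (spin_normSq_pos h).ne' (congrFun h0 0), ?_⟩
  rw [← Complex.ofReal_inj]
  push_cast
  rw [spin_zero, spin_one, spin_two, spin_three]
  linear_combination (-(s * (starRingEnd ℂ) t - t * (starRingEnd ℂ) s) ^ 2) * Complex.I_sq

/-- Every real null vector is a multiple of the null vector of a spinor. -/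
lemma exists_spin {l : Fin 4 → ℝ} (h : IsNullVec gStd l) :
    ∃ s t : ℂ, (s ≠ 0 ∨ t ≠ 0) ∧ ∃ c : ℝ, c ≠ 0 ∧ l = c • spin s t := by
  obtain ⟨h0, h⟩ := (isNullVec_gStd l).1 h
  -- The spinor `(l 0 + l 1, l 2 + i l 3)` works, up to scale, except when it vanishes. That happens
  -- only on the null line of the spinor `(0, 1)`.
  by_cases hl : l 0 + l 1 = 0
  · have e : l 2 ^ 2 + l 3 ^ 2 = 0 := by linear_combination (l 0 - l 1) * hl - h
    have h2 : l 2 = 0 := by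
      refine pow_eq_zero_iff two_ne_zero |>.1 (le_antisymm ?_ (sq_nonneg _))
      linarith [sq_nonneg (l 3)]
    have h3 : l 3 = 0 := by simpa [h2] using e
    have hl' : l = l 0 • spin 0 1 := by
      funext i
      fin_cases i <;> simp [spin, h2, h3]
      linarith
    exact ⟨0, 1, Or.inr one_ne_zero, l 0, fun hz => h0 (by rw [hl', hz, zero_smul]), hl'⟩
  · refine ⟨(l 0 + l 1 : ℝ), ⟨l 2, l 3⟩, Or.inl (by exact_mod_cast hl), 1 / (2 * (l 0 + l 1)),
      by positivity, ?_⟩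
    funext i
    have hl2 : 2 * (l 0 + l 1) ≠ 0 := by positivity
    rw [Pi.smul_apply, smul_eq_mul, one_div, eq_inv_mul_iff_mul_eq₀ hl2]
    fin_cases i <;> simp [spin, Complex.normSq_apply] <;> nlinarith

lemma spin_smul (m s t : ℂ) : spin (m * s) (m * t) = Complex.normSq m • spin s t := by
  funext i
  fin_cases i <;> simp [spin, Complex.normSq_apply] <;> ring

/-- The Minkowski product of the two null vectors is `-2` times the squared modulus of the
determinant `s t' - t s'`. Pairing a vanishing combination with either vector isolates the
coefficient of the other. -/
lemma spin_linearIndependent {s t s' t' : ℂ} (h : s * t' - t * s' ≠ 0) :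
    LinearIndependent ℝ ![spin s t, spin s' t'] := by
  rw [LinearIndependent.pair_iff]
  intro a b hab
  have hB : ∀ p q : ℂ, -(p * (starRingEnd ℂ) p + q * (starRingEnd ℂ) q) * ((a : ℂ) * spin s t 0 + b * spin s' t' 0)
      + (p * (starRingEnd ℂ) p - q * (starRingEnd ℂ) q) * (a * spin s t 1 + b * spin s' t' 1)
      + (p * (starRingEnd ℂ) q + q * (starRingEnd ℂ) p) * (a * spin s t 2 + b * spin s' t' 2)
      + Complex.I * (p * (starRingEnd ℂ) q - q * (starRingEnd ℂ) p)
        * (a * spin s t 3 + b * spin s' t' 3) = 0 := by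
    have : ∀ i, (a : ℂ) * spin s t i + b * spin s' t' i = 0 := fun i => by
      exact_mod_cast congrFun hab i
    intro p q
    simp [this]
  have h' : (s * t' - t * s') * (starRingEnd ℂ) (s * t' - t * s') ≠ 0 := mul_ne_zero h ((map_ne_zero _).2 h)
  have e1 := hB s t
  have e2 := hB s' t'
  simp only [spin_zero, spin_one, spin_two, spin_three] at e1 e2
  simp only [map_sub, map_mul] at h'
  have hI := Complex.I_sq
  constructor
  · rw [← Complex.ofReal_eq_zero]
    refine (mul_eq_zero.mp (?_ : (a : ℂ) * _ = 0)).resolve_right h'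
    linear_combination (-1 / 2) * e2 + (1 / 2) * (s' * (starRingEnd ℂ) t' - t' * (starRingEnd ℂ) s') * (a * (s * (starRingEnd ℂ) t - t * (starRingEnd ℂ) s) + b * (s' * (starRingEnd ℂ) t' - t' * (starRingEnd ℂ) s')) * hI
  · rw [← Complex.ofReal_eq_zero]
    refine (mul_eq_zero.mp (?_ : (b : ℂ) * _ = 0)).resolve_right h'
    linear_combination (-1 / 2) * e1 + (1 / 2) * (s * (starRingEnd ℂ) t - t * (starRingEnd ℂ) s) * (a * (s * (starRingEnd ℂ) t - t * (starRingEnd ℂ) s) + b * (s' * (starRingEnd ℂ) t' - t' * (starRingEnd ℂ) s')) * hI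

lemma lowerVec_smul (g : T2) (c : ℝ) (l : Fin 4 → ℝ) (a : Fin 4) :
    lowerVec g (c • l) a = c * lowerVec g l a := by
  simp only [lowerVec, Pi.smul_apply, smul_eq_mul, Complex.ofReal_mul, Finset.mul_sum]
  exact Finset.sum_congr rfl fun b _ => by ring

lemma IsNullVec.smul {g : T2} {l : Fin 4 → ℝ} (h : IsNullVec g l) {c : ℝ} (hc : c ≠ 0) :
    IsNullVec g (c • l) := by
  refine ⟨smul_ne_zero hc h.1, ?_⟩
  have : ∀ a, lowerVec g (c • l) a * (((c • l) a : ℝ) : ℂ) = (c * c) * (lowerVec g l a * l a) := by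
    intro a
    rw [lowerVec_smul, Pi.smul_apply, smul_eq_mul, Complex.ofReal_mul]
    ring
  simp only [this, ← Finset.mul_sum, h.2, mul_zero]

lemma IsPrincipalVec.smul {g F : T2} {l : Fin 4 → ℝ} (h : IsPrincipalVec g F l) {c : ℝ}
    (hc : c ≠ 0) : IsPrincipalVec g F (c • l) := by
  obtain ⟨h1, k, hk⟩ := h
  refine ⟨h1.smul hc, k, fun a => ?_⟩
  rw [lowerVec_smul, mul_left_comm, ← hk, Finset.mul_sum]
  refine Finset.sum_congr rfl fun b _ => ?_
  rw [Pi.smul_apply, smul_eq_mul, Complex.ofReal_mul]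
  ring

/-- The quadratic form on spinors of the SD bivector with components `a`, `b`, `c`. -/
def spinForm (a b c s t : ℂ) : ℂ :=
  (b + Complex.I * c) * s ^ 2 - 2 * a * s * t + (Complex.I * c - b) * t ^ 2

lemma isPrincipalVec_spin (a b c : ℂ) {s t : ℂ} (h : s ≠ 0 ∨ t ≠ 0) :
    IsPrincipalVec gStd (sdStd a b c) (spin s t) ↔ spinForm a b c s t = 0 := by
  have hD : s * (starRingEnd ℂ) s + t * (starRingEnd ℂ) t ≠ 0 := by
    rw [← spin_zero]
    exact_mod_cast (spin_normSq_pos h).ne'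
  have hI := Complex.I_sq
  constructor
  · rintro ⟨-, k, hk⟩
    simp only [Fin.sum_univ_four, lowerVec_gStd, spin_zero, spin_one, spin_two, spin_three] at hk
    refine (mul_eq_zero.mp (?_ : (s * (starRingEnd ℂ) s + t * (starRingEnd ℂ) t) * _ = 0)).resolve_left hD
    have k1 := hk 1
    have k2 := hk 2
    have k3 := hk 3
    simp [sdStd, spin_one, spin_two, spin_three] at k1 k2 k3
    rw [spinForm]
    generalize (starRingEnd ℂ) s = S at *
    generalize (starRingEnd ℂ) t = T at *
    -- The multipliers are half the components of the vector `spinDual s t`. It is orthogonal to the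
    -- null vector, so the unknown eigenvalue disappears.
    linear_combination -s * t * k1 + (s ^ 2 - t ^ 2) / 2 * k2 + Complex.I * (s ^ 2 + t ^ 2) / 2 * k3
      + (s * t * b * (s * T - t * S) + (s ^ 2 - t ^ 2) / 2 * a * (s * T - t * S)
        - (s ^ 2 + t ^ 2) / 2 * (-b * (s * S - t * T) + a * (s * T + t * S)
          - k * (s * T - t * S))) * hI
  · intro hq
    -- The eigenvalue is read off from the time component of the equation, where `l⁰` is positive.
    refine ⟨spin_isNullVec h, (a * (s * (starRingEnd ℂ) s - t * (starRingEnd ℂ) t)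
      + b * (s * (starRingEnd ℂ) t + t * (starRingEnd ℂ) s)
      + c * (Complex.I * (s * (starRingEnd ℂ) t - t * (starRingEnd ℂ) s))) /
      (s * (starRingEnd ℂ) s + t * (starRingEnd ℂ) t), fun i => ?_⟩
    rw [div_mul_eq_mul_div, eq_div_iff hD]
    rw [spinForm] at hq
    fin_cases i <;> simp [sdStd, Fin.sum_univ_four, lowerVec_gStd, spin_zero, spin_one, spin_two,
      spin_three] <;> generalize (starRingEnd ℂ) s = S at * <;>
      generalize (starRingEnd ℂ) t = T at *
    · ring
    · grind
    · grind
    · grind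

/-- Homogeneous roots: the two solutions are points of the projective line, one of them at infinity
when `A = 0`. -/
lemma exists_roots {A B C : ℂ} (h : B ^ 2 - 4 * A * C ≠ 0) :
    ∃ s₁ t₁ s₂ t₂ : ℂ, s₁ * t₂ - t₁ * s₂ ≠ 0 ∧
      ∀ s t, A * s ^ 2 + B * s * t + C * t ^ 2 = 0 ↔ s * t₁ = t * s₁ ∨ s * t₂ = t * s₂ := by
  by_cases hA : A = 0
  · subst hA
    have hB : B ≠ 0 := by rintro rfl; simp at h
    refine ⟨1, 0, -C, B, by simpa using hB, fun s t => ?_⟩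
    rw [show 0 * s ^ 2 + B * s * t + C * t ^ 2 = t * (s * B - t * -C) by ring, mul_eq_zero,
      sub_eq_zero]
    simp [eq_comm]
  · obtain ⟨d, hd⟩ := IsAlgClosed.exists_pow_nat_eq (B ^ 2 - 4 * A * C) two_pos
    have hd0 : d ≠ 0 := by rintro rfl; exact h (by rw [← hd]; simp)
    refine ⟨-B + d, 2 * A, -B - d, 2 * A, ?_, fun s t => ?_⟩
    · rw [show (-B + d) * (2 * A) - 2 * A * (-B - d) = 4 * A * d by ring]
      exact mul_ne_zero (mul_ne_zero (by norm_num) hA) hd0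
    · have h4 : (4 * A) ≠ 0 := mul_ne_zero (by norm_num) hA
      rw [← mul_right_inj' h4, mul_zero, show 4 * A * (A * s ^ 2 + B * s * t + C * t ^ 2)
        = (s * (2 * A) - t * (-B + d)) * (s * (2 * A) - t * (-B - d)) by
          linear_combination t ^ 2 * hd, mul_eq_zero, sub_eq_zero, sub_eq_zero]

lemma spin_eq_of_mul_eq {s t s₁ t₁ : ℂ} (h : s ≠ 0 ∨ t ≠ 0) (h₁ : s₁ ≠ 0 ∨ t₁ ≠ 0)
    (he : s * t₁ = t * s₁) : ∃ c : ℝ, c ≠ 0 ∧ spin s t = c • spin s₁ t₁ := by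
  obtain ⟨m, hs, ht⟩ : ∃ m, s = m * s₁ ∧ t = m * t₁ := by
    rcases h₁ with h₁ | h₁
    · exact ⟨s / s₁, by field_simp, by field_simp; rw [he]⟩
    · exact ⟨t / t₁, by field_simp; rw [he], by field_simp⟩
  refine ⟨Complex.normSq m, fun h0 => ?_, by rw [hs, ht, spin_smul]⟩
  rw [Complex.normSq_eq_zero] at h0
  subst h0
  simp_all

lemma isPrincipalVec_std_iff {a b c : ℂ} (h : a ^ 2 + b ^ 2 + c ^ 2 ≠ 0) :
    ∃ s₁ t₁ s₂ t₂ : ℂ, s₁ * t₂ - t₁ * s₂ ≠ 0 ∧ spinForm a b c s₁ t₁ = 0 ∧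
      spinForm a b c s₂ t₂ = 0 ∧ ∀ l, IsPrincipalVec gStd (sdStd a b c) l ↔
        ∃ r : ℝ, r ≠ 0 ∧ (l = r • spin s₁ t₁ ∨ l = r • spin s₂ t₂) := by
  obtain ⟨s₁, t₁, s₂, t₂, h0, hq⟩ := exists_roots
    (A := b + Complex.I * c) (B := -2 * a) (C := Complex.I * c - b) (by
      rw [show (-2 * a) ^ 2 - 4 * (b + Complex.I * c) * (Complex.I * c - b)
        = 4 * (a ^ 2 + b ^ 2 + c ^ 2) by linear_combination -4 * c ^ 2 * Complex.I_sq]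
      exact mul_ne_zero (by norm_num) h)
  have hq' : ∀ s t, spinForm a b c s t = 0 ↔ s * t₁ = t * s₁ ∨ s * t₂ = t * s₂ := fun s t => by
    rw [← hq s t, spinForm, show (b + Complex.I * c) * s ^ 2 - 2 * a * s * t +
      (Complex.I * c - b) * t ^ 2 = (b + Complex.I * c) * s ^ 2 + -2 * a * s * t +
      (Complex.I * c - b) * t ^ 2 by ring]
  have n1 : s₁ ≠ 0 ∨ t₁ ≠ 0 := by
    by_contra! hn
    exact h0 (by rw [hn.1, hn.2]; ring)
  have n2 : s₂ ≠ 0 ∨ t₂ ≠ 0 := by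
    by_contra! hn
    exact h0 (by rw [hn.1, hn.2]; ring)
  have r1 : spinForm a b c s₁ t₁ = 0 := (hq' _ _).2 (Or.inl (mul_comm _ _))
  have r2 : spinForm a b c s₂ t₂ = 0 := (hq' _ _).2 (Or.inr (mul_comm _ _))
  refine ⟨s₁, t₁, s₂, t₂, h0, r1, r2, fun l => ⟨fun hl => ?_, ?_⟩⟩
  · obtain ⟨s, t, hn, r, hr, rfl⟩ := exists_spin hl.1
    have hp : IsPrincipalVec gStd (sdStd a b c) (spin s t) := by
      have := hl.smul (inv_ne_zero hr)
      rwa [smul_smul, inv_mul_cancel₀ hr, one_smul] at this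
    rcases (hq' s t).1 ((isPrincipalVec_spin a b c hn).1 hp) with he | he
    · obtain ⟨r', hr', he'⟩ := spin_eq_of_mul_eq hn n1 he
      exact ⟨r * r', mul_ne_zero hr hr', Or.inl (by rw [he', smul_smul])⟩
    · obtain ⟨r', hr', he'⟩ := spin_eq_of_mul_eq hn n2 he
      exact ⟨r * r', mul_ne_zero hr hr', Or.inr (by rw [he', smul_smul])⟩
  · rintro ⟨r, hr, rfl | rfl⟩
    · exact ((isPrincipalVec_spin a b c n1).2 r1).smul hr
    · exact ((isPrincipalVec_spin a b c n2).2 r2).smul hr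

/-! ### Debever directions -/

lemma IsDebeverVec.smul {g : T2} {W : T4} {l : Fin 4 → ℝ} (h : IsDebeverVec g W l) {c : ℝ}
    (hc : c ≠ 0) : IsDebeverVec g W (c • l) := by
  refine ⟨h.1.smul hc, fun a b e f => ?_⟩
  have hN : ∀ b e, ∑ i, ∑ j, W b i j e * (((c • l) i : ℝ) : ℂ) * (((c • l) j : ℝ) : ℂ)
      = c ^ 2 * ∑ i, ∑ j, W b i j e * (l i : ℂ) * (l j : ℂ) := by
    intro b e
    simp only [Finset.mul_sum, Pi.smul_apply, smul_eq_mul, Complex.ofReal_mul]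
    exact Finset.sum_congr rfl fun i _ => Finset.sum_congr rfl fun j _ => by ring
  have := h.2 a b e f
  simp only at this
  simp only [lowerVec_smul, hN]
  linear_combination c ^ 4 * this

/-- The contraction `F_{ab} l^b`. -/
def contr (F : T2) (l : Fin 4 → ℝ) : Fin 4 → ℂ := fun a => ∑ b, F a b * (l b : ℂ)

lemma contr_tensor {F H : T2} (hH : H.transpose = -H) (l : Fin 4 → ℝ) (b e : Fin 4) :
    ∑ c, ∑ d, tensor F H b c d e * (l c : ℂ) * (l d : ℂ) = -(contr F l b * contr H l e) := by
  simp only [contr, tensor, entry_antisymm hH e, Fin.sum_univ_four]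
  ring

/-- The volume element drops out by antisymmetry, and one term of `G` by nullity. What remains is a
multiple of `l ⊗ l`, invisible to the Debever condition. -/
lemma contr_metricSD {l : Fin 4 → ℝ} (hl : IsNullVec gStd l) (b e : Fin 4) :
    ∑ c, ∑ d, metricSD gStd epsStd b c d e * (l c : ℂ) * (l d : ℂ)
      = (1 / 2) * (lowerVec gStd l b * lowerVec gStd l e) := by
  have h1 : ∑ c, ∑ d, epsStd b c d e * (l c : ℂ) * (l d : ℂ) = 0 := by
    have hs : ∀ c d, epsStd b c d e = -epsStd b d c e := fun c d => by
      simp [epsStd]; ring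
    have := Finset.sum_comm (s := Finset.univ) (t := Finset.univ)
      (f := fun c d => epsStd b c d e * (l c : ℂ) * (l d : ℂ))
    have h2 : ∑ d, ∑ c, epsStd b c d e * (l c : ℂ) * (l d : ℂ)
        = -∑ d, ∑ c, epsStd b d c e * (l d : ℂ) * (l c : ℂ) := by
      rw [← Finset.sum_neg_distrib]
      refine Finset.sum_congr rfl fun d _ => ?_
      rw [← Finset.sum_neg_distrib]
      refine Finset.sum_congr rfl fun c _ => ?_
      rw [hs c d]
      ring
    rw [h2] at this
    exact self_eq_neg.mp this
  have h3 : ∑ c, ∑ d, gStd b d * gStd c e * (l c : ℂ) * (l d : ℂ)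
      = lowerVec gStd l b * lowerVec gStd l e := by
    have hs : ∀ c, gStd c e = gStd e c := fun c => congrFun (congrFun gStd_transpose e) c
    simp only [lowerVec, hs, Fin.sum_univ_four]
    ring
  have h4 : ∑ c, ∑ d, gStd b e * gStd c d * (l c : ℂ) * (l d : ℂ) = 0 := by
    have := hl.2
    simp only [lowerVec, Fin.sum_univ_four] at this ⊢
    linear_combination gStd b e * this
  have h5 : ∀ c d, metricSD gStd epsStd b c d e * (l c : ℂ) * (l d : ℂ)
      = (1 / 2) * (gStd b d * gStd c e * (l c : ℂ) * (l d : ℂ))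
      - (1 / 2) * (gStd b e * gStd c d * (l c : ℂ) * (l d : ℂ))
      - (Complex.I / 2) * (epsStd b c d e * (l c : ℂ) * (l d : ℂ)) := fun c d => by
    simp only [metricSD, metricG, wedge, Pi.smul_apply, Pi.sub_apply, smul_eq_mul]
    ring
  simp only [h5, Finset.sum_sub_distrib, ← Finset.mul_sum, h1, h3, h4]
  ring

/-- The contraction `K_{bcde} l^c l^d` of the tensor `weylForm`. -/
lemma contr_weylForm {u Z : T2} (hu : u.transpose = -u) (hZ : Z.transpose = -Z) (Ω : ℂ)
    {l : Fin 4 → ℝ} (hl : IsNullVec gStd l) (b e : Fin 4) :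
    ∑ c, ∑ d, weylForm gStd epsStd u Z Ω b c d e * (l c : ℂ) * (l d : ℂ)
      = -(1 / 2) * (contr u l b * contr ((3 * Ω) • u + (2 : ℂ) • Z) l e
          + contr ((3 * Ω) • u + (2 : ℂ) • Z) l b * contr u l e)
        + Ω / 2 * (lowerVec gStd l b * lowerVec gStd l e) := by
  have hV : ∀ a, contr ((3 * Ω) • u + (2 : ℂ) • Z) l a = 3 * Ω * contr u l a + 2 * contr Z l a := by
    intro a
    simp only [contr, Matrix.add_apply, Matrix.smul_apply, smul_eq_mul, add_mul,
      Finset.sum_add_distrib, Finset.mul_sum, mul_assoc]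
  simp only [weylForm, Pi.add_apply, Pi.smul_apply, smul_eq_mul, add_mul, Finset.sum_add_distrib,
    mul_assoc, ← Finset.mul_sum]
  have e1 := contr_tensor (F := u) hu l b e
  have e2 := contr_tensor (F := u) hZ l b e
  have e3 := contr_tensor (F := Z) hu l b e
  have e4 := contr_metricSD hl b e
  simp only [mul_assoc] at e1 e2 e3 e4
  rw [e1, e2, e3, e4, hV, hV]
  ring

lemma contr_weyl {u Z : T2} (hu : u.transpose = -u) (hZ : Z.transpose = -Z) (Ω : ℂ)
    {l : Fin 4 → ℝ} (hl : IsNullVec gStd l) (b e : Fin 4) :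
    ∑ c, ∑ d, (weylForm gStd epsStd u Z Ω + conj4 (weylForm gStd epsStd u Z Ω)) b c d e
        * (l c : ℂ) * (l d : ℂ)
      = -(1 / 2) * (contr u l b * contr ((3 * Ω) • u + (2 : ℂ) • Z) l e
          + contr ((3 * Ω) • u + (2 : ℂ) • Z) l b * contr u l e)
        + Ω / 2 * (lowerVec gStd l b * lowerVec gStd l e)
        + (starRingEnd ℂ) (-(1 / 2) * (contr u l b * contr ((3 * Ω) • u + (2 : ℂ) • Z) l e
          + contr ((3 * Ω) • u + (2 : ℂ) • Z) l b * contr u l e)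
        + Ω / 2 * (lowerVec gStd l b * lowerVec gStd l e)) := by
  rw [← contr_weylForm hu hZ Ω hl b e, map_sum, ← Finset.sum_add_distrib]
  refine Finset.sum_congr rfl fun c _ => ?_
  rw [map_sum, ← Finset.sum_add_distrib]
  refine Finset.sum_congr rfl fun d _ => ?_
  simp only [Pi.add_apply, conj4, map_mul, Complex.conj_ofReal]
  ring

lemma lowerVec_gStd_conj (l : Fin 4 → ℝ) (a : Fin 4) :
    (starRingEnd ℂ) (lowerVec gStd l a) = lowerVec gStd l a := by
  rw [lowerVec_gStd]
  split_ifs <;> simp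

/-- If one factor of `u⊗V + V⊗u` maps `l` to a multiple of `l`, the contraction of the Weyl tensor
with `l` twice has the form `l ⊗ y + y ⊗ l`. Antisymmetrizing with `l` on both sides annihilates it.
-/
lemma isDebeverVec_of_contr {u Z : T2} (hu : u.transpose = -u) (hZ : Z.transpose = -Z) (Ω : ℂ)
    {l : Fin 4 → ℝ} (h : IsPrincipalVec gStd u l ∨
      IsPrincipalVec gStd ((3 * Ω) • u + (2 : ℂ) • Z) l) :
    IsDebeverVec gStd (weylForm gStd epsStd u Z Ω + conj4 (weylForm gStd epsStd u Z Ω)) l := by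
  have hl : IsNullVec gStd l := h.elim And.left And.left
  refine ⟨hl, ?_⟩
  obtain ⟨y, hy⟩ : ∃ y : Fin 4 → ℂ, ∀ b e, ∑ c, ∑ d,
      (weylForm gStd epsStd u Z Ω + conj4 (weylForm gStd epsStd u Z Ω)) b c d e
        * (l c : ℂ) * (l d : ℂ) = lowerVec gStd l b * y e + y b * lowerVec gStd l e := by
    simp only [contr_weyl hu hZ Ω hl, map_add, map_mul, lowerVec_gStd_conj]
    rcases h with ⟨-, k, hk⟩ | ⟨-, k, hk⟩
    · have hk' : ∀ a, contr u l a = k * lowerVec gStd l a := hk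
      refine ⟨fun a => -(1 / 2) * (k * contr ((3 * Ω) • u + (2 : ℂ) • Z) l a) + Ω / 4 * lowerVec gStd l a
        + (starRingEnd ℂ) (-(1 / 2) * (k * contr ((3 * Ω) • u + (2 : ℂ) • Z) l a))
        + (starRingEnd ℂ) (Ω / 2) / 2 * lowerVec gStd l a, fun b e => ?_⟩
      simp only [hk', map_mul, lowerVec_gStd_conj]
      ring
    · have hk' : ∀ a, contr ((3 * Ω) • u + (2 : ℂ) • Z) l a = k * lowerVec gStd l a := hk
      refine ⟨fun a => -(1 / 2) * (k * contr u l a) + Ω / 4 * lowerVec gStd l a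
        + (starRingEnd ℂ) (-(1 / 2) * (k * contr u l a))
        + (starRingEnd ℂ) (Ω / 2) / 2 * lowerVec gStd l a, fun b e => ?_⟩
      simp only [hk', map_mul, lowerVec_gStd_conj]
      ring
  intro k N a b e f
  simp only [N, hy, k]
  ring

/-- The complex null vector which, together with the null vector of the spinor `(s, t)`, spans an
anti-self-dual null plane. -/
def spinDual (s t : ℂ) : Fin 4 → ℂ := ![0, -2 * s * t, s ^ 2 - t ^ 2, Complex.I * (s ^ 2 + t ^ 2)]

lemma spinDual_lowerVec (s t : ℂ) : ∑ a, spinDual s t a * lowerVec gStd (spin s t) a = 0 := by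
  simp [Fin.sum_univ_four, spinDual, lowerVec_gStd, spin_one, spin_two, spin_three]
  linear_combination (s ^ 2 + t ^ 2) * (s * (starRingEnd ℂ) t - t * (starRingEnd ℂ) s)
    * Complex.I_sq

lemma spinDual_contr (a b c s t : ℂ) : ∑ i, spinDual s t i * contr (sdStd a b c) (spin s t) i =
    2 * (s * (starRingEnd ℂ) s + t * (starRingEnd ℂ) t) * spinForm a b c s t := by
  simp [Fin.sum_univ_four, spinDual, contr, sdStd, spin_zero, spin_one, spin_two, spin_three,
    spinForm]
  have hI := Complex.I_sq
  generalize (starRingEnd ℂ) s = S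
  generalize (starRingEnd ℂ) t = T
  grind

lemma spinDual_contr_conj (a b c s t : ℂ) :
    ∑ i, spinDual s t i * (starRingEnd ℂ) (contr (sdStd a b c) (spin s t) i) = 0 := by
  simp [Fin.sum_univ_four, spinDual, contr, sdStd, spin_zero, spin_one, spin_two, spin_three]
  have hI := Complex.I_sq
  generalize (starRingEnd ℂ) s = S
  generalize (starRingEnd ℂ) t = T
  generalize (starRingEnd ℂ) a = a
  generalize (starRingEnd ℂ) b = b
  generalize (starRingEnd ℂ) c = c
  grind

/-- The Debever condition is contracted with `m` in one index of each antisymmetrized pair, the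
other indices being `0`. As `m` annihilates `k`, only `k 0 ^ 2` times the value of `N` on `m`
survives. -/
lemma contr_of_debever {k m : Fin 4 → ℂ} {N : T2}
    (h : ∀ a b e f, k a * N b e * k f - k b * N a e * k f - k a * N b f * k e
      + k b * N a f * k e = 0) (hm : ∑ a, m a * k a = 0) (hk : k 0 ≠ 0) :
    ∑ b, ∑ e, m b * m e * N b e = 0 := by
  have hs : ∑ b, ∑ e, m b * m e * (k 0 * N b e * k 0 - k b * N 0 e * k 0 - k 0 * N b 0 * k e
      + k b * N 0 0 * k e) = 0 := by simp [h]
  refine (mul_eq_zero.1 (?_ : k 0 ^ 2 * _ = 0)).resolve_left (pow_ne_zero 2 hk)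
  simp only [Fin.sum_univ_four] at hs hm ⊢
  linear_combination hs + (k 0 * (m 0 * N 0 0 + m 1 * N 0 1 + m 2 * N 0 2 + m 3 * N 0 3)
    + k 0 * (m 0 * N 0 0 + m 1 * N 1 0 + m 2 * N 2 0 + m 3 * N 3 0)
    - N 0 0 * (m 0 * k 0 + m 1 * k 1 + m 2 * k 2 + m 3 * k 3)) * hm

/-- Contraction with `spinDual` twice kills the metric term and, since that vector lies in an
anti-self-dual null plane with `l`, the conjugate term. The product of the quadratic forms of `u`
and `V` is left. -/
lemma isPrincipalVec_of_isDebeverVec {a b c a' b' c' a'' b'' c'' Ω : ℂ}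
    (hV : (3 * Ω) • sdStd a b c + (2 : ℂ) • sdStd a' b' c' = sdStd a'' b'' c'')
    {l : Fin 4 → ℝ} (h : IsDebeverVec gStd (weylForm gStd epsStd (sdStd a b c) (sdStd a' b' c') Ω
      + conj4 (weylForm gStd epsStd (sdStd a b c) (sdStd a' b' c') Ω)) l) :
    IsPrincipalVec gStd (sdStd a b c) l ∨ IsPrincipalVec gStd (sdStd a'' b'' c'') l := by
  obtain ⟨s, t, hn, r, hr, rfl⟩ := exists_spin h.1
  have h' := h.smul (inv_ne_zero hr)
  rw [smul_smul, inv_mul_cancel₀ hr, one_smul] at h'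
  have hD : s * (starRingEnd ℂ) s + t * (starRingEnd ℂ) t ≠ 0 := by
    rw [← spin_zero]
    exact_mod_cast (spin_normSq_pos hn).ne'
  suffices hs : spinForm a b c s t * spinForm a'' b'' c'' s t = 0 by
    rcases mul_eq_zero.1 hs with hs | hs
    · exact Or.inl (((isPrincipalVec_spin _ _ _ hn).2 hs).smul hr)
    · exact Or.inr (((isPrincipalVec_spin _ _ _ hn).2 hs).smul hr)
  have hN := contr_weyl (sdStd_transpose a b c) (sdStd_transpose a' b' c') Ω h'.1
  rw [hV] at hN
  have e1 := spinDual_contr a b c s t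
  have e2 := spinDual_contr a'' b'' c'' s t
  have e3 := spinDual_contr_conj a b c s t
  have e4 := spinDual_contr_conj a'' b'' c'' s t
  have e5 := spinDual_lowerVec s t
  have hk0 : lowerVec gStd (spin s t) 0 ≠ 0 := by
    rw [lowerVec_gStd, spin_zero, if_pos rfl, neg_one_mul]
    exact neg_ne_zero.2 hD
  have key := contr_of_debever h'.2 e5 hk0
  simp only [hN, map_add, map_mul, lowerVec_gStd_conj] at key
  have key' : -((∑ i, spinDual s t i * contr (sdStd a b c) (spin s t) i)
        * (∑ i, spinDual s t i * contr (sdStd a'' b'' c'') (spin s t) i))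
      + (Ω / 2 + (starRingEnd ℂ) (Ω / 2))
        * (∑ i, spinDual s t i * lowerVec gStd (spin s t) i) ^ 2
      + 2 * (starRingEnd ℂ) (-(1 / 2))
        * ((∑ i, spinDual s t i * (starRingEnd ℂ) (contr (sdStd a b c) (spin s t) i))
        * (∑ i, spinDual s t i * (starRingEnd ℂ) (contr (sdStd a'' b'' c'') (spin s t) i))) = 0 := by
    rw [← key]
    simp only [Fin.sum_univ_four]
    ring
  rw [e1, e2, e3, e4, e5] at key'
  refine (mul_eq_zero.1 (?_ : (-4 * (s * (starRingEnd ℂ) s + t * (starRingEnd ℂ) t) ^ 2) * _ = 0)).resolve_left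
    (mul_ne_zero (by norm_num) (pow_ne_zero 2 hD))
  linear_combination key'

/-- The Debever directions of the Weyl tensor in an adapted frame. -/
lemma isDebeverVec_std_iff (b c Ω : ℂ) (l : Fin 4 → ℝ) :
    IsDebeverVec gStd (weylForm gStd epsStd (rt • sdStd 1 0 0) (sdStd 0 b c) Ω
      + conj4 (weylForm gStd epsStd (rt • sdStd 1 0 0) (sdStd 0 b c) Ω)) l ↔
    IsPrincipalVec gStd (rt • sdStd 1 0 0) l ∨
      IsPrincipalVec gStd ((3 * Ω) • (rt • sdStd 1 0 0) + (2 : ℂ) • sdStd 0 b c) l := by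
  constructor
  · intro h
    have hV : (3 * Ω) • (rt • sdStd 1 0 0) + (2 : ℂ) • sdStd 0 b c
        = sdStd (3 * Ω * rt) (2 * b) (2 * c) := by
      simp [smul_sdStd, sdStd_add]
    rw [hV]
    rw [smul_sdStd] at hV h ⊢
    exact isPrincipalVec_of_isDebeverVec hV h
  · refine isDebeverVec_of_contr ?_ (sdStd_transpose _ _ _) Ω
    rw [smul_sdStd, sdStd_transpose]

lemma isNull_pair_linearIndependent {a b c a' b' c' s t s' t' : ℂ}
    (h : spinForm a b c s t = 0) (h' : spinForm a' b' c' s' t' = 0) (hn : s ≠ 0 ∨ t ≠ 0)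
    (hn' : s' ≠ 0 ∨ t' ≠ 0)
    (hq : ∀ x y : ℂ, x ≠ 0 ∨ y ≠ 0 → spinForm a b c x y = 0 → spinForm a' b' c' x y ≠ 0) :
    LinearIndependent ℝ ![spin s t, spin s' t'] := by
  refine spin_linearIndependent fun he => hq s t hn h ?_
  obtain ⟨m, rfl, rfl⟩ : ∃ m, s = m * s' ∧ t = m * t' := by
    rw [sub_eq_zero] at he
    rcases hn' with h₁ | h₁
    · exact ⟨s / s', by field_simp, by field_simp; rw [he]⟩
    · exact ⟨t / t', by field_simp; rw [he], by field_simp⟩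
  rw [spinForm] at h' ⊢
  linear_combination m ^ 2 * h'

/-- The four Debever directions in an adapted frame. -/
lemma frame_debever {b c Ω : ℂ} (hq : b ^ 2 + c ^ 2 ≠ 0)
    (hα : 9 * Ω ^ 2 + 8 * (b ^ 2 + c ^ 2) ≠ 0) :
    ∃ k : Fin 4 → (Fin 4 → ℝ),
      (∀ i j, i ≠ j → LinearIndependent ℝ ![k i, k j]) ∧
      (∀ l, IsDebeverVec gStd (weylForm gStd epsStd (rt • sdStd 1 0 0) (sdStd 0 b c) Ω
          + conj4 (weylForm gStd epsStd (rt • sdStd 1 0 0) (sdStd 0 b c) Ω)) l ↔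
        ∃ i, ∃ c : ℝ, c ≠ 0 ∧ l = c • k i) ∧
      (∀ l, IsPrincipalVec gStd (rt • sdStd 1 0 0) l ↔
        ∃ c : ℝ, c ≠ 0 ∧ (l = c • k 0 ∨ l = c • k 1)) ∧
      (∀ l, IsPrincipalVec gStd ((3 * Ω) • (rt • sdStd 1 0 0) + (2 : ℂ) • sdStd 0 b c) l ↔
        ∃ c : ℝ, c ≠ 0 ∧ (l = c • k 2 ∨ l = c • k 3)) := by
  have hu : rt • sdStd 1 0 0 = sdStd rt 0 0 := by simp [smul_sdStd]
  have hV : (3 * Ω) • (rt • sdStd 1 0 0) + (2 : ℂ) • sdStd 0 b c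
      = sdStd (3 * Ω * rt) (2 * b) (2 * c) := by
    simp [smul_sdStd, sdStd_add]
  have hrt : rt ≠ 0 := fun h => by simpa [h] using rt_sq
  obtain ⟨s₁, t₁, s₂, t₂, h12, q1, q2, hP⟩ := isPrincipalVec_std_iff (a := rt) (b := 0) (c := 0)
    (by simpa using hrt)
  obtain ⟨s₃, t₃, s₄, t₄, h34, q3, q4, hP'⟩ := isPrincipalVec_std_iff
    (a := 3 * Ω * rt) (b := 2 * b) (c := 2 * c) (by
      rw [show (3 * Ω * rt) ^ 2 + (2 * b) ^ 2 + (2 * c) ^ 2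
        = (1 / 2) * (9 * Ω ^ 2 + 8 * (b ^ 2 + c ^ 2)) by linear_combination 9 * Ω ^ 2 * rt_sq]
      exact mul_ne_zero (by norm_num) hα)
  have ne : ∀ {s t s' t' : ℂ}, s * t' - t * s' ≠ 0 → (s ≠ 0 ∨ t ≠ 0) ∧ (s' ≠ 0 ∨ t' ≠ 0) := by
    intro s t s' t' h
    constructor <;> by_contra! hn <;> exact h (by rw [hn.1, hn.2]; ring)
  obtain ⟨n1, n2⟩ := ne h12
  obtain ⟨n3, n4⟩ := ne h34
  -- The form of `u` is `-2 rt x y`, with roots `(1, 0)` and `(0, 1)`. There the form of `V` is a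
  -- nonzero multiple of `ic + b` or `ic - b`, whose product is `-(b² + c²)`.
  have cross : ∀ x y : ℂ, x ≠ 0 ∨ y ≠ 0 → spinForm rt 0 0 x y = 0 →
      spinForm (3 * Ω * rt) (2 * b) (2 * c) x y ≠ 0 := by
    intro x y hxy h h'
    simp only [spinForm] at h h'
    have hxy0 : x * y = 0 := by
      refine (mul_eq_zero.1 (?_ : (-2 * rt) * (x * y) = 0)).resolve_left
        (mul_ne_zero (by norm_num) hrt)
      linear_combination h
    rcases mul_eq_zero.1 hxy0 with rfl | rfl
    · have hy : y ≠ 0 := by simpa using hxy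
      have : Complex.I * c - b = 0 := by
        refine (mul_eq_zero.1 (?_ : (2 * y ^ 2) * _ = 0)).resolve_left
          (mul_ne_zero two_ne_zero (pow_ne_zero 2 hy))
        linear_combination h'
      exact hq (by linear_combination -(Complex.I * c + b) * this + c ^ 2 * Complex.I_sq)
    · have hx : x ≠ 0 := by simpa using hxy
      have : Complex.I * c + b = 0 := by
        refine (mul_eq_zero.1 (?_ : (2 * x ^ 2) * _ = 0)).resolve_left
          (mul_ne_zero two_ne_zero (pow_ne_zero 2 hx))
        linear_combination h'
      exact hq (by linear_combination -(Complex.I * c - b) * this + c ^ 2 * Complex.I_sq)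
  refine ⟨![spin s₁ t₁, spin s₂ t₂, spin s₃ t₃, spin s₄ t₄], ?_, ?_, ?_, ?_⟩
  · have key : ∀ i j : Fin 4, i < j → LinearIndependent ℝ
        ![(![spin s₁ t₁, spin s₂ t₂, spin s₃ t₃, spin s₄ t₄] : Fin 4 → Fin 4 → ℝ) i,
          (![spin s₁ t₁, spin s₂ t₂, spin s₃ t₃, spin s₄ t₄] : Fin 4 → Fin 4 → ℝ) j] := by
      intro i j hij
      fin_cases i <;> fin_cases j <;> simp at hij
      · exact spin_linearIndependent h12
      · exact isNull_pair_linearIndependent q1 q3 n1 n3 cross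
      · exact isNull_pair_linearIndependent q1 q4 n1 n4 cross
      · exact isNull_pair_linearIndependent q2 q3 n2 n3 cross
      · exact isNull_pair_linearIndependent q2 q4 n2 n4 cross
      · exact spin_linearIndependent h34
    intro i j hij
    rcases lt_or_gt_of_ne hij with h | h
    · exact key i j h
    · exact LinearIndependent.pair_symm_iff.1 (key j i h)
  · intro l
    rw [isDebeverVec_std_iff, hV, hu, hP, hP']
    constructor
    · rintro (⟨r, hr, h | h⟩ | ⟨r, hr, h | h⟩)
      exacts [⟨0, r, hr, h⟩, ⟨1, r, hr, h⟩, ⟨2, r, hr, h⟩, ⟨3, r, hr, h⟩]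
    · rintro ⟨i, r, hr, h⟩
      fin_cases i
      exacts [Or.inl ⟨r, hr, Or.inl h⟩, Or.inl ⟨r, hr, Or.inr h⟩, Or.inr ⟨r, hr, Or.inl h⟩,
        Or.inr ⟨r, hr, Or.inr h⟩]
  · intro l
    rw [hu, hP]
    rfl
  · intro l
    rw [hV, hP']
    rfl

/-! ### Eigenvalues and eigenbivectors of the self-dual Weyl tensor -/

lemma raise_sum_smul (g : T2) {ι : Type*} (s : Finset ι) (c : ι → ℂ) (F : ι → T2) :
    raise g (∑ i ∈ s, c i • F i) = ∑ i ∈ s, c i • raise g (F i) := by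
  simp only [raise_eq, Matrix.mul_sum, Matrix.sum_mul, Matrix.mul_smul, Matrix.smul_mul]

lemma app_eq_sum (g : T2) (P : T4) (F : T2) : app g P F =
    ∑ p : Fin 4 × Fin 4, ((1 / 2) * raise g F p.1 p.2) • Matrix.of fun a b => P a b p.1 p.2 := by
  ext a b
  rw [Matrix.sum_apply, Fintype.sum_prod_type]
  simp only [app, Matrix.smul_apply, Matrix.of_apply, smul_eq_mul, Finset.mul_sum]
  exact Finset.sum_congr rfl fun m _ => Finset.sum_congr rfl fun n _ => by ring

lemma app_comp (g : T2) (P Q : T4) (F : T2) : app g (comp g P Q) F = app g P (app g Q F) := by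
  ext a b
  have h : ∀ m n, raise g (app g Q F) m n =
      ∑ r, ∑ s, ((1 / 2) * raise g F r s) * raise g (fun i j => Q i j r s) m n := by
    intro m n
    rw [app_eq_sum g Q F, raise_sum_smul, Matrix.sum_apply, Fintype.sum_prod_type]
    rfl
  simp only [app, comp] at h ⊢
  simp only [h, Fin.sum_univ_four]
  ring

lemma app_metricG_std {F : T2} (hF : F.transpose = -F) : app gStd (metricG gStd) F = F := by
  have h := entry_antisymm hF
  ext a b
  simp only [app, metricG, wedge, raise_gStd, gStd_apply, Pi.smul_apply, smul_eq_mul]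
  fin_cases a <;> fin_cases b <;> simp [Fin.sum_univ_four, entry_diag hF, h 0 1, h 0 2, h 0 3, h 1 2, h 1 3, h 2 3] <;> ring

lemma app_metricSD_sdStd (a b c : ℂ) :
    app gStd (metricSD gStd epsStd) (sdStd a b c) = sdStd a b c := by
  rw [app_metricSD_std, ip_sdStd, ip_sdStd, ip_sdStd, smul_sdStd]
  congr 1 <;> ring

lemma app_metricSD (g : T2) (η : T4) (F : T2) : app g (metricSD g η) F =
    (1 / 2 : ℂ) • (app g (metricG g) F - Complex.I • star g η F) := by
  rw [metricSD, app_smul, sub_eq_add_neg, ← neg_smul, app_add, app_smul, neg_smul,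
    ← sub_eq_add_neg, star]

/-- SD bivectors are the 2-forms fixed by the projector `𝒢`, whose image in the standard frame
consists of the `sdStd a b c`. -/
lemma isSD_std_iff (F : T2) : IsSD gStd epsStd F ↔ ∃ a b c, F = sdStd a b c := by
  have hI := Complex.I_mul_I
  constructor
  · rintro ⟨h1, h2⟩
    have h : app gStd (metricSD gStd epsStd) F = F := by
      rw [app_metricSD, h2, app_metricG_std h1, smul_smul, hI]
      module
    rw [app_metricSD_std, smul_sdStd] at h
    exact ⟨_, _, _, h.symm⟩
  · rintro ⟨a, b, c, rfl⟩
    refine ⟨sdStd_transpose a b c, ?_⟩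
    have h := app_metricSD_sdStd a b c
    rw [app_metricSD, app_metricG_std (sdStd_transpose a b c)] at h
    ext i j
    have e := congrFun (congrFun h i) j
    simp only [Matrix.smul_apply, Matrix.sub_apply, smul_eq_mul] at e ⊢
    linear_combination 2 * Complex.I * e + star gStd epsStd (sdStd a b c) i j * hI

lemma conj4_add (P Q : T4) : conj4 (P + Q) = conj4 P + conj4 Q := by
  funext a b c d
  simp [conj4]

lemma conj4_smul (k : ℂ) (P : T4) : conj4 (k • P) = (starRingEnd ℂ) k • conj4 P := by
  funext a b c d
  simp [conj4]

lemma conj4_tensor (F H : T2) :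
    conj4 (tensor F H) = tensor (F.map (starRingEnd ℂ)) (H.map (starRingEnd ℂ)) := by
  funext a b c d
  simp [conj4, tensor]

/-- Self-dual and anti-self-dual bivectors are orthogonal; hence the conjugate part of the Weyl
tensor acts as zero on SD bivectors. -/
lemma ip_conj_sdStd (a b c a' b' c' : ℂ) :
    ip gStd ((sdStd a b c).map (starRingEnd ℂ)) (sdStd a' b' c') = 0 := by
  rw [ip_gStd _ _ (by
    rw [← Matrix.transpose_map, sdStd_transpose]
    ext i j
    simp) (sdStd_transpose _ _ _)]
  simp [sdStd]
  linear_combination (-((starRingEnd ℂ) a * a') - (starRingEnd ℂ) b * b' - (starRingEnd ℂ) c * c') * Complex.I_mul_I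

/-- The action of the self-dual Weyl tensor in an adapted frame. -/
lemma app_weylSD_std (b c Ω x y z : ℂ) :
    app gStd (comp gStd (comp gStd (metricSD gStd epsStd)
      (weylForm gStd epsStd (rt • sdStd 1 0 0) (sdStd 0 b c) Ω
        + conj4 (weylForm gStd epsStd (rt • sdStd 1 0 0) (sdStd 0 b c) Ω)))
      (metricSD gStd epsStd)) (sdStd x y z) =
    sdStd (-2 * Ω * x - 2 * rt * (b * y + c * z)) (Ω * y - 2 * rt * b * x)
      (Ω * z - 2 * rt * c * x) := by
  rw [app_comp, app_comp, app_metricSD_sdStd, app_add]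
  have h1 : app gStd (conj4 (weylForm gStd epsStd (rt • sdStd 1 0 0) (sdStd 0 b c) Ω))
      (sdStd x y z) = 0 := by
    simp only [weylForm, metricSD_std, smul_sdStd, conj4_add, conj4_smul, conj4_tensor, app_add,
      app_smul, app_tensor, ip_conj_sdStd, zero_smul, smul_zero, add_zero]
  have h2 : app gStd (weylForm gStd epsStd (rt • sdStd 1 0 0) (sdStd 0 b c) Ω)
      (sdStd x y z) = sdStd (-2 * Ω * x - 2 * rt * (b * y + c * z)) (Ω * y - 2 * rt * b * x)
      (Ω * z - 2 * rt * c * x) := by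
    simp only [weylForm, smul_sdStd, app_add, app_smul, app_tensor, ip_sdStd, app_metricSD_sdStd,
      sdStd_add]
    congr 1
    · linear_combination -6 * Ω * x * rt_sq
    · ring
    · ring
  rw [h1, h2, add_zero, app_metricSD_sdStd]

lemma sdStd_inj {a b c a' b' c' : ℂ} : sdStd a b c = sdStd a' b' c' ↔ a = a' ∧ b = b' ∧ c = c' := by
  refine ⟨fun h => ⟨?_, ?_, ?_⟩, fun ⟨h1, h2, h3⟩ => by rw [h1, h2, h3]⟩
  · simpa [sdStd] using congrFun (congrFun h 1) 0
  · simpa [sdStd] using congrFun (congrFun h 2) 0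
  · simpa [sdStd] using congrFun (congrFun h 3) 0

lemma sdStd_zero : sdStd 0 0 0 = 0 := by
  ext i j
  fin_cases i <;> fin_cases j <;> simp [sdStd]

/-- The consequences of type I for the invariants, in an adapted frame. -/
lemma frame_typeI {b c Ω : ℂ} (h : ∃ ρ : Fin 3 → ℂ, Function.Injective ρ ∧
    ∀ i, ∃ F : T2, F ≠ 0 ∧ IsSD gStd epsStd F ∧
      app gStd (comp gStd (comp gStd (metricSD gStd epsStd)
      (weylForm gStd epsStd (rt • sdStd 1 0 0) (sdStd 0 b c) Ω
        + conj4 (weylForm gStd epsStd (rt • sdStd 1 0 0) (sdStd 0 b c) Ω)))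
      (metricSD gStd epsStd)) F = ρ i • F) :
    b ^ 2 + c ^ 2 ≠ 0 ∧ 9 * Ω ^ 2 + 8 * (b ^ 2 + c ^ 2) ≠ 0 := by
  obtain ⟨ρ, hρ, hF⟩ := h
  have hr : ∀ i, ρ i = Ω ∨ ρ i ^ 2 + Ω * ρ i - 2 * Ω ^ 2 - 2 * (b ^ 2 + c ^ 2) = 0 := by
    intro i
    obtain ⟨F, h0, hs, he⟩ := hF i
    obtain ⟨x, y, z, rfl⟩ := (isSD_std_iff F).1 hs
    rw [app_weylSD_std, smul_sdStd, sdStd_inj] at he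
    obtain ⟨e1, e2, e3⟩ := he
    by_cases hΩ : ρ i = Ω
    · exact Or.inl hΩ
    · refine Or.inr ?_
      -- An eigenbivector orthogonal to `u` can only have eigenvalue `Ω`. Otherwise eliminating `y`
      -- and `z` leaves the quadratic equation times `x`.
      have hx : x ≠ 0 := by
        rintro rfl
        have hΩ' : Ω - ρ i ≠ 0 := sub_ne_zero.2 (Ne.symm hΩ)
        have hy : y = 0 := (mul_eq_zero.1 (by linear_combination e2 : (Ω - ρ i) * y = 0)).resolve_left hΩ'
        have hz : z = 0 := (mul_eq_zero.1 (by linear_combination e3 : (Ω - ρ i) * z = 0)).resolve_left hΩ'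
        exact h0 (by rw [hy, hz, sdStd_zero])
      refine (mul_eq_zero.1 (?_ : x * _ = 0)).resolve_left hx
      linear_combination (ρ i - Ω) * (-1) * e1 + 2 * rt * (b * e2 + c * e3)
        + 4 * x * (b ^ 2 + c ^ 2) * rt_sq
  have h01 : ρ 0 ≠ ρ 1 := hρ.ne (by decide)
  have h02 : ρ 0 ≠ ρ 2 := hρ.ne (by decide)
  have h12 : ρ 1 ≠ ρ 2 := hρ.ne (by decide)
  -- Three different eigenvalues cannot lie among two numbers. If `b² + c² = 0` the quadratic has
  -- roots `Ω` and `-2Ω`; if its discriminant vanishes it has the double root `-Ω/2`.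
  have two : ∀ κ : ℂ, ¬ ∀ i, ρ i = Ω ∨ ρ i = κ := by
    intro κ hk
    rcases hk 0 with h0 | h0 <;> rcases hk 1 with h1 | h1 <;> rcases hk 2 with h2 | h2 <;>
      simp_all
  constructor
  · intro hq
    refine two (-2 * Ω) fun i => (hr i).elim Or.inl fun h => ?_
    rcases mul_eq_zero.1 (by linear_combination h + 2 * hq :
      (ρ i - Ω) * (ρ i - -2 * Ω) = 0) with h | h
    · exact Or.inl (sub_eq_zero.1 h)
    · exact Or.inr (sub_eq_zero.1 h)
  · intro hq
    refine two (-Ω / 2) fun i => (hr i).imp_right fun h => ?_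
    refine sub_eq_zero.1 (pow_eq_zero_iff two_ne_zero |>.1 ?_)
    linear_combination h + hq / 4

lemma dot_std (b c : ℂ) : dot gStd (rt • sdStd 1 0 0) (sdStd 0 b c)
    = sdStd 0 (-(Complex.I * rt * c)) (Complex.I * rt * b) := by
  have hI := Complex.I_mul_I
  rw [smul_sdStd]
  ext i j
  rw [dot_gStd]
  fin_cases i <;> fin_cases j <;> simp [sdStd] <;> grind

lemma exists_unit_multiples {E : Fin 3 → T2} {x y z : Fin 3 → ℂ}
    (hE : ∀ i, E i = sdStd (x i) (y i) (z i))
    (hn : ∀ i, x i * x i + y i * y i + z i * z i ≠ 0)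
    (ho : ∀ i j, i ≠ j → x i * x j + y i * y j + z i * z j = 0) :
    ∃ c : Fin 3 → ℂ, ∀ i j, ip gStd (c i • E i) (c j • E j) = if i = j then -1 else 0 := by
  have h : ∀ i, ∃ c : ℂ, c ^ 2 = 1 / (2 * (x i * x i + y i * y i + z i * z i)) := fun i =>
    IsAlgClosed.exists_pow_nat_eq _ two_pos
  choose c hc using h
  refine ⟨c, fun i j => ?_⟩
  rw [hE, hE, ip_smul_left, ip_smul_right, ip_sdStd]
  by_cases hij : i = j
  · subst hij
    rw [if_pos rfl]
    have := hc i
    rw [eq_div_iff (mul_ne_zero two_ne_zero (hn i))] at this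
    linear_combination -this
  · rw [ho i j hij, if_neg hij]
    ring

/-- The eigenvalues and eigenbivectors of the self-dual Weyl tensor in an adapted frame. -/
lemma frame_eigen {b c Ω : ℂ} (hq : b ^ 2 + c ^ 2 ≠ 0)
    (hα : 9 * Ω ^ 2 + 8 * (b ^ 2 + c ^ 2) ≠ 0) (α : ℂ) (ρ : Fin 3 → ℂ) (E : Fin 3 → T2)
    (h1 : α ^ 2 = 9 * Ω ^ 2 - 4 * ip gStd (sdStd 0 b c) (sdStd 0 b c))
    (h2 : ρ = ![Ω, (-Ω + α) / 2, (-Ω - α) / 2])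
    (h3 : E = ![dot gStd (rt • sdStd 1 0 0) (sdStd 0 b c),
      (3 * Ω - α) • (rt • sdStd 1 0 0) + (2 : ℂ) • sdStd 0 b c,
      (3 * Ω + α) • (rt • sdStd 1 0 0) + (2 : ℂ) • sdStd 0 b c]) :
    Function.Injective ρ ∧
      (∀ i, IsSD gStd epsStd (E i)) ∧
      (∀ i (F : T2), IsSD gStd epsStd F →
        (app gStd (comp gStd (comp gStd (metricSD gStd epsStd)
          (weylForm gStd epsStd (rt • sdStd 1 0 0) (sdStd 0 b c) Ω
            + conj4 (weylForm gStd epsStd (rt • sdStd 1 0 0) (sdStd 0 b c) Ω)))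
          (metricSD gStd epsStd)) F = ρ i • F ↔ ∃ c : ℂ, F = c • E i)) ∧
      ∃ c : Fin 3 → ℂ, ∀ i j, ip gStd (c i • E i) (c j • E j) = if i = j then -1 else 0 := by
  have hr := rt_sq
  have hrt : rt ≠ 0 := fun h => by simpa [h] using rt_sq
  have hα2 : α ^ 2 = 9 * Ω ^ 2 + 8 * (b ^ 2 + c ^ 2) := by
    rw [h1, ip_sdStd]; ring
  have hα0 : α ≠ 0 := by
    rintro rfl
    exact hα (by rw [← hα2]; ring)
  -- Both factors are nonzero because `q ≠ 0`. This separates `Ω` from the other eigenvalues, makes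
  -- the `u`-components of the last two eigenbivectors nonzero, and enters their norms `(E,E)`,
  -- which are `2α(3Ω - α)` and `-2α(3Ω + α)`.
  have hp : (3 * Ω - α) * (3 * Ω + α) = -8 * (b ^ 2 + c ^ 2) := by linear_combination -hα2
  have hp0 : (3 * Ω - α) * (3 * Ω + α) ≠ 0 := by
    rw [hp]
    exact mul_ne_zero (by norm_num) hq
  have hm := left_ne_zero_of_mul hp0
  have hM := right_ne_zero_of_mul hp0
  have hE : ∀ i, E i = sdStd (![0, (3 * Ω - α) * rt, (3 * Ω + α) * rt] i)
      (![-(Complex.I * rt * c), 2 * b, 2 * b] i) (![Complex.I * rt * b, 2 * c, 2 * c] i) := by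
    intro i
    rw [h3]
    fin_cases i
    · exact dot_std b c
    · simp [smul_sdStd, sdStd_add]
    · simp [smul_sdStd, sdStd_add]
  refine ⟨?_, fun i => (isSD_std_iff _).2 ⟨_, _, _, hE i⟩, ?_, ?_⟩
  · have e01 : Ω ≠ (-Ω + α) / 2 := fun h => hm (by linear_combination 2 * h)
    have e02 : Ω ≠ (-Ω - α) / 2 := fun h => hM (by linear_combination 2 * h)
    have e12 : (-Ω + α) / 2 ≠ (-Ω - α) / 2 := fun h => hα0 (by linear_combination h)
    intro i j hij
    rw [h2] at hij
    clear h3 hE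
    fin_cases i <;> fin_cases j <;> first
      | rfl
      | exact absurd hij e01
      | exact absurd hij e01.symm
      | exact absurd hij e02
      | exact absurd hij e02.symm
      | exact absurd hij e12
      | exact absurd hij e12.symm
  · intro i F hF
    obtain ⟨x, y, z, rfl⟩ := (isSD_std_iff F).1 hF
    rw [app_weylSD_std, smul_sdStd, sdStd_inj, hE, h2]
    simp only [smul_sdStd, sdStd_inj]
    fin_cases i
    · simp only [Fin.zero_eta, Matrix.cons_val_zero]
      constructor
      · rintro ⟨e1, e2, e3⟩
        have hx : x = 0 := by
          refine (mul_eq_zero.1 (?_ : (2 * rt * (b ^ 2 + c ^ 2)) * x = 0)).resolve_left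
            (mul_ne_zero (mul_ne_zero two_ne_zero hrt) hq)
          linear_combination -b * e2 - c * e3
        subst hx
        have hyz : b * y + c * z = 0 := by
          refine (mul_eq_zero.1 (?_ : (2 * rt) * _ = 0)).resolve_left (mul_ne_zero two_ne_zero hrt)
          linear_combination -e1
        -- From `b y + c z = 0` the pair `(y, z)` is a multiple of `(-c, b)`; the factor is found by
        -- pairing with that vector.
        refine ⟨(b * z - c * y) / (Complex.I * rt * (b ^ 2 + c ^ 2)), by simp, ?_, ?_⟩ <;>
          field_simp
        · linear_combination b * hyz
        · linear_combination c * hyz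
      · rintro ⟨k, rfl, rfl, rfl⟩
        refine ⟨by ring, by ring, by ring⟩
    · simp only [Fin.mk_one, Matrix.cons_val_one, Matrix.cons_val_zero]
      constructor
      · rintro ⟨e1, e2, e3⟩
        refine ⟨x / ((3 * Ω - α) * rt), by field_simp, ?_, ?_⟩ <;> field_simp
        · linear_combination 2 * rt * e2 + 4 * b * x * hr
        · linear_combination 2 * rt * e3 + 4 * c * x * hr
      · rintro ⟨k, rfl, rfl, rfl⟩
        refine ⟨?_, ?_, ?_⟩
        · linear_combination (k * rt / 2) * hα2
        · linear_combination (-2 * k * b * (3 * Ω - α)) * hr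
        · linear_combination (-2 * k * c * (3 * Ω - α)) * hr
    · simp only [Fin.reduceFinMk, Matrix.cons_val]
      constructor
      · rintro ⟨e1, e2, e3⟩
        refine ⟨x / ((3 * Ω + α) * rt), by field_simp, ?_, ?_⟩ <;> field_simp
        · linear_combination 2 * rt * e2 + 4 * b * x * hr
        · linear_combination 2 * rt * e3 + 4 * c * x * hr
      · rintro ⟨k, rfl, rfl, rfl⟩
        refine ⟨?_, ?_, ?_⟩
        · linear_combination (k * rt / 2) * hα2
        · linear_combination (-2 * k * b * (3 * Ω + α)) * hr
        · linear_combination (-2 * k * c * (3 * Ω + α)) * hr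
  · refine exists_unit_multiples hE (fun i => ?_) (fun i j hij => ?_)
    · fin_cases i
      · simp only [Fin.zero_eta, Matrix.cons_val_zero]
        rw [show (0 : ℂ) * 0 + -(Complex.I * rt * c) * -(Complex.I * rt * c)
          + Complex.I * rt * b * (Complex.I * rt * b) = (-1 / 2) * (b ^ 2 + c ^ 2) by
            linear_combination rt ^ 2 * (b ^ 2 + c ^ 2) * Complex.I_sq - (b ^ 2 + c ^ 2) * hr]
        exact mul_ne_zero (by norm_num) hq
      · simp only [Fin.mk_one, Matrix.cons_val_one, Matrix.cons_val_zero]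
        rw [show (3 * Ω - α) * rt * ((3 * Ω - α) * rt) + 2 * b * (2 * b) + 2 * c * (2 * c)
          = -α * (3 * Ω - α) by
            linear_combination (3 * Ω - α) ^ 2 * hr - (1 / 2) * hα2]
        exact mul_ne_zero (neg_ne_zero.2 hα0) hm
      · simp only [Fin.reduceFinMk, Matrix.cons_val]
        rw [show (3 * Ω + α) * rt * ((3 * Ω + α) * rt) + 2 * b * (2 * b) + 2 * c * (2 * c)
          = α * (3 * Ω + α) by
            linear_combination (3 * Ω + α) ^ 2 * hr - (1 / 2) * hα2]
        exact mul_ne_zero hα0 hM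
    · fin_cases i <;> fin_cases j <;> simp at hij ⊢
      all_goals first
        | ring1
        | linear_combination (3 * Ω + α) * (3 * Ω - α) * hr - (1 / 2) * hα2

/-! ### Change of frame -/

/-- The components of a 2-tensor in the frame given by the columns of `P`. -/
def pull (P F : T2) : T2 := P.transpose * F * P

/-- The components of a 4-tensor in the frame given by the columns of `P`. -/
def pull4 (P : T2) (K : T4) : T4 := fun a b m n =>
  ∑ i, ∑ j, P i a * P j b * pull P (Matrix.of (K i j)) m n

/-- The components of a covector in the frame given by the columns of `P`. -/
def pullv (P : T2) (x : Fin 4 → ℂ) : Fin 4 → ℂ := Matrix.vecMul x P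

/-- The columns of `P` form a frame in which the metric `g` has components `g'`. -/
structure IsFrame (P g g' : T2) : Prop where
  det : IsUnit P.det
  metric : pull P g = g'
  inv : g⁻¹ = P * g'⁻¹ * P.transpose

lemma IsFrame.of_metric {P g g' : T2} (hP : IsUnit P.det) (h : pull P g = g') :
    IsFrame P g g' := by
  refine ⟨hP, h, ?_⟩
  have hPt : IsUnit P.transpose.det := by rwa [Matrix.det_transpose]
  rw [← h, pull, Matrix.mul_inv_rev, Matrix.mul_inv_rev, ← mul_assoc, Matrix.mul_nonsing_inv _ hP,
    one_mul, mul_assoc, Matrix.nonsing_inv_mul _ hPt, mul_one]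

lemma sum_four_comm (f : Fin 4 → Fin 4 → Fin 4 → Fin 4 → ℂ) :
    ∑ a, ∑ b, ∑ c, ∑ d, f a b c d = ∑ c, ∑ d, ∑ a, ∑ b, f a b c d := by
  have := Finset.sum_comm (s := (Finset.univ : Finset (Fin 4 × Fin 4)))
    (t := (Finset.univ : Finset (Fin 4 × Fin 4))) (f := fun p q => f p.1 p.2 q.1 q.2)
  simpa only [Fintype.sum_prod_type] using this

section Linear

variable (P : T2)

lemma pull_add (F H : T2) : pull P (F + H) = pull P F + pull P H := by
  simp only [pull, Matrix.mul_add, Matrix.add_mul]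

lemma pull_sub (F H : T2) : pull P (F - H) = pull P F - pull P H := by
  simp only [pull, Matrix.mul_sub, Matrix.sub_mul]

lemma pull_neg (F : T2) : pull P (-F) = -pull P F := by
  simp only [pull, Matrix.mul_neg, Matrix.neg_mul]

lemma pull_smul (k : ℂ) (F : T2) : pull P (k • F) = k • pull P F := by
  simp only [pull, Matrix.mul_smul, Matrix.smul_mul]

lemma pull_zero : pull P 0 = 0 := by simp [pull]

lemma pull_sum {ι : Type*} (s : Finset ι) (F : ι → T2) :
    pull P (∑ i ∈ s, F i) = ∑ i ∈ s, pull P (F i) := by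
  simp only [pull, Matrix.mul_sum, Matrix.sum_mul]

lemma pull_transpose (F : T2) : pull P F.transpose = (pull P F).transpose := by
  simp only [pull, Matrix.transpose_mul, Matrix.transpose_transpose, mul_assoc]

lemma pull_apply (F : T2) (a b : Fin 4) : pull P F a b = ∑ i, ∑ j, P i a * P j b * F i j := by
  simp only [pull, Matrix.mul_apply, Matrix.transpose_apply, Finset.sum_mul]
  rw [Finset.sum_comm]
  exact Finset.sum_congr rfl fun i _ => Finset.sum_congr rfl fun j _ => by ring

lemma pull4_apply (K : T4) (a b m n : Fin 4) :
    pull4 P K a b m n = ∑ i, ∑ j, ∑ k, ∑ l, P i a * P j b * P k m * P l n * K i j k l := by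
  simp only [pull4, pull_apply, Finset.mul_sum, Matrix.of_apply]
  exact Finset.sum_congr rfl fun i _ => Finset.sum_congr rfl fun j _ =>
    Finset.sum_congr rfl fun i _ => Finset.sum_congr rfl fun j _ => by ring

lemma pull4_eq (K : T4) (a b : Fin 4) :
    pull4 P K a b = pull P (∑ i, ∑ j, (P i a * P j b) • (Matrix.of (K i j) : T2)) := by
  funext m n
  simp only [pull_sum, pull_smul, Matrix.sum_apply, Matrix.smul_apply, smul_eq_mul]
  rfl

lemma pull4_add (K L : T4) : pull4 P (K + L) = pull4 P K + pull4 P L := by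
  funext a b m n
  simp only [pull4_apply, Pi.add_apply, mul_add, Finset.sum_add_distrib]

lemma pull4_smul (k : ℂ) (K : T4) : pull4 P (k • K) = k • pull4 P K := by
  funext a b m n
  simp only [pull4_apply, Pi.smul_apply, smul_eq_mul, Finset.mul_sum, mul_left_comm k]

lemma pull4_sub (K L : T4) : pull4 P (K - L) = pull4 P K - pull4 P L := by
  rw [sub_eq_add_neg, ← neg_one_smul ℂ L, pull4_add, pull4_smul, neg_one_smul, ← sub_eq_add_neg]

lemma pull4_prod (A B : T2) : pull4 P (fun a b m n => A a m * B b n) =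
    fun a b m n => pull P A a m * pull P B b n := by
  funext a b m n
  simp only [pull4_apply, pull_apply, Finset.sum_mul_sum]
  refine Finset.sum_congr rfl fun i _ => ?_
  exact Finset.sum_congr rfl fun k _ => Finset.sum_congr rfl fun j _ =>
    Finset.sum_congr rfl fun l _ => by ring

lemma pull4_swap_right (K : T4) : pull4 P (fun a b m n => K a b n m) =
    fun a b m n => pull4 P K a b n m := by
  funext a b m n
  simp only [pull4_apply]
  refine Finset.sum_congr rfl fun i _ => Finset.sum_congr rfl fun j _ => ?_
  rw [Finset.sum_comm]
  exact Finset.sum_congr rfl fun i _ => Finset.sum_congr rfl fun j _ => by ring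

lemma pull4_wedge (A B : T2) : pull4 P (wedge A B) = wedge (pull P A) (pull P B) := by
  have h : wedge A B = (fun a b m n => A a m * B b n) + (fun a b m n => B a m * A b n)
      - (fun a b m n => A a n * B b m) - (fun a b m n => B a n * A b m) := by
    funext a b m n
    simp only [wedge, Pi.add_apply, Pi.sub_apply]
    ring
  rw [h, pull4_sub, pull4_sub, pull4_add, pull4_prod, pull4_prod,
    pull4_swap_right P fun a b m n => A a m * B b n, pull4_swap_right P fun a b m n => B a m * A b n,
    pull4_prod, pull4_prod]
  funext a b m n
  simp only [wedge, Pi.add_apply, Pi.sub_apply]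
  ring

lemma pull4_tensor (A B : T2) : pull4 P (tensor A B) = tensor (pull P A) (pull P B) := by
  funext a b m n
  rw [pull4, tensor, pull_apply P A, Finset.sum_mul]
  simp only [Finset.sum_mul]
  refine Finset.sum_congr rfl fun i _ => Finset.sum_congr rfl fun j _ => ?_
  rw [show Matrix.of (tensor A B i j) = A i j • B from rfl, pull_smul, Matrix.smul_apply,
    smul_eq_mul]
  ring

lemma pull4_metricSD (g : T2) (η : T4) :
    pull4 P (metricSD g η) = metricSD (pull P g) (pull4 P η) := by
  simp only [metricSD, metricG, pull4_smul, pull4_sub, pull4_wedge]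

lemma pull4_metricPerp (g : T2) (η : T4) (u : T2) :
    pull4 P (metricPerp g η u) = metricPerp (pull P g) (pull4 P η) (pull P u) := by
  simp only [metricPerp, pull4_add, pull4_tensor, pull4_metricSD]

/-- The contraction of the last two indices of `K` with `G`. -/
def contract (G : T2) (K : T4) : T2 := Matrix.of fun a b => ∑ m, ∑ n, G m n * K a b m n

lemma sum_mul_eq_trace (G X : T2) : ∑ m, ∑ n, G m n * X m n = (G.transpose * X).trace := by
  simp only [Matrix.trace, Matrix.diag, Matrix.mul_apply, Matrix.transpose_apply]
  rw [Finset.sum_comm]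

/-- Cyclicity of the trace moves the frame from the covariant to the contravariant factor. All
contractions with the inverse metric are reduced to this. -/
lemma sum_mul_pull (G X : T2) :
    ∑ m, ∑ n, G m n * pull P X m n = ∑ m, ∑ n, (P * G * P.transpose) m n * X m n := by
  rw [sum_mul_eq_trace, sum_mul_eq_trace, pull, Matrix.transpose_mul, Matrix.transpose_mul,
    Matrix.transpose_transpose, ← mul_assoc, Matrix.trace_mul_comm]
  simp only [mul_assoc]

lemma contract_pull4 (G : T2) (K : T4) :
    contract G (pull4 P K) = pull P (contract (P * G * P.transpose) K) := by
  ext a b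
  rw [pull_apply]
  simp only [contract, Matrix.of_apply, pull4_eq]
  rw [sum_mul_pull]
  simp only [Matrix.sum_apply, Matrix.smul_apply, Matrix.of_apply, smul_eq_mul, Finset.mul_sum]
  rw [sum_four_comm]
  exact Finset.sum_congr rfl fun k _ => Finset.sum_congr rfl fun j _ =>
    Finset.sum_congr rfl fun l _ => Finset.sum_congr rfl fun i _ => by ring

lemma pull4_swap_mid (K : T4) : pull4 P (fun a b m n => K m a n b) =
    fun a b m n => pull4 P K m a n b := by
  funext a b m n
  simp only [pull4_apply]
  rw [sum_four_comm]
  refine Finset.sum_congr rfl fun k _ => ?_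
  rw [Finset.sum_comm]
  exact Finset.sum_congr rfl fun l _ => Finset.sum_congr rfl fun i _ =>
    Finset.sum_congr rfl fun j _ => by ring

lemma pull_vecMulVec (x y : Fin 4 → ℂ) :
    pull P (Matrix.vecMulVec x y) = Matrix.vecMulVec (pullv P x) (pullv P y) := by
  ext a b
  simp only [pull_apply, Matrix.vecMulVec_apply, pullv, Matrix.vecMul, dotProduct,
    Finset.sum_mul_sum]
  exact Finset.sum_congr rfl fun i _ => Finset.sum_congr rfl fun j _ => by ring

lemma wedgeVec_eq (x y : Fin 4 → ℂ) :
    wedgeVec x y = Matrix.vecMulVec x y - Matrix.vecMulVec y x := by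
  ext a b
  simp only [wedgeVec, Matrix.of_apply, Matrix.sub_apply, Matrix.vecMulVec_apply]

lemma pull_wedgeVec (x y : Fin 4 → ℂ) :
    pull P (wedgeVec x y) = wedgeVec (pullv P x) (pullv P y) := by
  rw [wedgeVec_eq, wedgeVec_eq, pull_sub, pull_vecMulVec, pull_vecMulVec]

end Linear

section Frame

variable {P g g' : T2} (h : IsFrame P g g')

include h

lemma IsFrame.pull_dot (A B : T2) : pull P (dot g A B) = dot g' (pull P A) (pull P B) := by
  simp only [pull, dot, h.inv, mul_assoc]

lemma IsFrame.raise (F : T2) : P * raise g' (pull P F) * P.transpose = raise g F := by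
  simp only [raise_eq, h.inv, pull, Matrix.transpose_mul, Matrix.transpose_transpose, mul_assoc]

lemma IsFrame.pull_app (K : T4) (F : T2) :
    pull P (app g K F) = app g' (pull4 P K) (pull P F) := by
  have e : ∀ (g : T2) (K : T4) (F : T2), app g K F = (1 / 2 : ℂ) • contract (Umbilical.raise g F) K := by
    intro g K F
    ext a b
    simp only [app, contract, Matrix.smul_apply, Matrix.of_apply, smul_eq_mul, mul_comm (K _ _ _ _)]
  rw [e, e, contract_pull4, h.raise, pull_smul]

lemma IsFrame.ip (F H : T2) : ip g' (pull P F) (pull P H) = ip g F H := by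
  have e : ∀ (g F H : T2), Umbilical.ip g F H = (1 / 2) * ∑ a, ∑ b, Umbilical.raise g H a b * F a b := by
    intro g F H
    simp only [Umbilical.ip, mul_comm]
  rw [e, e, sum_mul_pull, h.raise]

lemma IsFrame.pull_star (η : T4) (F : T2) :
    pull P (star g η F) = star g' (pull4 P η) (pull P F) := h.pull_app η F

lemma IsFrame.pull_ricT (r : T4) : pull P (ricT g r) = ricT g' (pull4 P r) := by
  have e : ∀ (g : T2) (r : T4), ricT g r = contract g⁻¹ fun a b m n => r m a n b := by
    intro g r
    rfl
  rw [e, e, ← pull4_swap_mid, contract_pull4, h.inv]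

lemma IsFrame.scalT (r : T4) : scalT g' (pull4 P r) = scalT g r := by
  rw [Umbilical.scalT, Umbilical.scalT, ← h.pull_ricT, sum_mul_pull, ← h.inv]

lemma IsFrame.pull4_weylT (r : T4) : pull4 P (weylT g r) = weylT g' (pull4 P r) := by
  simp only [weylT, metricG, pull4_add, pull4_sub, pull4_smul, pull4_wedge, h.pull_ricT, h.scalT,
    h.metric]

lemma IsFrame.pull_perp (u X : T2) :
    pull P (perp g u X) = perp g' (pull P u) (pull P X) := by
  simp only [perp, pull_sub, pull_smul, h.pull_dot]

lemma IsFrame.pullv_chiT (u : T2) (x : Fin 4 → ℂ) :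
    pullv P (chiT g u x) = chiT g' (pull P u) (pullv P x) := by
  have e : ∀ (g u : T2) (x : Fin 4 → ℂ), chiT g u x = Matrix.vecMul x (g⁻¹ * u) := by
    intro g u x
    funext b
    simp only [chiT, Matrix.vecMul, dotProduct, Matrix.mul_apply, Finset.mul_sum]
    exact Finset.sum_congr rfl fun i _ => Finset.sum_congr rfl fun j _ => by ring
  rw [e, e, pullv, pullv, pull, Matrix.vecMul_vecMul, Matrix.vecMul_vecMul, h.inv]
  simp only [mul_assoc]

lemma IsFrame.pull_antiT (u : T2) (x : Fin 4 → ℂ) (N : T2) :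
    pull P (antiT g u x N) = antiT g' (pull P u) (pullv P x) (pull P N) := by
  have e : ∀ (g u : T2) (x : Fin 4 → ℂ) (N : T2), antiT g u x N = (1 / 2 : ℂ) •
      ((N - Matrix.vecMulVec (chiT g u x) x) - (N - Matrix.vecMulVec (chiT g u x) x).transpose) :=
    fun g u x N => rfl
  rw [e, e, pull_smul, pull_sub, pull_transpose, pull_sub, pull_vecMulVec, h.pullv_chiT]

lemma IsFrame.pull_zedT (η : T4) (u : T2) (x : Fin 4 → ℂ) (N : T2) :
    pull P (zedT g η u x N) = zedT g' (pull4 P η) (pull P u) (pullv P x) (pull P N) := by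
  rw [zedT, zedT, h.pull_app, pull4_metricPerp, h.metric, h.pull_antiT]

lemma IsFrame.omegaT (u : T2) (x : Fin 4 → ℂ) (N : T2) (r : T4) :
    omegaT g' (pull P u) (pullv P x) (pull P N) (pull4 P r) = omegaT g u x N r := by
  rw [Umbilical.omegaT, Umbilical.omegaT, h.scalT, ← h.pull_antiT, h.ip]

lemma IsFrame.pullv_divD (D : Fin 4 → T2) :
    pullv P (divD g D) = divD g' fun c => ∑ x, P x c • pull P (D x) := by
  have e : ∀ (g : T2) (D : Fin 4 → T2), divD g D = -∑ c, Matrix.vecMul (g⁻¹ c) (D c) := by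
    intro g D
    funext b
    simp only [divD, Pi.neg_apply, Finset.sum_apply, Matrix.vecMul, dotProduct]
  rw [e, e, pullv, Matrix.neg_vecMul, Matrix.sum_vecMul]
  congr 1
  have e3 : ∀ x, ∑ c, P x c • g'⁻¹ c = (P * g'⁻¹) x := by
    intro x
    funext b
    simp only [Finset.sum_apply, Pi.smul_apply, smul_eq_mul, Matrix.mul_apply]
  simp only [Matrix.vecMul_sum, Matrix.vecMul_smul]
  rw [Finset.sum_comm]
  refine Finset.sum_congr rfl fun x _ => ?_
  simp only [← Matrix.smul_vecMul]
  rw [← Matrix.sum_vecMul, e3, pull, ← Matrix.vecMul_vecMul, ← Matrix.vecMul_vecMul, h.inv]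
  rfl

lemma IsFrame.pull_injective {F H : T2} (hF : pull P F = pull P H) : F = H := by
  have hPt : IsUnit P.transpose.det := by rw [Matrix.det_transpose]; exact h.det
  have := congrArg (fun X => P.transpose⁻¹ * X * P⁻¹) hF
  simpa [pull, mul_assoc, Matrix.mul_nonsing_inv _ h.det, Matrix.nonsing_inv_mul_cancel_left _ _ hPt] using this

end Frame

lemma dot_add_left (g A B C : T2) : dot g (A + B) C = dot g A C + dot g B C := by
  simp only [dot, Matrix.add_mul]

lemma dot_add_right (g A B C : T2) : dot g A (B + C) = dot g A B + dot g A C := by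
  simp only [dot, Matrix.mul_add]

lemma dot_smul_left (g A B : T2) (k : ℂ) : dot g (k • A) B = k • dot g A B := by
  simp only [dot, Matrix.smul_mul]

lemma dot_smul_right (g A B : T2) (k : ℂ) : dot g A (k • B) = k • dot g A B := by
  simp only [dot, Matrix.mul_smul]

lemma dot_sum_left {ι : Type*} (g B : T2) (s : Finset ι) (A : ι → T2) :
    dot g (∑ i ∈ s, A i) B = ∑ i ∈ s, dot g (A i) B := by
  simp only [dot, Matrix.sum_mul]

lemma dot_sum_right {ι : Type*} (g A : T2) (s : Finset ι) (B : ι → T2) :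
    dot g A (∑ i ∈ s, B i) = ∑ i ∈ s, dot g A (B i) := by
  simp only [dot, Matrix.mul_sum]

lemma perp_add (g u A B : T2) : perp g u (A + B) = perp g u A + perp g u B := by
  simp only [perp, dot_add_left, dot_add_right, smul_add]
  abel

lemma perp_smul (g u A : T2) (k : ℂ) : perp g u (k • A) = k • perp g u A := by
  simp only [perp, dot_smul_left, dot_smul_right, smul_sub]
  rw [smul_comm]

lemma perp_neg (g u A : T2) : perp g u (-A) = -perp g u A := by
  rw [← neg_one_smul ℂ A, perp_smul, neg_one_smul]

lemma wedgeVec_add_left (p p' q : Fin 4 → ℂ) :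
    wedgeVec (p + p') q = wedgeVec p q + wedgeVec p' q := by
  ext a b
  simp only [wedgeVec, Matrix.of_apply, Matrix.add_apply, Pi.add_apply]
  ring

lemma wedgeVec_smul_left (k : ℂ) (p q : Fin 4 → ℂ) : wedgeVec (k • p) q = k • wedgeVec p q := by
  ext a b
  simp only [wedgeVec, Matrix.of_apply, Matrix.smul_apply, Pi.smul_apply, smul_eq_mul]
  ring

lemma wedgeVec_swap (p q : Fin 4 → ℂ) : wedgeVec q p = -wedgeVec p q := by
  ext a b
  simp only [wedgeVec, Matrix.of_apply, Matrix.neg_apply]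
  ring

lemma wedgeVec_add_right (p q q' : Fin 4 → ℂ) :
    wedgeVec p (q + q') = wedgeVec p q + wedgeVec p q' := by
  rw [wedgeVec_swap, wedgeVec_add_left, wedgeVec_swap q p, wedgeVec_swap q' p, neg_add]

lemma wedgeVec_smul_right (k : ℂ) (p q : Fin 4 → ℂ) : wedgeVec p (k • q) = k • wedgeVec p q := by
  rw [wedgeVec_swap, wedgeVec_smul_left, wedgeVec_swap q p, smul_neg]

/-- The bilinear map underlying `integ`. -/
def integVec (g u : T2) (x : Fin 4 → ℂ) (p q : (Fin 4 → ℂ) × (Fin 4 → ℂ)) : T2 :=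
  perp g u (wedgeVec p.1 q.2 - wedgeVec q.1 p.2)
    - dot g (dot g (perp g u (wedgeVec x p.2)) (wedgeVec x q.2)) u
    - dot g (dot g u (wedgeVec x q.2)) (perp g u (wedgeVec x p.2))
    + dot g (dot g (perp g u (wedgeVec x q.2)) (wedgeVec x p.2)) u
    + dot g (dot g u (wedgeVec x p.2)) (perp g u (wedgeVec x q.2))

lemma integ_eq (g u : T2) (x : Fin 4 → ℂ) (N : T2) (d c : Fin 4) :
    integ g u x N d c = integVec g u x (N d, g d) (N c, g c) := rfl

lemma integVec_swap (g u : T2) (x : Fin 4 → ℂ) (p q : (Fin 4 → ℂ) × (Fin 4 → ℂ)) :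
    integVec g u x q p = -integVec g u x p q := by
  rw [integVec, integVec, ← neg_sub (wedgeVec p.1 q.2), perp_neg]
  abel

lemma integVec_isLinear (g u : T2) (x : Fin 4 → ℂ) (q : (Fin 4 → ℂ) × (Fin 4 → ℂ)) :
    IsLinearMap ℂ fun p => integVec g u x p q := by
  constructor
  · intro p p'
    simp only [integVec, Prod.fst_add, Prod.snd_add, wedgeVec_add_left, wedgeVec_add_right,
      dot_add_left, dot_add_right, perp_add, sub_eq_add_neg, neg_add, perp_neg]
    abel
  · intro k p
    simp only [integVec, Prod.smul_fst, Prod.smul_snd, wedgeVec_smul_left, wedgeVec_smul_right,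
      dot_smul_left, dot_smul_right, ← smul_sub, ← smul_add, perp_smul]

lemma integVec_sum_left (g u : T2) (x : Fin 4 → ℂ) (a : Fin 4 → ℂ)
    (p : Fin 4 → (Fin 4 → ℂ) × (Fin 4 → ℂ)) (q : (Fin 4 → ℂ) × (Fin 4 → ℂ)) :
    integVec g u x (∑ d, a d • p d) q = ∑ d, a d • integVec g u x (p d) q := by
  have := map_sum (IsLinearMap.mk' _ (integVec_isLinear g u x q)) (fun d => a d • p d) Finset.univ
  simpa only [IsLinearMap.mk'_apply, map_smul] using this

lemma integVec_sum_right (g u : T2) (x : Fin 4 → ℂ) (a : Fin 4 → ℂ)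
    (p : Fin 4 → (Fin 4 → ℂ) × (Fin 4 → ℂ)) (q : (Fin 4 → ℂ) × (Fin 4 → ℂ)) :
    integVec g u x q (∑ d, a d • p d) = ∑ d, a d • integVec g u x q (p d) := by
  rw [integVec_swap, integVec_sum_left, ← Finset.sum_neg_distrib]
  exact Finset.sum_congr rfl fun d _ => by rw [integVec_swap g u x q, smul_neg, neg_neg]

/-- A row of a 2-tensor is a covector labelled by the first index: the label also transforms,
linearly through `P`. -/
lemma pull_row (P F : T2) (d : Fin 4) : pull P F d = ∑ x, P x d • pullv P (F x) := by
  have e : ∀ x, pullv P (F x) = (F * P) x := fun x => rfl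
  funext b
  rw [pull, mul_assoc, Matrix.mul_apply, Finset.sum_apply]
  simp only [e, Pi.smul_apply, smul_eq_mul, Matrix.transpose_apply]

section Frame

variable {P g g' : T2} (h : IsFrame P g g')

include h

lemma IsFrame.pull_integVec (u : T2) (x : Fin 4 → ℂ) (p q : (Fin 4 → ℂ) × (Fin 4 → ℂ)) :
    pull P (integVec g u x p q) = integVec g' (pull P u) (pullv P x)
      (pullv P p.1, pullv P p.2) (pullv P q.1, pullv P q.2) := by
  simp only [integVec, pull_add, pull_sub, h.pull_dot, h.pull_perp, pull_wedgeVec]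

lemma IsFrame.integ (u : T2) (x : Fin 4 → ℂ) (N : T2) (d c : Fin 4) :
    integ g' (pull P u) (pullv P x) (pull P N) d c
      = ∑ i, ∑ j, (P i d * P j c) • pull P (integ g u x N i j) := by
  -- The labels `d`, `c` enter `integ` only through the rows of `N` and `g`, which transform
  -- together. Bilinearity of `integVec` in these pairs then gives the tensorial behaviour.
  have e : ∀ d, ((pull P N d, g' d) : (Fin 4 → ℂ) × (Fin 4 → ℂ)) =
      ∑ i, P i d • (pullv P (N i), pullv P (g i)) := by
    intro d
    rw [← h.metric, pull_row, pull_row, Prod.ext_iff, Prod.fst_sum, Prod.snd_sum]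
    exact ⟨rfl, rfl⟩
  rw [integ_eq, e d, e c, integVec_sum_left]
  refine Finset.sum_congr rfl fun i _ => ?_
  rw [integVec_sum_right, Finset.smul_sum]
  refine Finset.sum_congr rfl fun j _ => ?_
  rw [integ_eq, h.pull_integVec, smul_smul]

/-- The commutator of the curvature with a 2-form in a frame. -/
lemma IsFrame.curv_commutator (u : T2) (r : T4) (d c : Fin 4) :
    dot g' (curvMat (pull4 P r) d c) (pull P u) - dot g' (pull P u) (curvMat (pull4 P r) d c)
      = ∑ i, ∑ j, (P i d * P j c) •
        pull P (dot g (curvMat r i j) u - dot g u (curvMat r i j)) := by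
  have e : curvMat (pull4 P r) d c = ∑ i, ∑ j, (P i d * P j c) • pull P (curvMat r i j) := by
    ext k l
    simp only [curvMat, Matrix.sum_apply, Matrix.smul_apply, smul_eq_mul, Matrix.of_apply,
      pull_apply, pull4_apply, Finset.mul_sum]
    rw [sum_four_comm]
    refine Finset.sum_congr rfl fun i _ => Finset.sum_congr rfl fun j _ =>
      Finset.sum_congr rfl fun i _ => Finset.sum_congr rfl fun j _ => by ring
  rw [e]
  simp only [dot_sum_left, dot_sum_right, dot_smul_left, dot_smul_right, ← h.pull_dot,
    ← Finset.sum_sub_distrib, ← smul_sub, ← pull_sub]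

end Frame

/-! ### Covariant derivatives and umbilicity in a frame -/

/-- The components, in the frame given by the columns of `P`, of the covariant derivative of a
2-tensor. -/
def pullD (P : T2) (D : Fin 4 → T2) (k : Fin 4) : T2 := ∑ x, P x k • pull P (D x)

lemma pullD_add (P : T2) (D D' : Fin 4 → T2) (k : Fin 4) :
    pullD P (fun x => D x + D' x) k = pullD P D k + pullD P D' k := by
  simp only [pullD, pull_add, smul_add, Finset.sum_add_distrib]

lemma pullD_smul (P : T2) (a : ℂ) (D : Fin 4 → T2) (k : Fin 4) :
    pullD P (fun x => a • D x) k = a • pullD P D k := by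
  simp only [pullD, pull_smul, Finset.smul_sum, smul_comm a]

lemma pullD_neg (P : T2) (D : Fin 4 → T2) (k : Fin 4) :
    pullD P (fun x => -D x) k = -pullD P D k := by
  simp only [pullD, pull_neg, smul_neg, Finset.sum_neg_distrib]

lemma pullD_sub (P : T2) (D D' : Fin 4 → T2) (k : Fin 4) :
    pullD P (fun x => D x - D' x) k = pullD P D k - pullD P D' k := by
  simp only [pullD, pull_sub, smul_sub, Finset.sum_sub_distrib]

lemma pullD_zero (P : T2) (k : Fin 4) : pullD P (fun _ => 0) k = 0 := by
  simp [pullD, pull_zero]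

lemma pullD_antisymm {P : T2} {D : Fin 4 → T2} (hD : ∀ c, (D c).transpose = -D c) (k : Fin 4) :
    (pullD P D k).transpose = -pullD P D k := by
  simp only [pullD, Matrix.transpose_sum, Matrix.transpose_smul, ← pull_transpose, hD, pull_neg,
    smul_neg, Finset.sum_neg_distrib]

lemma IsFrame.pullD_dot_left {P g g' : T2} (h : IsFrame P g g') (D : Fin 4 → T2) (B : T2)
    (k : Fin 4) : pullD P (fun x => dot g (D x) B) k = dot g' (pullD P D k) (pull P B) := by
  simp only [pullD, dot_sum_left, dot_smul_left, h.pull_dot]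

lemma IsFrame.pullD_dot_right {P g g' : T2} (h : IsFrame P g g') (D : Fin 4 → T2) (B : T2)
    (k : Fin 4) : pullD P (fun x => dot g B (D x)) k = dot g' (pull P B) (pullD P D k) := by
  simp only [pullD, dot_sum_right, dot_smul_right, h.pull_dot]

/-- The generalized second fundamental form of a plane. -/
def secondForm (g v h : T2) (D : Fin 4 → T2) (c : Fin 4) : T2 :=
  Matrix.of fun a b => ∑ d, ∑ e, (h * g⁻¹) c d * (v * g⁻¹) a e * D e d b

lemma umb_iff (g v h : T2) (D : Fin 4 → T2) : Umb g v h D ↔ ∀ c,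
    (1 / 2 : ℂ) • (secondForm g v h D c + (secondForm g v h D c).transpose)
      = (1 / 2 * ∑ m, ∑ n, g⁻¹ m n * secondForm g v h D c m n) • v := by
  refine forall_congr' fun c => ?_
  rw [← Matrix.ext_iff]
  refine forall_congr' fun a => forall_congr' fun b => ?_
  simp only [secondForm, Matrix.smul_apply, Matrix.add_apply, Matrix.transpose_apply,
    Matrix.of_apply, smul_eq_mul]
  rw [mul_right_comm (1 / 2 : ℂ)]

lemma secondForm_apply (g v h : T2) (D : Fin 4 → T2) (c a b : Fin 4) :
    secondForm g v h D c a b = (∑ e, (v * g⁻¹) a e • (h * g⁻¹ * D e)) c b := by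
  rw [secondForm, Matrix.of_apply, Finset.sum_comm, Matrix.sum_apply]
  generalize h * g⁻¹ = A
  generalize v * g⁻¹ = B
  refine Finset.sum_congr rfl fun e _ => ?_
  rw [Matrix.smul_apply, Matrix.mul_apply, smul_eq_mul, Finset.mul_sum]
  exact Finset.sum_congr rfl fun d _ => by ring

lemma IsFrame.secondForm {P g g' : T2} (hP : IsFrame P g g') (v h : T2) (D : Fin 4 → T2)
    (c : Fin 4) : secondForm g' (pull P v) (pull P h) (pullD P D) c
      = pullD P (secondForm g v h D) c := by
  have hmix : ∀ F : T2, pull P F * g'⁻¹ * P.transpose = P.transpose * (F * g⁻¹) := by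
    intro F
    simp only [pull, hP.inv, mul_assoc]
  have e1 : ∀ a, ∑ e, (pull P v * g'⁻¹) a e • (pull P h * g'⁻¹ * pullD P D e)
      = ∑ j, P j a • pull P (∑ e, (v * g⁻¹) j e • (h * g⁻¹ * D e)) := by
    intro a
    have e2 : ∀ x, ∑ e, (pull P v * g'⁻¹) a e * P x e = ∑ j, P j a * (v * g⁻¹) j x := by
      intro x
      have := congrFun (congrFun (hmix v) a) x
      rw [Matrix.mul_apply, Matrix.mul_apply] at this
      simpa only [Matrix.transpose_apply] using this
    have e3 : ∀ x, pull P h * g'⁻¹ * pull P (D x) = pull P (h * g⁻¹ * D x) := by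
      intro x
      rw [show pull P (D x) = P.transpose * (D x * P) from mul_assoc _ _ _, ← mul_assoc, hmix, pull]
      simp only [mul_assoc]
    simp only [pullD, Matrix.mul_sum, Matrix.mul_smul, e3, Finset.smul_sum, smul_smul, pull_sum,
      pull_smul]
    rw [Finset.sum_comm]
    conv_rhs => rw [Finset.sum_comm]
    refine Finset.sum_congr rfl fun x _ => ?_
    rw [← Finset.sum_smul, ← Finset.sum_smul, e2]
  ext a b
  rw [secondForm_apply, e1]
  simp only [pullD, Matrix.sum_apply, Matrix.smul_apply, pull_apply, smul_eq_mul,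
    secondForm_apply g, Finset.mul_sum]
  rw [Finset.sum_comm]
  exact Finset.sum_congr rfl fun i _ => Finset.sum_congr rfl fun j _ =>
    Finset.sum_congr rfl fun k _ => Finset.sum_congr rfl fun l _ => by ring

lemma IsFrame.umb {P g g' : T2} (hP : IsFrame P g g') {v h : T2} {D : Fin 4 → T2}
    (hu : Umb g v h D) : Umb g' (pull P v) (pull P h) (pullD P D) := by
  rw [umb_iff] at hu ⊢
  intro c
  have e1 : ∑ m, ∑ n, g'⁻¹ m n * pullD P (Umbilical.secondForm g v h D) c m n
      = ∑ x, P x c * ∑ m, ∑ n, g⁻¹ m n * Umbilical.secondForm g v h D x m n := by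
    simp only [hP.inv, ← sum_mul_pull, pullD, Matrix.sum_apply, Matrix.smul_apply, smul_eq_mul,
      Finset.mul_sum]
    conv_rhs => rw [Finset.sum_comm]
    refine Finset.sum_congr rfl fun m _ => ?_
    rw [Finset.sum_comm]
    exact Finset.sum_congr rfl fun i _ => Finset.sum_congr rfl fun n _ => by ring
  have e2 : (pullD P (Umbilical.secondForm g v h D) c).transpose
      = pullD P (fun x => (Umbilical.secondForm g v h D x).transpose) c := by
    simp only [pullD, Matrix.transpose_sum, Matrix.transpose_smul, pull_transpose]
  simp only [hP.secondForm]
  rw [e1, e2, ← pullD_add, ← pullD_smul]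
  simp only [hu, pullD, pull_smul, smul_smul]
  rw [← Finset.sum_smul, Finset.mul_sum]
  congr 1
  exact Finset.sum_congr rfl fun x _ => by ring

/-- The covariant derivative of the canonical SD bivector of an umbilical structure, expressed in
terms of its divergence. -/
lemma IsFrame.covM_canSD {P g U S : T2} (hP : IsFrame P g gStd) (hPU : pull P U = uStd)
    (hPS : pull P S = suStd) {DU DS : Fin 4 → T2}
    (hU : ∀ c, (DU c).transpose = -DU c) (hS : ∀ c, (DS c).transpose = -DS c)
    (h1 : ∀ c, dot g (dot g (DU c) U) U + dot g (dot g U (DU c)) U + dot g (dot g U U) (DU c)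
      = DU c)
    (h2 : ∀ c, dot g (DS c) U + dot g S (DU c) = 0)
    (h3 : ∀ c, dot g (DS c) S + dot g S (DS c) = dot g (DU c) U + dot g U (DU c))
    (hV : Umb g (dot g U U) (g - dot g U U) fun c => dot g (DU c) U + dot g U (DU c))
    (hH : Umb g (g - dot g U U) (dot g U U) fun c => -(dot g (DU c) U + dot g U (DU c)))
    (c : Fin 4) :
    rt • (DU c - Complex.I • DS c) = perp g (rt • (U - Complex.I • S))
      (wedgeVec (divD g fun c => rt • (DU c - Complex.I • DS c)) (g c)) := by
  have k1 : ∀ D : Fin 4 → T2, (fun k => dot gStd (pullD P D k) uStd + dot gStd uStd (pullD P D k))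
      = pullD P fun x => dot g (D x) U + dot g U (D x) := by
    intro D
    funext k
    rw [pullD_add, hP.pullD_dot_left, hP.pullD_dot_right, hPU]
  have kv : pull P (dot g U U) = dot gStd uStd uStd := by rw [hP.pull_dot, hPU]
  have kh : pull P (g - dot g U U) = gStd - dot gStd uStd uStd := by
    rw [pull_sub, kv, hP.metric]
  have key := frame_covM (pullD P DU) (pullD P DS) (pullD_antisymm hU) (pullD_antisymm hS)
    (fun k => by
      rw [← hPU, ← hP.pullD_dot_left, ← hP.pullD_dot_left, ← hP.pullD_dot_right,
        ← hP.pullD_dot_left, ← hP.pull_dot, ← hP.pullD_dot_right, ← pullD_add, ← pullD_add]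
      simp only [h1])
    (fun k => by
      rw [← hPU, ← hPS, ← hP.pullD_dot_left, ← hP.pullD_dot_right, ← pullD_add]
      simp only [h2, pullD_zero])
    (fun k => by
      rw [← hPU, ← hPS, ← hP.pullD_dot_left, ← hP.pullD_dot_right, ← hP.pullD_dot_left,
        ← hP.pullD_dot_right, ← pullD_add, ← pullD_add]
      simp only [h3])
    (by
      have := hP.umb hV
      rwa [kv, kh, ← k1] at this)
    (by
      have := hP.umb hH
      rw [kv, kh] at this
      convert this using 2 with k
      rw [pullD_neg, ← k1])
  set D : Fin 4 → T2 := fun c => rt • (DU c - Complex.I • DS c) with hD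
  have kD : (fun k => rt • (pullD P DU k - Complex.I • pullD P DS k)) = pullD P D := by
    funext k
    rw [hD, pullD_smul, pullD_sub, pullD_smul]
  have ku : pull P (rt • (U - Complex.I • S)) = rt • sdStd 1 0 0 := by
    rw [pull_smul, pull_sub, pull_smul, hPU, hPS, sdStd_one]
  have key' : ∀ k, pullD P D k =
      pullD P (fun x => perp g (rt • (U - Complex.I • S)) (wedgeVec (divD g D) (g x))) k := by
    intro k
    have hk := key k
    rw [kD, ← ku] at hk
    have e : divD gStd (pullD P D) = pullv P (divD g D) := (hP.pullv_divD D).symm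
    rw [congrFun kD k, e] at hk
    have e2 : gStd k = ∑ x, P x k • pullv P (g x) := by rw [← hP.metric, pull_row]
    rw [hk, e2]
    simp only [pullD, hP.pull_perp, pull_wedgeVec, Fin.sum_univ_four, wedgeVec_add_right,
      wedgeVec_smul_right, perp_add, perp_smul]
  -- The direction index is transformed back by `P⁻¹`, the tensor indices by injectivity of `pull`.
  have inj : ∀ D D' : Fin 4 → T2, (∀ k, pullD P D k = pullD P D' k) → ∀ c, D c = D' c := by
    have e : ∀ (D : Fin 4 → T2) (c : Fin 4), ∑ k, P⁻¹ k c • pullD P D k = pull P (D c) := by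
      intro D c
      have e1 : ∀ x, ∑ k, P⁻¹ k c * P x k = if x = c then 1 else 0 := by
        intro x
        rw [← Matrix.one_apply, ← Matrix.mul_nonsing_inv P hP.det, Matrix.mul_apply]
        exact Finset.sum_congr rfl fun k _ => mul_comm _ _
      simp only [pullD, Finset.smul_sum, smul_smul]
      rw [Finset.sum_comm]
      simp only [← Finset.sum_smul, e1]
      simp
    intro D D' hD c
    refine hP.pull_injective ?_
    rw [← e D, ← e D']
    simp only [hD]
  exact inj _ _ key' c

/-! ### Curvature tensors and null directions in a frame -/

lemma pull4_cycle (P : T2) (K : T4) : pull4 P (fun a b c d => K a c d b) =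
    fun a b c d => pull4 P K a c d b := by
  funext a b m n
  simp only [pull4_apply]
  refine Finset.sum_congr rfl fun i _ => ?_
  rw [Finset.sum_comm]
  refine Finset.sum_congr rfl fun j _ => ?_
  rw [Finset.sum_comm]
  exact Finset.sum_congr rfl fun k _ => Finset.sum_congr rfl fun l _ => by ring

lemma pull4_swap_left (P : T2) (K : T4) : pull4 P (fun a b c d => K b a c d) =
    fun a b c d => pull4 P K b a c d := by
  funext a b m n
  simp only [pull4_apply]
  rw [Finset.sum_comm]
  exact Finset.sum_congr rfl fun i _ => Finset.sum_congr rfl fun j _ =>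
    Finset.sum_congr rfl fun k _ => Finset.sum_congr rfl fun l _ => by ring

lemma pull4_zero (P : T2) : pull4 P 0 = 0 := by
  funext a b c d
  simp [pull4_apply]

lemma pull4_cycle_left (P : T2) (K : T4) : pull4 P (fun a b c d => K a d b c) =
    fun a b c d => pull4 P K a d b c := by
  have h := pull4_cycle P fun a b c d => K a c d b
  have h' := pull4_cycle P K
  refine h.trans ?_
  funext a b c d
  exact congrFun (congrFun (congrFun (congrFun h' a) c) d) b

lemma IsCurv.pull4 {r : T4} (h : IsCurv r) (P : T2) : IsCurv (pull4 P r) := by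
  refine ⟨fun a b c d => ?_, fun a b c d => ?_, fun a b c d => ?_⟩
  · have e : (fun a b c d => r b a c d) = (-1 : ℂ) • r := by
      funext a b c d
      simp [h.left a b]
    have := pull4_swap_left P r
    rw [e, pull4_smul] at this
    have := congrFun (congrFun (congrFun (congrFun this a) b) c) d
    simpa using this.symm
  · have e : (fun a b c d => r a b d c) = (-1 : ℂ) • r := by
      funext a b c d
      simp [h.right a b c d]
    have := pull4_swap_right P r
    rw [e, pull4_smul] at this
    have := congrFun (congrFun (congrFun (congrFun this a) b) c) d
    simpa using this.symm
  · have e : r + (fun a b c d => r a c d b) + (fun a b c d => r a d b c) = 0 := by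
      funext a b c d
      exact h.bianchi a b c d
    have := pull4_zero P
    rw [← e, pull4_add, pull4_add, pull4_cycle P r, pull4_cycle_left P r, e] at this
    exact congrFun (congrFun (congrFun (congrFun this a) b) c) d

lemma pull4_conj {P : T2} (hP : P.map (starRingEnd ℂ) = P) (K : T4) :
    conj4 (pull4 P K) = pull4 P (conj4 K) := by
  have e : ∀ i a, (starRingEnd ℂ) (P i a) = P i a := fun i a => congrFun (congrFun hP i) a
  funext a b m n
  simp only [conj4, pull4_apply, map_sum, map_mul, e]

section Frame

variable {P g g' : T2} (h : IsFrame P g g')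

include h

lemma IsFrame.isSD_iff (η : T4) (F : T2) :
    IsSD g η F ↔ IsSD g' (pull4 P η) (pull P F) := by
  rw [IsSD, IsSD, ← h.pull_star, ← pull_transpose, ← pull_neg, ← pull_smul]
  exact ⟨fun ⟨h1, h2⟩ => ⟨by rw [h1], by rw [h2]⟩,
    fun ⟨h1, h2⟩ => ⟨h.pull_injective h1, h.pull_injective h2⟩⟩

lemma IsFrame.pull_app_weylSD (η W : T4) (F : T2) :
    pull P (app g (comp g (comp g (metricSD g η) W) (metricSD g η)) F) =
      app g' (comp g' (comp g' (metricSD g' (pull4 P η)) (pull4 P W)) (metricSD g' (pull4 P η)))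
        (pull P F) := by
  simp only [app_comp, h.pull_app, pull4_metricSD, h.metric]

lemma IsFrame.pullv_injective {x y : Fin 4 → ℂ} (hxy : pullv P x = pullv P y) : x = y := by
  have := congrArg (fun z => Matrix.vecMul z P⁻¹) hxy
  simpa [pullv, Matrix.vecMul_vecMul, Matrix.mul_nonsing_inv _ h.det] using this

/-- Injectivity of `pull` is applied to the last pair of indices and then to the first. -/
lemma IsFrame.pull4_eq_zero {K : T4} (hK : pull4 P K = 0) : K = 0 := by
  have e1 : ∀ a b, ∑ i, ∑ j, (P i a * P j b) • (Matrix.of (K i j) : T2) = 0 := by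
    intro a b
    refine h.pull_injective ?_
    rw [← pull4_eq, hK, pull_zero]
    rfl
  have e2 : ∀ k l, (Matrix.of fun i j => K i j k l : T2) = 0 := by
    intro k l
    refine h.pull_injective ?_
    rw [pull_zero]
    ext a b
    have := congrFun (congrFun (e1 a b) k) l
    simp only [Matrix.sum_apply, Matrix.smul_apply, Matrix.of_apply, smul_eq_mul,
      pull_apply] at this ⊢
    exact this
  funext i j k l
  exact congrFun (congrFun (e2 k l) i) j

end Frame

section Real

variable {Pr : Matrix (Fin 4) (Fin 4) ℝ} {P g g' : T2} (hr : P = Pr.map Complex.ofReal)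
  (h : IsFrame P g g')

include hr

lemma mulVec_ofReal (l : Fin 4 → ℝ) (a : Fin 4) :
    ((Pr.mulVec l a : ℝ) : ℂ) = ∑ b, P a b * (l b : ℂ) := by
  simp [hr, Matrix.mulVec, dotProduct]

lemma contr_pull (F : T2) (l : Fin 4 → ℝ) :
    contr (pull P F) l = pullv P (contr F (Pr.mulVec l)) := by
  funext a
  simp only [contr, mulVec_ofReal hr, pullv, Matrix.vecMul, dotProduct, pull_apply,
    Fin.sum_univ_four]
  ring

include h

lemma IsFrame.lowerVec (l : Fin 4 → ℝ) :
    lowerVec g' l = pullv P (lowerVec g (Pr.mulVec l)) := by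
  have := contr_pull hr g l
  rwa [h.metric] at this

lemma IsFrame.det_real : IsUnit Pr.det := by
  have := h.det
  rw [hr, isUnit_iff_ne_zero] at this
  rw [isUnit_iff_ne_zero]
  intro h0
  apply this
  have := (Complex.ofRealHom.map_det Pr).symm
  rw [h0, map_zero] at this
  exact this

lemma IsFrame.mulVec_injective {l l' : Fin 4 → ℝ} (hl : Pr.mulVec l = Pr.mulVec l') : l = l' := by
  have := congrArg (Pr⁻¹.mulVec) hl
  simpa [Matrix.mulVec_mulVec, Matrix.nonsing_inv_mul _ (h.det_real hr)] using this

lemma IsFrame.isNullVec_iff (l : Fin 4 → ℝ) :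
    IsNullVec g (Pr.mulVec l) ↔ IsNullVec g' l := by
  have e1 : Pr.mulVec l = 0 ↔ l = 0 := by
    refine ⟨fun h0 => h.mulVec_injective hr (by rw [h0, Matrix.mulVec_zero]), ?_⟩
    rintro rfl
    exact Matrix.mulVec_zero _
  rw [IsNullVec, IsNullVec, Ne, Ne, e1, h.lowerVec hr]
  simp only [mulVec_ofReal hr, pullv, Matrix.vecMul, dotProduct, Finset.mul_sum, Finset.sum_mul]
  rw [Finset.sum_comm]
  simp only [mul_assoc]

lemma IsFrame.isPrincipalVec_iff (F : T2) (l : Fin 4 → ℝ) :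
    IsPrincipalVec g F (Pr.mulVec l) ↔ IsPrincipalVec g' (pull P F) l := by
  rw [IsPrincipalVec, IsPrincipalVec, h.isNullVec_iff hr]
  refine and_congr_right fun _ => exists_congr fun k => ?_
  have e1 : (∀ a, ∑ b, F a b * (Pr.mulVec l b : ℂ) = k * Umbilical.lowerVec g (Pr.mulVec l) a) ↔
      contr F (Pr.mulVec l) = k • Umbilical.lowerVec g (Pr.mulVec l) := funext_iff.symm
  have e2 : (∀ a, ∑ b, pull P F a b * (l b : ℂ) = k * Umbilical.lowerVec g' l a) ↔
      contr (pull P F) l = k • Umbilical.lowerVec g' l := funext_iff.symm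
  rw [e1, e2, contr_pull hr, h.lowerVec hr, pullv, pullv, ← Matrix.smul_vecMul]
  exact ⟨fun he => by rw [he], fun he => h.pullv_injective he⟩

lemma IsFrame.isDebeverVec_iff (W : T4) (l : Fin 4 → ℝ) :
    IsDebeverVec g W (Pr.mulVec l) ↔ IsDebeverVec g' (pull4 P W) l := by
  -- Up to sign the Debever expression is the `wedge` of `l ⊗ l` with the contracted Weyl tensor, so
  -- its naturality follows from that of `wedge` and `contract`.
  have e0 : ∀ (g : T2) (W : T4) (l : Fin 4 → ℝ), IsDebeverVec g W l ↔ IsNullVec g l ∧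
      wedge (Matrix.vecMulVec (Umbilical.lowerVec g l) (Umbilical.lowerVec g l))
        (contract (Matrix.of fun c d => (l c : ℂ) * l d) fun b e c d => W b c d e) = 0 := by
    intro g W l
    refine and_congr_right fun _ => ?_
    simp only [funext_iff]
    refine forall_congr' fun a => forall_congr' fun b => forall_congr' fun e => forall_congr' fun f => ?_
    have e1 : ∀ b e, ∑ c, ∑ d, W b c d e * (l c : ℂ) * (l d : ℂ)
        = contract (Matrix.of fun c d => (l c : ℂ) * l d) (fun b e c d => W b c d e) b e := by
      intro b e
      simp only [contract, Matrix.of_apply]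
      exact Finset.sum_congr rfl fun c _ => Finset.sum_congr rfl fun d _ => by ring
    simp only [e1, wedge, Matrix.vecMulVec_apply, Pi.zero_apply]
    constructor <;> intro h <;> linear_combination -h
  rw [e0, e0, h.isNullVec_iff hr]
  refine and_congr_right fun _ => ?_
  have e1 : P * (Matrix.of fun c d => (l c : ℂ) * l d) * P.transpose =
      Matrix.of fun c d => ((Pr.mulVec l c : ℝ) : ℂ) * (Pr.mulVec l d : ℝ) := by
    ext c d
    simp only [Matrix.mul_apply, Matrix.of_apply, mulVec_ofReal hr, Matrix.transpose_apply,
      Fin.sum_univ_four]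
    ring
  have e2 : (fun b e c d => pull4 P W b c d e) = pull4 P (fun b e c d => W b c d e) :=
    (pull4_cycle P W).symm
  rw [e2, contract_pull4, e1, h.lowerVec hr, ← pull_vecMulVec, ← pull4_wedge]
  exact ⟨fun he => by rw [he, pull4_zero], fun he => h.pull4_eq_zero he⟩

end Real

/-! ### The theorem at a point -/

/-- The algebraic part of the theorem, at a point. -/
theorem debever_and_eigen_of_curvature {Pr : Matrix (Fin 4) (Fin 4) ℝ} {P g u N : T2} {η r : T4}
    {x : Fin 4 → ℂ} (hr : P = Pr.map Complex.ofReal) (hP : IsFrame P g gStd)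
    (hη : pull4 P η = epsStd) (hu : pull P u = rt • sdStd 1 0 0) (hc : IsCurv r)
    (hreal : ∀ a b c d, (starRingEnd ℂ) (weylT g r a b c d) = weylT g r a b c d)
    (h : ∀ d c, dot g (curvMat r d c) u - dot g u (curvMat r d c) = integ g u x N d c)
    (hI : ∃ ρ : Fin 3 → ℂ, Function.Injective ρ ∧ ∀ i, ∃ F : T2, F ≠ 0 ∧ IsSD g η F ∧
      app g (comp g (comp g (metricSD g η) (weylT g r)) (metricSD g η)) F = ρ i • F)
    {Z : T2} (hZ : Z = zedT g η u x N) {Ω : ℂ} (hΩ : Ω = omegaT g u x N r)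
    {V : T2} (hV : V = (3 * Ω) • u + (2 : ℂ) • Z) :
    (IsSD g η u ∧ IsSD g η V ∧
      ∃ k : Fin 4 → (Fin 4 → ℝ),
        (∀ i j, i ≠ j → LinearIndependent ℝ ![k i, k j]) ∧
        (∀ l, IsDebeverVec g (weylT g r) l ↔ ∃ i, ∃ c : ℝ, c ≠ 0 ∧ l = c • k i) ∧
        (∀ l, IsPrincipalVec g u l ↔ ∃ c : ℝ, c ≠ 0 ∧ (l = c • k 0 ∨ l = c • k 1)) ∧
        (∀ l, IsPrincipalVec g V l ↔ ∃ c : ℝ, c ≠ 0 ∧ (l = c • k 2 ∨ l = c • k 3))) ∧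
    (∀ (α : ℂ) (ρ : Fin 3 → ℂ) (E : Fin 3 → T2),
      α ^ 2 = 9 * Ω ^ 2 - 4 * ip g Z Z →
      ρ = ![Ω, (-Ω + α) / 2, (-Ω - α) / 2] →
      E = ![dot g u Z, (3 * Ω - α) • u + (2 : ℂ) • Z, (3 * Ω + α) • u + (2 : ℂ) • Z] →
      Function.Injective ρ ∧
      (∀ i, IsSD g η (E i)) ∧
      (∀ i (F : T2), IsSD g η F →
        (app g (comp g (comp g (metricSD g η) (weylT g r)) (metricSD g η)) F = ρ i • F ↔
          ∃ c : ℂ, F = c • E i)) ∧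
      ∃ c : Fin 3 → ℂ, ∀ i j, ip g (c i • E i) (c j • E j) = if i = j then -1 else 0) := by
  have hPc : P.map (starRingEnd ℂ) = P := by
    rw [hr]
    ext i j
    simp
  obtain ⟨b, c, hbc⟩ : ∃ b c, pull P Z = sdStd 0 b c := by
    rw [hZ, hP.pull_zedT, hη, hu, zedT, app_metricPerp_std _ (antiT_transpose _ _ _ _)]
    exact ⟨_, _, rfl⟩
  have hΩ' : omegaT gStd (rt • sdStd 1 0 0) (pullv P x) (pull P N) (pull4 P r) = Ω := by
    rw [← hu, hP.omegaT, hΩ]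
  have hZ' : zedT gStd epsStd (rt • sdStd 1 0 0) (pullv P x) (pull P N) = sdStd 0 b c := by
    rw [← hbc, hZ, hP.pull_zedT, hη, hu]
  have hW : pull4 P (weylT g r) = weylForm gStd epsStd (rt • sdStd 1 0 0) (sdStd 0 b c) Ω
      + conj4 (weylForm gStd epsStd (rt • sdStd 1 0 0) (sdStd 0 b c) Ω) := by
    rw [hP.pull4_weylT, ← hΩ', ← hZ']
    refine frame_weyl (pullv P x) (pull P N) (fun d c => ?_) (hc.pull4 P) ?_
    · rw [← hu, hP.curv_commutator, hP.integ]
      simp only [h]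
    · have e : conj4 (weylT g r) = weylT g r := by
        funext a b c d
        exact hreal a b c d
      have := pull4_conj hPc (weylT g r)
      rw [e, hP.pull4_weylT] at this
      intro a b c d
      exact congrFun (congrFun (congrFun (congrFun this a) b) c) d
  have hSD : ∀ F, IsSD g η F ↔ IsSD gStd epsStd (pull P F) := fun F => by
    rw [hP.isSD_iff, hη]
  have hL : ∀ F, pull P (app g (comp g (comp g (metricSD g η) (weylT g r)) (metricSD g η)) F) =
      app gStd (comp gStd (comp gStd (metricSD gStd epsStd)
        (weylForm gStd epsStd (rt • sdStd 1 0 0) (sdStd 0 b c) Ω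
          + conj4 (weylForm gStd epsStd (rt • sdStd 1 0 0) (sdStd 0 b c) Ω)))
        (metricSD gStd epsStd)) (pull P F) := fun F => by
    rw [hP.pull_app_weylSD, hη, hW]
  obtain ⟨hq, hα⟩ : b ^ 2 + c ^ 2 ≠ 0 ∧ 9 * Ω ^ 2 + 8 * (b ^ 2 + c ^ 2) ≠ 0 := by
    obtain ⟨ρ, hρ, hF⟩ := hI
    refine frame_typeI ⟨ρ, hρ, fun i => ?_⟩
    obtain ⟨F, h0, h1, h2⟩ := hF i
    refine ⟨pull P F, fun h0' => h0 (hP.pull_injective (h0'.trans (pull_zero P).symm)),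
      (hSD F).1 h1, ?_⟩
    rw [← hL, h2, pull_smul]
  have hVp : pull P V = (3 * Ω) • (rt • sdStd 1 0 0) + (2 : ℂ) • sdStd 0 b c := by
    rw [hV, pull_add, pull_smul, pull_smul, hu, hbc]
  have surj : ∀ l : Fin 4 → ℝ, ∃ l', l = Pr.mulVec l' := fun l => ⟨Pr⁻¹.mulVec l, by
    rw [Matrix.mulVec_mulVec, Matrix.mul_nonsing_inv _ (hP.det_real hr), Matrix.one_mulVec]⟩
  have hmul : ∀ (l k : Fin 4 → ℝ) (a : ℝ), Pr.mulVec l = a • Pr.mulVec k ↔ l = a • k := by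
    intro l k a
    rw [← Matrix.mulVec_smul]
    exact ⟨fun he => hP.mulVec_injective hr he, fun he => by rw [he]⟩
  refine ⟨⟨?_, ?_, ?_⟩, ?_⟩
  · rw [hSD, hu, smul_sdStd, isSD_std_iff]
    exact ⟨_, _, _, rfl⟩
  · rw [hSD, hVp, smul_sdStd, smul_sdStd, smul_sdStd, sdStd_add, isSD_std_iff]
    exact ⟨_, _, _, rfl⟩
  · obtain ⟨k, k1, k2, k3, k4⟩ := frame_debever hq hα
    refine ⟨fun i => Pr.mulVec (k i), fun i j hij => ?_, fun l => ?_, fun l => ?_, fun l => ?_⟩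
    · have hk := k1 i j hij
      rw [LinearIndependent.pair_iff] at hk ⊢
      intro s t hst
      refine hk s t (hP.mulVec_injective hr ?_)
      rw [Matrix.mulVec_add, Matrix.mulVec_smul, Matrix.mulVec_smul, hst, Matrix.mulVec_zero]
    · obtain ⟨l, rfl⟩ := surj l
      rw [hP.isDebeverVec_iff hr, hW, k2]
      simp only [hmul]
    · obtain ⟨l, rfl⟩ := surj l
      rw [hP.isPrincipalVec_iff hr, hu, k3]
      simp only [hmul]
    · obtain ⟨l, rfl⟩ := surj l
      rw [hP.isPrincipalVec_iff hr, hVp, k4]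
      simp only [hmul]
  · intro α ρ E h1 h2 h3
    have inj : ∀ F H, pull P F = pull P H ↔ F = H := fun F H =>
      ⟨fun he => hP.pull_injective he, fun he => by rw [he]⟩
    obtain ⟨e1, e2, e3, e4⟩ := frame_eigen hq hα α ρ (fun i => pull P (E i))
      (by rw [h1, ← hbc, hP.ip]) h2 (by
        rw [h3]
        funext i
        fin_cases i
        · simp [hP.pull_dot, hu, hbc]
        · simp [pull_add, pull_smul, hu, hbc]
        · simp [pull_add, pull_smul, hu, hbc])
    refine ⟨e1, fun i => (hSD _).2 (e2 i), fun i F hF => ?_, ?_⟩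
    · rw [← inj, hL, pull_smul, e3 i _ ((hSD F).1 hF)]
      simp only [← pull_smul, inj]
    · obtain ⟨c, hcc⟩ := e4
      refine ⟨c, fun i j => ?_⟩
      rw [← hcc, ← pull_smul, ← pull_smul, hP.ip]

/-! ### Existence of adapted frames -/

/-- The integer Levi-Civita symbol, up to the factor `12`. -/
def epsInt (a b c d : Fin 4) : ℤ :=
  (((b : ℕ) : ℤ) - (a : ℕ)) * ((c : ℕ) - (a : ℕ)) * ((d : ℕ) - (a : ℕ)) * ((c : ℕ) - (b : ℕ))
    * ((d : ℕ) - (b : ℕ)) * ((d : ℕ) - (c : ℕ))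

/-- The product is a Vandermonde determinant in the values `0, 1, 2, 3`; in increasing order it
equals `1! 2! 3! = 12`. -/
lemma epsInt_perm : ∀ σ : Equiv.Perm (Fin 4),
    epsInt (σ 0) (σ 1) (σ 2) (σ 3) = 12 * (Equiv.Perm.sign σ : ℤ) := by
  decide

lemma alternating_eps {V : Type*} [AddCommGroup V] [Module ℝ V] (om : V [⋀^Fin 4]→ₗ[ℝ] ℝ)
    (f : Fin 4 → V) (a b c d : Fin 4) :
    ((om ![f a, f b, f c, f d] : ℝ) : ℂ) = epsStd a b c d * (om f : ℝ) := by
  have e : ![f a, f b, f c, f d] = f ∘ ![a, b, c, d] := by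
    funext i
    fin_cases i <;> rfl
  rw [e]
  by_cases hi : Function.Injective ![a, b, c, d]
  · let σ : Equiv.Perm (Fin 4) := Equiv.ofBijective _ (Finite.injective_iff_bijective.1 hi)
    have h1 : om (f ∘ ![a, b, c, d]) = ((Equiv.Perm.sign σ : ℤ) : ℝ) * om f := by
      have := om.map_perm f σ
      rw [show f ∘ ![a, b, c, d] = f ∘ σ from rfl, this]
      simp [Units.smul_def]
    have h2 : epsStd a b c d = ((Equiv.Perm.sign σ : ℤ) : ℂ) := by
      have h3 : epsInt a b c d = 12 * (Equiv.Perm.sign σ : ℤ) := epsInt_perm σ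
      have h4 : epsStd a b c d = ((epsInt a b c d : ℤ) : ℂ) / 12 := rfl
      rw [h4, h3]
      push_cast
      ring
    rw [h1, h2]
    push_cast
    rfl
  · rw [om.map_eq_zero_of_not_injective _ fun h => hi (Function.Injective.of_comp h)]
    have h2 : epsStd a b c d = 0 := by
      by_contra h0
      apply hi
      have h4 : epsStd a b c d = ((epsInt a b c d : ℤ) : ℂ) / 12 := rfl
      have h5 : epsInt a b c d ≠ 0 := fun h => h0 (by rw [h4, h]; simp)
      intro i j hij
      by_contra hne
      apply h5
      fin_cases i <;> fin_cases j <;> simp at hij hne <;> subst hij <;> simp [epsInt]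
    simp [h2]

/-- The Minkowski inner product. -/
def mink (p q : Fin 4 → ℝ) : ℝ := -(p 0 * q 0) + p 1 * q 1 + p 2 * q 2 + p 3 * q 3

/-- The orthogonal complement of a time-like vector is space-like, by the Cauchy–Schwarz inequality
for the spatial parts. -/
lemma mink_pos {p v : Fin 4 → ℝ} (hp : mink p p = -1) (hv : mink p v = 0) (h0 : v ≠ 0) :
    0 < mink v v := by
  unfold mink at *
  by_contra! hle
  have hcs : (p 1 * v 1 + p 2 * v 2 + p 3 * v 3) ^ 2
      ≤ (p 1 ^ 2 + p 2 ^ 2 + p 3 ^ 2) * (v 1 ^ 2 + v 2 ^ 2 + v 3 ^ 2) := by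
    nlinarith [sq_nonneg (p 1 * v 2 - p 2 * v 1), sq_nonneg (p 1 * v 3 - p 3 * v 1),
      sq_nonneg (p 2 * v 3 - p 3 * v 2)]
  have e1 : p 1 * v 1 + p 2 * v 2 + p 3 * v 3 = p 0 * v 0 := by linarith
  have e2 : p 0 ^ 2 = 1 + (p 1 ^ 2 + p 2 ^ 2 + p 3 ^ 2) := by linarith
  rw [e1, mul_pow, e2] at hcs
  have hC : v 1 ^ 2 + v 2 ^ 2 + v 3 ^ 2 ≤ v 0 ^ 2 := by linarith
  have hA : 0 ≤ p 1 ^ 2 + p 2 ^ 2 + p 3 ^ 2 := by positivity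
  have hv0 : v 0 ^ 2 = 0 := by nlinarith [sq_nonneg (v 0)]
  apply h0
  funext i
  have : v i ^ 2 = 0 := by
    have s1 := sq_nonneg (v 1)
    have s2 := sq_nonneg (v 2)
    have s3 := sq_nonneg (v 3)
    fin_cases i <;> simp <;> nlinarith
  simpa using this

lemma exists_mink_orthogonal (p q r : Fin 4 → ℝ) :
    ∃ v : Fin 4 → ℝ, v ≠ 0 ∧ mink p v = 0 ∧ mink q v = 0 ∧ mink r v = 0 := by
  -- Three linear equations in four unknowns, completed by a zero row to a singular square matrix.
  obtain ⟨v, h0, hv⟩ := Matrix.exists_mulVec_eq_zero_iff.2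
    (show (!![-p 0, p 1, p 2, p 3; -q 0, q 1, q 2, q 3; -r 0, r 1, r 2, r 3; 0, 0, 0, 0] :
      Matrix (Fin 4) (Fin 4) ℝ).det = 0 from Matrix.det_eq_zero_of_row_eq_zero 3 fun j => by
        fin_cases j <;> rfl)
  have h1 := congrFun hv 0
  have h2 := congrFun hv 1
  have h3 := congrFun hv 2
  simp [Matrix.mulVec, dotProduct, Fin.sum_univ_four] at h1 h2 h3
  exact ⟨v, h0, by unfold mink; linarith, by unfold mink; linarith, by unfold mink; linarith⟩

lemma mink_smul_right (p v : Fin 4 → ℝ) (k : ℝ) : mink p (k • v) = k * mink p v := by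
  simp only [mink, Pi.smul_apply, smul_eq_mul]
  ring

lemma mink_smul_left (p v : Fin 4 → ℝ) (k : ℝ) : mink (k • p) v = k * mink p v := by
  simp only [mink, Pi.smul_apply, smul_eq_mul]
  ring

lemma mink_comm (p v : Fin 4 → ℝ) : mink p v = mink v p := by
  simp only [mink]
  ring

lemma exists_unit_mink {p q r : Fin 4 → ℝ} (hp : mink p p = -1) :
    ∃ v : Fin 4 → ℝ, mink v v = 1 ∧ mink p v = 0 ∧ mink q v = 0 ∧ mink r v = 0 := by
  obtain ⟨v, h0, h1, h2, h3⟩ := exists_mink_orthogonal p q r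
  have hpos := mink_pos hp h1 h0
  have hs : Real.sqrt (mink v v) ≠ 0 := (Real.sqrt_pos.2 hpos).ne'
  refine ⟨(Real.sqrt (mink v v))⁻¹ • v, ?_, ?_, ?_, ?_⟩
  · rw [mink_smul_left, mink_smul_right]
    have := Real.mul_self_sqrt hpos.le
    field_simp
    linarith [this]
  all_goals simp [mink_smul_right, h1, h2, h3]

/-- Extension of two orthonormal vectors to an oriented orthonormal frame of Minkowski space. -/
lemma exists_lorentz {p q : Fin 4 → ℝ} (hp : mink p p = -1) (hq : mink q q = 1)
    (hpq : mink p q = 0) : ∃ L : Fin 4 → Fin 4 → ℝ, L 0 = p ∧ L 1 = q ∧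
      (∀ i j, mink (L i) (L j) = if i = j then (if i = 0 then -1 else 1) else 0) ∧
      (Matrix.of L).det = 1 := by
  obtain ⟨v, v1, v2, v3, -⟩ := exists_unit_mink (q := q) (r := q) hp
  obtain ⟨w, w1, w2, w3, w4⟩ := exists_unit_mink (q := q) (r := v) hp
  -- The sign `s` of the last vector is left free in order to correct the orientation;
  -- orthonormality already forces the determinant to be `1` or `-1`.
  have key : ∀ s : ℝ, s * s = 1 → ∀ i j, mink (![p, q, v, s • w] i) (![p, q, v, s • w] j)
      = if i = j then (if i = 0 then -1 else 1) else 0 := by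
    intro s hs i j
    fin_cases i <;> fin_cases j <;>
      simp [mink_smul_left, mink_smul_right, hp, hq, hpq, v1, v2, v3, w1, w2, w3, w4,
        mink_comm q p, mink_comm v p, mink_comm v q, mink_comm w p, mink_comm w q, mink_comm w v, hs]
  have hdet : ∀ L : Fin 4 → Fin 4 → ℝ,
      (∀ i j, mink (L i) (L j) = if i = j then (if i = 0 then -1 else 1) else 0) →
      (Matrix.of L).det * (Matrix.of L).det = 1 := by
    intro L hL
    let G : Matrix (Fin 4) (Fin 4) ℝ := Matrix.diagonal ![-1, 1, 1, 1]
    have hG : Matrix.of L * G * (Matrix.of L).transpose = G := by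
      ext i j
      rw [Matrix.mul_apply]
      simp only [G, Matrix.diagonal_apply, Matrix.mul_diagonal, Matrix.transpose_apply, Matrix.of_apply,
        Fin.sum_univ_four]
      have := hL i j
      simp only [mink] at this
      fin_cases i <;> fin_cases j <;> simp at this ⊢ <;> linarith
    have hd := congrArg Matrix.det hG
    have hGd : G.det = -1 := by simp [G, Matrix.det_diagonal, Fin.prod_univ_four]
    rw [Matrix.det_mul, Matrix.det_mul, Matrix.det_transpose, hGd] at hd
    linarith
  have h1 := hdet _ (key 1 (by norm_num))
  rcases mul_self_eq_one_iff.1 h1 with h | h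
  · exact ⟨_, rfl, rfl, key 1 (by norm_num), h⟩
  · refine ⟨_, rfl, rfl, key (-1) (by norm_num), ?_⟩
    have e : Matrix.of ![p, q, v, (-1 : ℝ) • w]
        = (Matrix.of ![p, q, v, (1 : ℝ) • w]).updateRow 3 ((-1 : ℝ) • w) := by
      ext i j
      fin_cases i <;> simp [Matrix.updateRow_apply]
    have e' : (Matrix.of ![p, q, v, (1 : ℝ) • w]).updateRow 3 w
        = Matrix.of ![p, q, v, (1 : ℝ) • w] := by
      ext i j
      fin_cases i <;> simp [Matrix.updateRow_apply]
    rw [e, Matrix.det_updateRow_smul, e', h]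
    norm_num

lemma exists_coordVec_sum {M : Type*} [TopologicalSpace M] [ChartedSpace Coord M]
    {e : OpenPartialHomeomorph M Coord}
    (he : e ∈ IsManifold.maximalAtlas (𝓡 4) ∞ M) {y : Coord} (hy : y ∈ e.target)
    (v : TangentSpace (𝓡 4) (e.symm y)) : ∃ z : Fin 4 → ℝ, v = ∑ a, z a • coordVec e y a := by
  have hd : e.MDifferentiable (𝓡 4) (𝓡 4) :=
    ⟨(contMDiffOn_of_mem_maximalAtlas he).mdifferentiableOn (by simp),
      (contMDiffOn_symm_of_mem_maximalAtlas he).mdifferentiableOn (by simp)⟩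
  obtain ⟨z, hz⟩ := hd.symm.mfderiv_surjective (x := y) hy v
  let z' : Coord := z
  let D : Coord →L[ℝ] Coord := mfderiv (𝓡 4) (𝓡 4) e.symm y
  have e1 : ∑ a, z' a • (EuclideanSpace.single a (1 : ℝ) : Coord) = z' := by
    have := (EuclideanSpace.basisFun (Fin 4) ℝ).sum_repr z'
    simpa using this
  have e2 : D z' = ∑ a, z' a • D (EuclideanSpace.single a (1 : ℝ)) := by
    conv_lhs => rw [← e1]
    rw [map_sum]
    simp only [map_smul]
  exact ⟨fun a => z' a, hz.symm.trans e2⟩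

section Multilinear

variable {V : Type*} [AddCommGroup V] [Module ℝ V]

lemma bilin_sum (β : LinearMap.BilinForm ℝ V) (z z' : Fin 4 → ℝ) (c : Fin 4 → V) :
    β (∑ a, z a • c a) (∑ a, z' a • c a) = ∑ a, ∑ b, z a * z' b * β (c a) (c b) := by
  simp only [map_sum, LinearMap.sum_apply, map_smul, LinearMap.smul_apply, smul_eq_mul,
    Finset.mul_sum]
  rw [Finset.sum_comm]
  exact Finset.sum_congr rfl fun a _ => Finset.sum_congr rfl fun b _ => by ring

lemma alternating_sum (om : V [⋀^Fin 4]→ₗ[ℝ] ℝ) (z : Fin 4 → Fin 4 → ℝ) (c : Fin 4 → V) :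
    om ![∑ a, z 0 a • c a, ∑ a, z 1 a • c a, ∑ a, z 2 a • c a, ∑ a, z 3 a • c a] =
      ∑ i, ∑ j, ∑ k, ∑ l, z 0 i * z 1 j * z 2 k * z 3 l * om ![c i, c j, c k, c l] := by
  have key : ∀ (m : Fin 4 → V) (s : Fin 4) (z : Fin 4 → ℝ),
      om (Function.update m s (∑ a, z a • c a)) = ∑ a, z a * om (Function.update m s (c a)) := by
    intro m s z
    have := om.toMultilinearMap.map_update_sum Finset.univ s (fun a => z a • c a) m
    simp only [MultilinearMap.map_update_smul, smul_eq_mul] at this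
    exact this
  have u0 : ∀ x a b d v : V, Function.update ![x, a, b, d] 0 v = ![v, a, b, d] := fun x a b d v => by
    funext i; fin_cases i <;> rfl
  have u1 : ∀ x a b d v : V, Function.update ![a, x, b, d] 1 v = ![a, v, b, d] := fun x a b d v => by
    funext i; fin_cases i <;> rfl
  have u2 : ∀ x a b d v : V, Function.update ![a, b, x, d] 2 v = ![a, b, v, d] := fun x a b d v => by
    funext i; fin_cases i <;> rfl
  have u3 : ∀ x a b d v : V, Function.update ![a, b, d, x] 3 v = ![a, b, d, v] := fun x a b d v => by
    funext i; fin_cases i <;> rfl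
  have k0 : ∀ (z : Fin 4 → ℝ) (a b d : V), om ![∑ i, z i • c i, a, b, d] = ∑ i, z i * om ![c i, a, b, d] := by
    intro z a b d
    simpa only [u0] using key ![0, a, b, d] 0 z
  have k1 : ∀ (z : Fin 4 → ℝ) (a b d : V), om ![a, ∑ i, z i • c i, b, d] = ∑ i, z i * om ![a, c i, b, d] := by
    intro z a b d
    simpa only [u1] using key ![a, 0, b, d] 1 z
  have k2 : ∀ (z : Fin 4 → ℝ) (a b d : V), om ![a, b, ∑ i, z i • c i, d] = ∑ i, z i * om ![a, b, c i, d] := by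
    intro z a b d
    simpa only [u2] using key ![a, b, 0, d] 2 z
  have k3 : ∀ (z : Fin 4 → ℝ) (a b d : V), om ![a, b, d, ∑ i, z i • c i] = ∑ i, z i * om ![a, b, d, c i] := by
    intro z a b d
    simpa only [u3] using key ![a, b, d, 0] 3 z
  rw [k0]
  simp only [k1, k2, k3, Finset.mul_sum, mul_assoc]

end Multilinear

/-- An oriented orthonormal frame adapted to the 2+2 structure, in terms of the coordinate frame. -/
lemma exists_frame {M : Type*} [TopologicalSpace M] [ChartedSpace Coord M]
    [IsManifold (𝓡 4) ∞ M] (S : SpaceTime M) (B : TwoTwo S) {e : OpenPartialHomeomorph M Coord}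
    (he : e ∈ IsManifold.maximalAtlas (𝓡 4) ∞ M) {y : Coord} (hy : y ∈ e.target) :
    ∃ (Pr : Matrix (Fin 4) (Fin 4) ℝ) (P : T2), P = Pr.map Complex.ofReal ∧
      IsFrame P (S.gC e y) gStd ∧ pull4 P (S.ηC e y) = epsStd ∧ pull P (B.UC e y) = uStd := by
  obtain ⟨b, hb, hηb⟩ := S.orthonormal (e.symm y)
  obtain ⟨e₀, e₁, h00, h11, h01, hU⟩ := B.volume_form (e.symm y)
  have hm : ∀ z z' : Fin 4 → ℝ, S.g (e.symm y) (∑ i, z i • b i) (∑ i, z' i • b i) = mink z z' := by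
    intro z z'
    rw [bilin_sum]
    simp [hb, Fin.sum_univ_four, mink]
  have r0 := b.sum_repr e₀
  have r1 := b.sum_repr e₁
  rw [← r0, hm] at h00
  rw [← r1, hm] at h11
  rw [← r0, ← r1, hm] at h01
  obtain ⟨L, hL0, hL1, hL, hdet⟩ := exists_lorentz h00 h11 h01
  set f : Fin 4 → TangentSpace (𝓡 4) (e.symm y) := fun i => ∑ j, L i j • b j with hf
  have f0 : f 0 = e₀ := by rw [hf]; simp only [hL0, r0]
  have f1 : f 1 = e₁ := by rw [hf]; simp only [hL1, r1]
  have hg : ∀ i j, S.g (e.symm y) (f i) (f j) = if i = j then (if i = 0 then -1 else 1) else 0 :=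
    fun i j => (hm _ _).trans (hL i j)
  -- The volume element takes the value `1` on the oriented basis `b`, so on `f` it equals the
  -- determinant of `L`.
  have hη : S.η (e.symm y) f = 1 := by
    rw [(S.η (e.symm y)).eq_smul_basis_det b, AlternatingMap.smul_apply, hηb, one_smul,
      Module.Basis.det_apply, ← hdet, ← Matrix.det_transpose]
    congr 1
    ext i j
    simp [Module.Basis.toMatrix_apply, hf, Finsupp.single_apply]
  choose z hz using fun i => exists_coordVec_sum he hy (f i)
  let Pr : Matrix (Fin 4) (Fin 4) ℝ := Matrix.of fun a i => z i a
  have hbil : ∀ (β : LinearMap.BilinForm ℝ (TangentSpace (𝓡 4) (e.symm y))) (i j : Fin 4),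
      pull (Pr.map Complex.ofReal) (Matrix.of fun a b => (β (coordVec e y a) (coordVec e y b) : ℂ)) i j
        = (β (f i) (f j) : ℝ) := by
    intro β i j
    rw [hz i, hz j, bilin_sum, pull_apply]
    simp [Pr]
  have hmetric : pull (Pr.map Complex.ofReal) (S.gC e y) = gStd := by
    ext i j
    refine (hbil _ i j).trans ?_
    rw [hg, gStd_apply]
    split_ifs <;> simp
  have hdetP : IsUnit (Pr.map Complex.ofReal : T2).det := by
    have h1 := congrArg Matrix.det hmetric
    have h2 := congrArg Matrix.det gStd_mul_self
    rw [Matrix.det_mul, Matrix.det_one] at h2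
    rw [pull, Matrix.det_mul] at h1
    rw [isUnit_iff_ne_zero]
    intro h0
    rw [h0, mul_zero] at h1
    rw [← h1, mul_zero] at h2
    exact zero_ne_one h2
  refine ⟨Pr, _, rfl, IsFrame.of_metric hdetP hmetric, ?_, ?_⟩
  · funext i j k l
    have h1 := alternating_eps (S.η (e.symm y)) f i j k l
    rw [hη, Complex.ofReal_one, mul_one] at h1
    rw [← h1, hz i, hz j, hz k, hz l]
    have h2 := alternating_sum (S.η (e.symm y)) ![z i, z j, z k, z l] (coordVec e y)
    simp only [Matrix.cons_val] at h2
    rw [h2, pull4_apply]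
    simp [Pr, SpaceTime.ηC]
  · ext i j
    refine (hbil _ i j).trans ?_
    rw [hU, ← f0, ← f1, hg, hg, hg, hg]
    fin_cases i <;> fin_cases j <;> simp [uStd]

/-- There is a real oriented orthonormal frame adapted to the 2+2 structure `U`. -/
def HasFrame (g : T2) (η : T4) (U : T2) : Prop :=
  ∃ (Pr : Matrix (Fin 4) (Fin 4) ℝ) (P : T2), P = Pr.map Complex.ofReal ∧
    IsFrame P g gStd ∧ pull4 P η = epsStd ∧ pull P U = uStd

lemma star_uStd : star gStd epsStd uStd = suStd := by
  ext i j
  simp only [star, app, raise_eq, gStd_inv]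
  fin_cases i <;> fin_cases j <;>
    simp [gStd, Fin.sum_univ_four, epsStd, uStd, suStd, Matrix.mul_apply, Matrix.transpose_apply] <;>
    norm_num

lemma IsFrame.pull_star_uStd {P g U : T2} {η : T4} (hP : IsFrame P g gStd)
    (hη : pull4 P η = epsStd) (hU : pull P U = uStd) : pull P (star g η U) = suStd := by
  rw [hP.pull_star, hη, hU, star_uStd]

lemma HasFrame.det {g U : T2} {η : T4} (h : HasFrame g η U) : g.det ≠ 0 := by
  obtain ⟨_, P, _, hP, _⟩ := h
  intro h0
  have h1 := congrArg Matrix.det hP.metric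
  have h2 := congrArg Matrix.det gStd_mul_self
  rw [Matrix.det_mul, Matrix.det_one] at h2
  rw [pull, Matrix.det_mul, Matrix.det_mul, h0, mul_zero, zero_mul] at h1
  rw [← h1, mul_zero] at h2
  exact zero_ne_one h2

/-- The algebraic relations satisfied by the volume forms of two orthogonal planes. -/
lemma HasFrame.relations {g U : T2} {η : T4} (h : HasFrame g η U) :
    U.transpose = -U ∧ (star g η U).transpose = -star g η U ∧
    dot g (dot g U U) U = U ∧ dot g (star g η U) U = 0 ∧
    dot g (star g η U) (star g η U) = dot g U U - g := by
  obtain ⟨_, P, _, hP, hη, hU⟩ := h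
  have hS := hP.pull_star_uStd hη hU
  refine ⟨hP.pull_injective ?_, hP.pull_injective ?_, hP.pull_injective ?_, hP.pull_injective ?_,
    hP.pull_injective ?_⟩
  · rw [pull_transpose, pull_neg, hU]
    ext i j
    fin_cases i <;> fin_cases j <;> simp [uStd]
  · rw [pull_transpose, pull_neg, hS]
    ext i j
    fin_cases i <;> fin_cases j <;> simp [suStd]
  · rw [hP.pull_dot, hP.pull_dot, hU, dot_uStd]
    ext i j
    rw [dot_gStd]
    fin_cases i <;> fin_cases j <;> simp [uStd]
  · rw [hP.pull_dot, hU, hS, pull_zero]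
    ext i j
    rw [dot_gStd]
    fin_cases i <;> fin_cases j <;> simp [uStd, suStd]
  · rw [hP.pull_dot, pull_sub, hP.pull_dot, hU, hS, hP.metric, dot_uStd]
    ext i j
    rw [dot_gStd]
    fin_cases i <;> fin_cases j <;> simp [gStd, suStd]

/-! ### The equation for the canonical SD bivector near a point -/

section Local

variable {g U : Coord → T2} {η : Coord → T4} {x : Coord}

/-- The covariant derivative of the canonical SD bivector of an umbilical 2+2 structure. -/
theorem covM_canSD_of_umbilical (hg : IsMetricNear g x)
    (hη : ∀ a b c d, ContDiffAt ℝ ∞ (fun y => η y a b c d) x) (hU : SmoothM U x)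
    (hF : ∀ᶠ y in nhds x, HasFrame (g y) (η y) (U y)) (hB : UmbilicalAt g U x) (c : Fin 4) :
    covM g (canSD g η U) x c = perp (g x) (canSD g η U x)
      (wedgeVec (xi g η U x) (g x c)) := by
  have hgs := hg.smooth.self_of_nhds
  have hS := star_smooth hg hη hU
  have hUU := dot_smooth hg hU hU
  obtain ⟨_, P, _, hP, hPη, hPU⟩ := hF.self_of_nhds
  set SU : Coord → T2 := fun y => star (g y) (η y) (U y) with hSU
  have hneg : ∀ (F : Coord → T2) (hF : SmoothM F x) (c : Fin 4),
      covM g (fun y => -F y) x c = -covM g F x c := by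
    intro F hF c
    have := covM_smul (g := g) (-1) hF c
    simpa only [neg_one_smul] using this
  have hanti : ∀ (F : Coord → T2), SmoothM F x → (∀ᶠ y in nhds x, (F y).transpose = -F y) →
      ∀ c, (covM g F x c).transpose = -covM g F x c := by
    intro F hF h c
    rw [← covM_transpose, covM_congr c h, hneg F hF]
  have hDv : ∀ c, covM g (projV g U) x c =
      dot (g x) (covM g U x c) (U x) + dot (g x) (U x) (covM g U x c) :=
    fun c => covM_dot hg hU hU c
  have hDh : ∀ c, covM g (projH g U) x c =
      -(dot (g x) (covM g U x c) (U x) + dot (g x) (U x) (covM g U x c)) := by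
    intro c
    have := covM_sub (g := g) hgs hUU c
    rw [covM_metric hg, zero_sub] at this
    rw [← hDv]
    exact this
  -- The relations `U³ = U`, `*U·U = 0`, `(*U)² = U² - g` hold at all nearby points and may be
  -- differentiated.
  have h1 : ∀ c, dot (g x) (dot (g x) (covM g U x c) (U x)) (U x)
      + dot (g x) (dot (g x) (U x) (covM g U x c)) (U x)
      + dot (g x) (dot (g x) (U x) (U x)) (covM g U x c) = covM g U x c := by
    intro c
    have e := covM_congr (g := g) c (hF.mono fun y hy => hy.relations.2.2.1)
    rw [covM_dot hg hUU hU, covM_dot hg hU hU, dot_add_left] at e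
    exact e
  have h2 : ∀ c, dot (g x) (covM g SU x c) (U x) + dot (g x) (SU x) (covM g U x c) = 0 := by
    intro c
    have e := covM_congr (g := g) (F := fun y => dot (g y) (SU y) (U y)) (H := fun _ => 0) c
      (hF.mono fun y hy => hy.relations.2.2.2.1)
    rw [covM_dot hg hS hU, covM_eq g fun _ => 0, pdM_const] at e
    simpa using e
  have h3 : ∀ c, dot (g x) (covM g SU x c) (SU x) + dot (g x) (SU x) (covM g SU x c) =
      dot (g x) (covM g U x c) (U x) + dot (g x) (U x) (covM g U x c) := by
    intro c
    have e := covM_congr (g := g) (F := fun y => dot (g y) (SU y) (SU y))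
      (H := fun y => dot (g y) (U y) (U y) - g y) c
      (hF.mono fun y hy => hy.relations.2.2.2.2)
    rw [covM_dot hg hS hS, covM_sub hUU hgs, covM_dot hg hU hU, covM_metric hg, sub_zero] at e
    exact e
  have hD : ∀ c, covM g (canSD g η U) x c =
      rt • (covM g U x c - Complex.I • covM g SU x c) := by
    intro c
    have e := covM_smul (g := g) rt (hU.sub (hS.smul Complex.I)) c
    rw [covM_sub hU (hS.smul Complex.I), covM_smul _ hS] at e
    exact e
  have hV : Umb (g x) (dot (g x) (U x) (U x)) (g x - dot (g x) (U x) (U x)) fun c =>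
      dot (g x) (covM g U x c) (U x) + dot (g x) (U x) (covM g U x c) := by
    simp only [← hDv]
    exact hB.1
  have hH : Umb (g x) (g x - dot (g x) (U x) (U x)) (dot (g x) (U x) (U x)) fun c =>
      -(dot (g x) (covM g U x c) (U x) + dot (g x) (U x) (covM g U x c)) := by
    simp only [← hDh]
    exact hB.2
  have key := hP.covM_canSD hPU (hP.pull_star_uStd hPη hPU)
    (hanti U hU (hF.mono fun y hy => hy.relations.1))
    (hanti SU hS (hF.mono fun y hy => hy.relations.2.1)) h1 h2 h3 hV hH c
  simp only [hSU] at hD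
  simp only [hSU, ← hD] at key
  exact key

lemma isCurv_riemann (hg : IsMetricNear g x) : IsCurv (riemann g x) where
  left a b c d := riemann_antisymm_left hg a b c d
  right a b c d := riemann_antisymm_right a b c d
  bianchi a b c d := riemann_bianchi hg a b c d

/-- The right side is the mixed-index form given by the Ricci identity. Antisymmetry of the lowered
curvature matrix turns it into a commutator for `dot`, which is natural under a change of frame. -/
lemma curv_action (hg : IsMetricNear g x) (u : T2) (d c : Fin 4) :
    dot (g x) (curvMat (riemann g x) d c) u - dot (g x) u (curvMat (riemann g x) d c) =
      -((curv g x d c).transpose * u) - u * curv g x d c := by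
  have e : curvMat (riemann g x) d c = g x * curv g x d c := by
    ext k l
    exact riemann_eq k l d c
  have e2 : (g x * curv g x d c).transpose = -(g x * curv g x d c) := by
    rw [← e]
    ext k l
    exact riemann_antisymm_left hg k l d c
  rw [Matrix.transpose_mul, hg.symm.self_of_nhds] at e2
  have e3 : (curv g x d c).transpose = -(g x * curv g x d c * (g x)⁻¹) := by
    rw [← neg_mul, ← e2, mul_assoc, hg.mul_inv, mul_one]
  rw [e, e3, dot, dot, mul_assoc u, ← mul_assoc (g x)⁻¹, hg.inv_mul, one_mul, neg_mul, neg_neg]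

end Local

/-! ### Regularity of the components in a chart -/

section Chart

variable {M : Type*} [TopologicalSpace M] [ChartedSpace Coord M] [IsManifold (𝓡 4) ∞ M]
  (S : SpaceTime M) (B : TwoTwo S) {e : OpenPartialHomeomorph M Coord}
  (he : e ∈ IsManifold.maximalAtlas (𝓡 4) ∞ M) {x : Coord} (hx : x ∈ e.target)

lemma contDiffAt_ofReal {f : Coord → ℝ} {s : Set Coord} (hs : IsOpen s)
    (hf : ContDiffOn ℝ ∞ f s) {x : Coord} (hx : x ∈ s) :
    ContDiffAt ℝ ∞ (fun y => (f y : ℂ)) x :=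
  Complex.ofRealCLM.contDiff.contDiffAt.comp x (hf.contDiffAt (hs.mem_nhds hx))

include he

lemma smooth_gC (hx : x ∈ e.target) : SmoothM (S.gC e) x := fun a b =>
  contDiffAt_ofReal e.open_target (S.g_smooth e he a b) hx

lemma smooth_UC (hx : x ∈ e.target) : SmoothM (B.UC e) x := fun a b =>
  contDiffAt_ofReal e.open_target (B.U_smooth e he a b) hx

lemma smooth_ηC (hx : x ∈ e.target) (a b c d : Fin 4) :
    ContDiffAt ℝ ∞ (fun y => S.ηC e y a b c d) x := by
  -- Every component is a constant times the single smooth function `η(∂₀, ∂₁, ∂₂, ∂₃)`.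
  simp only [SpaceTime.ηC, alternating_eps]
  exact contDiffAt_const.mul (contDiffAt_ofReal e.open_target (S.η_smooth e he) hx)

lemma isMetricNear_gC (B : TwoTwo S) (hx : x ∈ e.target) : IsMetricNear (S.gC e) x := by
  have ht : ∀ᶠ y in nhds x, y ∈ e.target := e.open_target.mem_nhds hx
  refine ⟨ht.mono fun y hy => smooth_gC S he hy, .of_forall fun y => ?_, ht.mono fun y hy =>
    HasFrame.det (exists_frame S B he hy), .of_forall fun y a b => Complex.conj_ofReal _⟩
  ext a b
  exact congrArg Complex.ofReal (S.g_symm _ _ _)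

end Chart

end Umbilical

end

theorem mainTheorem12 {M : Type*} [TopologicalSpace M] [ChartedSpace Umbilical.Coord M]
    [IsManifold (𝓡 4) ∞ M] (S : Umbilical.SpaceTime M)
    -- a 2+2 structure which is umbilical
    (B : Umbilical.TwoTwo S) (hB : B.IsUmbilical)
    -- a chart, and a point of its domain at which the Weyl tensor is of type I
    (e : OpenPartialHomeomorph M Umbilical.Coord) (he : e ∈ IsManifold.maximalAtlas (𝓡 4) ∞ M)
    (x : Umbilical.Coord) (hx : x ∈ e.target) (hI : Umbilical.IsTypeI (S.gC e) (S.ηC e) x)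
    -- abbreviations for the components at this point
    (g : Umbilical.T2) (hg : g = S.gC e x) (η : Umbilical.T4) (hη : η = S.ηC e x)
    (u : Umbilical.T2) (hu : u = Umbilical.canSD (S.gC e) (S.ηC e) (B.UC e) x)
    (Z : Umbilical.T2) (hZ : Z = Umbilical.Zed (S.gC e) (S.ηC e) (B.UC e) x)
    (Ω : ℂ) (hΩ : Ω = Umbilical.Omega (S.gC e) (S.ηC e) (B.UC e) x)
    (V : Umbilical.T2) (hV : V = (3 * Ω) • u + (2 : ℂ) • Z) :
    -- `u` and `V` are SD bivectors; there are exactly four Debever directions,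
    -- namely the two principal directions of `u` and the two principal directions of `V`
    (Umbilical.IsSD g η u ∧ Umbilical.IsSD g η V ∧
      ∃ k : Fin 4 → (Fin 4 → ℝ),
        (∀ i j, i ≠ j → LinearIndependent ℝ ![k i, k j]) ∧
        (∀ l, Umbilical.IsDebeverVec g (Umbilical.weyl (S.gC e) x) l ↔
          ∃ i, ∃ c : ℝ, c ≠ 0 ∧ l = c • k i) ∧
        (∀ l, Umbilical.IsPrincipalVec g u l ↔
          ∃ c : ℝ, c ≠ 0 ∧ (l = c • k 0 ∨ l = c • k 1)) ∧
        (∀ l, Umbilical.IsPrincipalVec g V l ↔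
          ∃ c : ℝ, c ≠ 0 ∧ (l = c • k 2 ∨ l = c • k 3))) ∧
    -- the eigenvalues `ρ`, the eigenbivectors and their normalization,
    -- for either choice of the square root `α`
    (∀ (α : ℂ) (ρ : Fin 3 → ℂ) (E : Fin 3 → Umbilical.T2),
      α ^ 2 = 9 * Ω ^ 2 - 4 * Umbilical.ip g Z Z →
      ρ = ![Ω, (-Ω + α) / 2, (-Ω - α) / 2] →
      E = ![Umbilical.dot g u Z, (3 * Ω - α) • u + (2 : ℂ) • Z,
        (3 * Ω + α) • u + (2 : ℂ) • Z] →
      Function.Injective ρ ∧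
      (∀ i, Umbilical.IsSD g η (E i)) ∧
      (∀ i (F : Umbilical.T2), Umbilical.IsSD g η F →
        (Umbilical.app g (Umbilical.weylSD (S.gC e) (S.ηC e) x) F = ρ i • F ↔
          ∃ c : ℂ, F = c • E i)) ∧
      ∃ c : Fin 3 → ℂ, ∀ i j,
        Umbilical.ip g (c i • E i) (c j • E j) = if i = j then -1 else 0) := by
  subst hg hη hu
  have ht : ∀ᶠ y in nhds x, y ∈ e.target := e.open_target.mem_nhds hx
  have hg : ∀ y ∈ e.target, Umbilical.IsMetricNear (S.gC e) y :=
    fun y hy => Umbilical.isMetricNear_gC S he B hy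
  have hF := ht.mono fun y hy => Umbilical.exists_frame S B he hy
  have hsu : ∀ y ∈ e.target, Umbilical.SmoothM
      (Umbilical.canSD (S.gC e) (S.ηC e) (B.UC e)) y := fun y hy =>
    Umbilical.canSD_smooth (hg y hy) (Umbilical.smooth_ηC S he hy) (Umbilical.smooth_UC S B he hy)
  -- Umbilicity is used at all points near `x`, because the equation for `∇u` is about to be
  -- differentiated.
  have hcov : ∀ᶠ y in nhds x, ∀ c, Umbilical.covM (S.gC e)
      (Umbilical.canSD (S.gC e) (S.ηC e) (B.UC e)) y c =
      Umbilical.perp (S.gC e y) (Umbilical.canSD (S.gC e) (S.ηC e) (B.UC e) y)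
        (Umbilical.wedgeVec (Umbilical.xi (S.gC e) (S.ηC e) (B.UC e) y) (S.gC e y c)) :=
    ht.mono fun y hy c => Umbilical.covM_canSD_of_umbilical (hg y hy)
      (Umbilical.smooth_ηC S he hy) (Umbilical.smooth_UC S B he hy)
      (Filter.Eventually.mono (e.open_target.mem_nhds hy) fun z hz =>
        Umbilical.exists_frame S B he hz) (hB e he y hy) c
  obtain ⟨Pr, P, hr, hP, hPη, hPU⟩ := Umbilical.exists_frame S B he hx
  have hPu : Umbilical.pull P (Umbilical.canSD (S.gC e) (S.ηC e) (B.UC e) x) =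
      Umbilical.rt • Umbilical.sdStd 1 0 0 := by
    rw [← Umbilical.sdStd_one, ← hPU, ← hP.pull_star_uStd hPη hPU, ← Umbilical.pull_smul,
      ← Umbilical.pull_sub, ← Umbilical.pull_smul]
    rfl
  -- The pointwise objects agree by definition with the differential ones: `weylT` of `riemann` is
  -- `weyl`, and `zedT`, `omegaT` become `Zed`, `Omega` for `x = ξ` and `N = ∇ξ`.
  exact Umbilical.debever_and_eigen_of_curvature hr hP hPη hPu
    (Umbilical.isCurv_riemann (hg x hx)) (Umbilical.weyl_real (hg x hx))
    (fun d c => (Umbilical.curv_action (hg x hx) _ d c).trans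
      (Umbilical.curv_of_covM_eq (hg x hx) (hsu x hx)
        (Umbilical.xi_smooth (hg x hx) (hsu x hx)) hcov d c)) hI hZ hΩ hV
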